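/- Let $n$ be a positive integer and let $\alpha=(\alpha_1,\dots,\alpha_m)$ be a composition of $n$, that is, a sequence of positive integers with sum $n$. Let $\mathfrak S_\alpha$ be the set of words $w=w_1w_2\cdots w_n$ that are rearrangements of the multiset $\{1^{\alpha_1},2^{\alpha_2},\dots,m^{\alpha_m}\}$, where $i^{\alpha_i}$ means $\alpha_i$ copies of $i$. For $w\in\mathfrak S_\alpha$ let $a_1a_2\cdots a_n$ be its nondecreasing rearrangement. - $\mathsf{Rlwmin}(w)$ is the multiset of weak right-to-left minima of $w$, i.e. of the letters $w_i$, one for each position $i$ such that $w_i\le w_j$ for all $j>i$. For a multiset $R$ put $\mathfrak S_{\alpha,R}=\{w\in\mathfrak S_\alpha:\mathsf{Rlwmin}(w)=R\}$. - $\mathsf{Des}(w)=\{i: 1\le i\le n-1,\ w_i>w_{i+1}\}$, $\mathsf{des}(w)=|\mathsf{Des}(w)|$ and $\mathsf{maj}(w)=\sum_{i\in\mathsf{Des}(w)}i$. - $\mathsf{Exc}(w)=\{i: 1\le i\le n,\ w_i>a_i\}$ and $\mathsf{exc}(w)=|\mathsf{Exc}(w)|$. Let $\mathrm{EXCL}(w)$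 be the subword of $w$ formed by the letters in the positions of $\mathsf{Exc}(w)$, and $\mathrm{NEXCL}(w)$ the subword formed by the remaining letters. For a word $u$ let $\mathsf{inv}(u)=|\{(i,j):i<j,\ u_i>u_j\}|$ and $\mathsf{imv}(u)=|\{(i,j):i<j,\ u_i\ge u_j\}|$. Then $$\mathsf{den}(w)=\sum_{i\in\mathsf{Exc}(w)}i+\mathsf{imv}(\mathrm{EXCL}(w))+\mathsf{inv}(\mathrm{NEXCL}(w)).$$ - The value of the $i$-th letter is $v_i=1+|\{j:w_j<w_i\}|+|\{j<i:w_j=w_i\}|$, and $\mathsf{Dbot}(w)=\sum_{i\in\mathsf{Des}(w)}v_{i+1}$. A proper descent block of $w$ is a maximal contiguous strictly decreasing subword $w_p>w_{p+1}>\dots>w_q$ with $p<q$. The embracing number $e_i$ is the number of proper descent blocks $w_p\cdots w_q$ with $i<p$ and $w_p\ge w_i>w_q$. Then $$\mathsf{mak}(w)=\mathsf{Dbot}(w)+\sum_{i=1}^n e_i.$$ Then, for every composition $\alpha$ of $n$ and every multiset $R$, as polynomials in the indeterminates $t$ and $q$, $$\sum_{w\in\mathfrak S_{\alpha,R}}t^{\mathsf{des}(w)}q^{\mathsf{maj}(w)}=\sum_{w\in\mathfrak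 S_{\alpha,R}}t^{\mathsf{exc}(w)}q^{\mathsf{den}(w)}=\sum_{w\in\mathfrak S_{\alpha,R}}t^{\mathsf{des}(w)}q^{\mathsf{mak}(w)}.$$ -/

import Mathlib

namespace WordStat

/-- The letter `w_i` of the word `w = w_1 w_2 … w_n`; positions are counted from `1`,
and this is only used for `1 ≤ i ≤ n`. -/
def letter (w : List ℕ) (i : ℕ) : ℕ := w.getD (i - 1) 0

/-- The set `{1, …, n}` of positions of a word of length `n`. -/
def positions (w : List ℕ) : Finset ℕ := Finset.Icc 1 w.length

/-- The multiset `{1^{α_1}, 2^{α_2}, …, m^{α_m}}` of a composition `α = (α_1, …, α_m)`. -/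
def contentMultiset {n : ℕ} (α : Composition n) : Multiset ℕ :=
  ∑ i : Fin α.length, Multiset.replicate (α.blocksFun i) ((i : ℕ) + 1)

/-- The set of all words (multipermutations) of the multiset of `α`. -/
def words {n : ℕ} (α : Composition n) : Finset (List ℕ) := (contentMultiset α).lists.toFinset

theorem mem_words {n : ℕ} (α : Composition n) (w : List ℕ) :
    w ∈ words α ↔ (w : Multiset ℕ) = contentMultiset α := by
  unfold words
  rw [Multiset.mem_toFinset, Multiset.mem_lists_iff]
  exact eq_comm

/-- The multiset of weak right-to-left minima: the letters `w_i` with `w_i ≤ w_j` for all `j > i`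
(for `i = n` the condition is empty). -/
def Rlwmin (w : List ℕ) : Multiset ℕ :=
  ((positions w).filter
    (fun i => ∀ j ∈ positions w, i < j → letter w i ≤ letter w j)).val.map (letter w)

/-- The words of the multiset of `α` whose multiset of weak right-to-left minima is `R`. -/
def wordsR {n : ℕ} (α : Composition n) (R : Multiset ℕ) : Finset (List ℕ) :=
  (words α).filter (fun w => Rlwmin w = R)

/-- The descent set: positions `1 ≤ i ≤ n - 1` with `w_i > w_{i+1}`. -/
def Des (w : List ℕ) : Finset ℕ :=
  (Finset.Ico 1 w.length).filter (fun i => letter w (i + 1) < letter w i)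

/-- The number of descents. -/
def des (w : List ℕ) : ℕ := (Des w).card

/-- The major index. -/
def maj (w : List ℕ) : ℕ := ∑ i ∈ Des w, i

/-- The nondecreasing rearrangement `a_1 a_2 … a_n` of `w`. -/
def rearr (w : List ℕ) : List ℕ := w.insertionSort (· ≤ ·)

/-- The excedance set: positions `i` with `w_i > a_i`. -/
def Exc (w : List ℕ) : Finset ℕ :=
  (positions w).filter (fun i => letter (rearr w) i < letter w i)

/-- The number of excedances. -/
def exc (w : List ℕ) : ℕ := (Exc w).card

/-- The number of inversions: pairs `i < j` with `w_i > w_j`. -/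
def inv (w : List ℕ) : ℕ :=
  ((positions w ×ˢ positions w).filter
    (fun p => p.1 < p.2 ∧ letter w p.2 < letter w p.1)).card

/-- The number of weak inversions: pairs `i < j` with `w_i ≥ w_j`. -/
def imv (w : List ℕ) : ℕ :=
  ((positions w ×ˢ positions w).filter
    (fun p => p.1 < p.2 ∧ letter w p.2 ≤ letter w p.1)).card

/-- The subsequence of `w` formed by the letters at excedance positions. -/
def excl (w : List ℕ) : List ℕ :=
  ((List.range' 1 w.length).filter (fun i => i ∈ Exc w)).map (letter w)

/-- The subsequence of `w` formed by the letters at the other positions. -/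
def nexcl (w : List ℕ) : List ℕ :=
  ((List.range' 1 w.length).filter (fun i => i ∉ Exc w)).map (letter w)

/-- Denert's statistic on words. -/
def den (w : List ℕ) : ℕ := (∑ i ∈ Exc w, i) + imv (excl w) + inv (nexcl w)

/-- The height of the letter `a` in `w`: one more than the number of letters of `w` that are
smaller than `a`. -/
def height (w : List ℕ) (a : ℕ) : ℕ := w.countP (fun b => b < a) + 1

/-- The value of the `i`-th letter: its height plus the number of letters equal to it on its
left. -/
def value (w : List ℕ) (i : ℕ) : ℕ :=
  height w (letter w i) + ((Finset.Ico 1 i).filter (fun j => letter w j = letter w i)).card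

/-- The descent bottoms sum: the sum of the values of the descent bottoms `w_{i+1}`. -/
def Dbot (w : List ℕ) : ℕ := ∑ i ∈ Des w, value w (i + 1)

/-- The proper descent blocks, i.e. the maximal runs `w_p > w_{p+1} > … > w_q` with `p < q`,
as pairs `(p, q)`. Their closer is `w_p` and their opener is `w_q`. Maximality says that neither
`p - 1` nor `q` is a descent (which is automatic for `p = 1` and for `q = n`). -/
def properBlocks (w : List ℕ) : Finset (ℕ × ℕ) :=
  (positions w ×ˢ positions w).filter
    (fun B => B.1 < B.2 ∧ (∀ i ∈ Finset.Ico B.1 B.2, i ∈ Des w) ∧ B.1 - 1 ∉ Des w ∧ B.2 ∉ Des w)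

/-- The embracing number `e_i`: the number of proper descent blocks strictly to the right of
position `i` whose closer is `≥ w_i` and whose opener is `< w_i`. -/
def embracing (w : List ℕ) (i : ℕ) : ℕ :=
  ((properBlocks w).filter
    (fun B => i < B.1 ∧ letter w i ≤ letter w B.1 ∧ letter w B.2 < letter w i)).card

/-- The embracing sum. -/
def Res (w : List ℕ) : ℕ := ∑ i ∈ positions w, embracing w i

/-- The statistic `mak` on words. -/
def mak (w : List ℕ) : ℕ := Dbot w + Res w

end WordStat

/-! Attach a variable `z a` to each weak right-to-left minimum `a`. Since distinct multisets `R`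
give distinct monomials in the `z`, it suffices to prove the equalities for the sums over all words
of the given content, weighted by these monomials.

Words are built by adding all `c` copies of the next largest letter `x` at once to words whose
content `s` has `N` letters, all below `x`. For `mak` and `den` the step becomes transparent when
words also carry `H` placeholders `B`, larger than every letter, which later letters may replace.
For `mak`, each `B` must be followed immediately by an ordinary letter. For `den`, the word has `N +
H` letters, is compared with the `N` letters of the sorted content, and has all its `B` among the
first `N` positions: they are excedances whose letter is not yet decided. Let `V H` be the resulting
generating function.

Of the `c` letters `x`, some `p` replace placeholders, and the other `c - p` are inserted without
creating a descent or an excedance. Afterwards the new letters or positions make room for new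
placeholders. If `o` placeholders remain before the last stage and `H = o + p`, the weights are the
elementary symmetric `e_p(1, q, …, q^(H-1))` (`selCoeff`), the complete homogeneous `h_(c-p)(z x, q,
…, q^H)` (`shufCoeff`), and `t^r e_r(q^(N+1), …, q^(N+c))` for `r` new placeholders (`openCoeff`).
They are the same for both statistics, so both sequences evolve under one operator `transfer`
(`makGF_eq_transfer`, `denGF_eq_transfer`) and coincide.

For `maj` there are no placeholders, and only `V 0` is accessible. But `V 0` determines `V`: with
`τ` the substitution of `q t` for `t`, the sequence satisfies `ShiftRec`, a recurrence in `H` that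
`transfer` preserves (`ShiftRec.transfer`). Hence the new initial term obeys a recurrence in `c`
which involves only `τ` and the old initial term (`fillSum'_succ`, `transfer_zero_eq`). Inserting
`c` maximal letters into a fixed word obeys the same recurrence for `(des, maj)` (`majIns'_rec`).
The induction over `x` is `gf_eq_and_shiftRec`, and the theorem is its case `H = 0`. -/

namespace WordStat

/-! ### The placeholder recurrence, the three families of `q`-coefficients and the transfer operator
-/

section Algebra

variable {A : Type*} [CommRing A]

/-- The operator `v ↦ q^(N+1) t v + q (1-t) τ(v)`. -/
def shiftOp (q t : A) (τ : A →+* A) (N : ℕ) (v : A) : A :=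
  q ^ (N + 1) * t * v + q * (1 - t) * τ v

/-- The recurrence which determines the sequence `V` from its initial term. -/
def ShiftRec (q t : A) (τ : A →+* A) (N : ℕ) (V : ℕ → A) : Prop :=
  ∀ H, (1 - q ^ (H + 1)) * V (H + 1) = q ^ (H + 1) * V H - shiftOp q t τ N (V H)

theorem shiftOp_add (q t : A) (τ : A →+* A) (N : ℕ) (v w : A) :
    shiftOp q t τ N (v + w) = shiftOp q t τ N v + shiftOp q t τ N w := by
  simp only [shiftOp, map_add]; ring

theorem shiftOp_zero (q t : A) (τ : A →+* A) (N : ℕ) : shiftOp q t τ N 0 = 0 := by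
  simp [shiftOp]

theorem shiftOp_mul (q t : A) (τ : A →+* A) (N : ℕ) {a : A} (ha : τ a = a) (v : A) :
    shiftOp q t τ N (a * v) = a * shiftOp q t τ N v := by
  simp only [shiftOp, map_mul, ha]; ring

theorem shiftOp_sub (q t : A) (τ : A →+* A) (N : ℕ) (v w : A) :
    shiftOp q t τ N (v - w) = shiftOp q t τ N v - shiftOp q t τ N w := by
  simp only [shiftOp, map_sub]; ring

theorem shiftOp_sum {ι : Type*} (q t : A) (τ : A →+* A) (N : ℕ) (s : Finset ι) (f : ι → A) :
    shiftOp q t τ N (∑ i ∈ s, f i) = ∑ i ∈ s, shiftOp q t τ N (f i) := by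
  simp only [shiftOp, map_sum, Finset.mul_sum, Finset.sum_add_distrib]

/-- Moving `t` through `shiftOp` lowers the index. -/
theorem shiftOp_t_mul {q t : A} {τ : A →+* A} (ht : τ t = q * t) (N : ℕ) (v : A) :
    shiftOp q t τ (N + 1) (t * v) = q * t * shiftOp q t τ N v := by
  simp only [shiftOp, map_mul, ht]; ring

/-- Allowing one more position to carry the largest letter. -/
def openStep (q t : A) (N : ℕ) (V : ℕ → A) : ℕ → A
  | 0 => V 0
  | H + 1 => V (H + 1) + t * q ^ (N + 1) * V H

/-- The weight `t * q ^ (N + 1)` fits the shift: because `τ t = q * t`, a factor `t` passes through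
`shiftOp` while lowering its index by one. The new recurrence at `H + 1` is then a combination of
the old ones at `H` and `H + 1`. -/
theorem ShiftRec.openStep {q t : A} {τ : A →+* A} (hq : τ q = q) (ht : τ t = q * t) {N : ℕ}
    {V : ℕ → A} (h : ShiftRec q t τ N V) : ShiftRec q t τ (N + 1) (openStep q t N V) := by
  intro H
  rcases H with _ | H
  · have h0 := h 0
    simp only [WordStat.openStep, shiftOp] at h0 ⊢
    linear_combination h0
  · have h0 := h H
    have h1 := h (H + 1)
    have hp : τ (q ^ (N + 1)) = q ^ (N + 1) := by rw [map_pow, hq]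
    have e : t * q ^ (N + 1) * V H = q ^ (N + 1) * (t * V H) := by ring
    simp only [WordStat.openStep, shiftOp_add]
    rw [e, shiftOp_mul _ _ _ _ hp, shiftOp_t_mul ht]
    simp only [shiftOp] at h0 h1 ⊢
    linear_combination h1 + t * q ^ (N + 2) * h0

/-- Coefficients of `∏_{l=1}^{c} (1 + t q^(N+l) S)`. -/
def openCoeff (q t : A) : ℕ → ℕ → ℕ → A
  | _, 0, 0 => 1
  | _, 0, _ + 1 => 0
  | N, c + 1, 0 => openCoeff q t (N + 1) c 0
  | N, c + 1, r + 1 =>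
    openCoeff q t (N + 1) c (r + 1) + t * q ^ (N + 1) * openCoeff q t (N + 1) c r

theorem openCoeff_zero (q t : A) (N c : ℕ) : openCoeff q t N c 0 = 1 := by
  induction c generalizing N with
  | zero => simp [openCoeff]
  | succ c ih => simp [openCoeff, ih]

/-- The coefficients are `t ^ r * e_r(q^(N+1), …, q^(N+c))`. The definition splits off the first
variable, whereas `openSteps` adds positions at the far end and needs the last one split off. -/
theorem openCoeff_succ_right (q t : A) (N c r : ℕ) :
    openCoeff q t N (c + 1) (r + 1) =
      openCoeff q t N c (r + 1) + t * q ^ (N + c + 1) * openCoeff q t N c r := by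
  induction c generalizing N r with
  | zero => cases r <;> simp [openCoeff]
  | succ c ih =>
    rw [openCoeff, ih, openCoeff]
    cases r with
    | zero =>
      simp only [openCoeff_zero]
      ring
    | succ r =>
      rw [ih, openCoeff]; ring

theorem openCoeff_shift (q t : A) (N c r : ℕ) :
    openCoeff q t (N + 1) c r = q ^ r * openCoeff q t N c r := by
  induction c generalizing N r with
  | zero => cases r <;> simp [openCoeff]
  | succ c ih =>
    cases r with
    | zero => simp [openCoeff_zero]
    | succ r => rw [openCoeff, openCoeff, ih (N + 1), ih (N + 1)]; ring

theorem openCoeff_succ_left (q t : A) (N c r : ℕ) :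
    openCoeff q t N (c + 1) (r + 1) =
      q ^ (r + 1) * openCoeff q t N c (r + 1) + t * q ^ (N + 1) * (q ^ r * openCoeff q t N c r) := by
  rw [openCoeff, openCoeff_shift, openCoeff_shift]

/-- Iterating `openStep`. -/
def openSteps (q t : A) (N : ℕ) (V : ℕ → A) : ℕ → ℕ → A
  | 0 => V
  | c + 1 => openStep q t (N + c) (openSteps q t N V c)

theorem ShiftRec.openSteps {q t : A} {τ : A →+* A} (hq : τ q = q) (ht : τ t = q * t) {N : ℕ}
    {V : ℕ → A} (h : ShiftRec q t τ N V) (c : ℕ) :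
    ShiftRec q t τ (N + c) (openSteps q t N V c) := by
  induction c with
  | zero => exact h
  | succ c ih => exact ih.openStep hq ht

theorem openSteps_zero (q t : A) (N : ℕ) (V : ℕ → A) (c : ℕ) : openSteps q t N V c 0 = V 0 := by
  induction c with
  | zero => rfl
  | succ c ih => simp [openSteps, openStep, ih]

theorem openSteps_eq_sum (q t : A) (N : ℕ) (V : ℕ → A) (c H : ℕ) :
    openSteps q t N V c H =
      ∑ r ∈ Finset.range (H + 1), openCoeff q t N c r * V (H - r) := by
  induction c generalizing H with
  | zero =>
    rw [Finset.sum_range_succ']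
    simp [openSteps, openCoeff]
  | succ c ih =>
    cases H with
    | zero => simp [openSteps, openStep, ih, openCoeff_zero]
    | succ H =>
      rw [openSteps, openStep, ih, ih, Finset.sum_range_succ', Finset.sum_range_succ' _ (H + 1)]
      simp only [openCoeff_succ_right, openCoeff_zero, add_mul, Finset.sum_add_distrib,
        Finset.mul_sum, Nat.add_sub_add_right]
      rw [show ∑ i ∈ Finset.range (H + 1), t * q ^ (N + c + 1) * (openCoeff q t N c i * V (H - i))
        = ∑ i ∈ Finset.range (H + 1), t * q ^ (N + c + 1) * openCoeff q t N c i * V (H - i) from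
          Finset.sum_congr rfl fun i _ => by ring]
      ring

/-- The generating function of the ways to select `p` of `H` marked places. -/
def selCoeff (q : A) : ℕ → ℕ → A
  | 0, 0 => 1
  | 0, _ + 1 => 0
  | H + 1, 0 => selCoeff q H 0
  | H + 1, p + 1 => q ^ (p + 1) * selCoeff q H (p + 1) + q ^ p * selCoeff q H p

theorem selCoeff_zero (q : A) (H : ℕ) : selCoeff q H 0 = 1 := by
  induction H with
  | zero => simp [selCoeff]
  | succ H ih => simp [selCoeff, ih]

theorem selCoeff_succ_left (q : A) (H p : ℕ) :
    selCoeff q (H + 1) (p + 1) = q ^ (p + 1) * selCoeff q H (p + 1) + q ^ p * selCoeff q H p := by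
  rw [selCoeff]

/-- In `selCoeff q H p = e_p(1, q, …, q^(H-1))` the defining recursion removes the variable `1`, and
this one removes the highest power. The `den` side uses the former, the `mak` side the latter. -/
theorem selCoeff_succ (q : A) (H p : ℕ) :
    selCoeff q (H + 1) (p + 1) = selCoeff q H (p + 1) + q ^ H * selCoeff q H p := by
  induction H generalizing p with
  | zero => cases p <;> simp [selCoeff]
  | succ H ih =>
    have e1 := selCoeff_succ_left q (H + 1) p
    have e2 := selCoeff_succ_left q H p
    have e3 := ih p
    cases p with
    | zero =>
      simp only [selCoeff_zero] at *
      linear_combination e1 + q * e3 - e2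
    | succ p =>
      have e4 := ih p
      have e5 := selCoeff_succ_left q H p
      linear_combination e1 + q ^ (p + 2) * e3 + q ^ (p + 1) * e4 - e2 - q ^ (H + 1) * e5

/-- A `q`-analogue of the absorption identity `(p+1) * C(H+1, p+1) = (H+1) * C(H, p)`. -/
theorem selCoeff_mul (q : A) (H p : ℕ) :
    (1 - q ^ (p + 1)) * selCoeff q (H + 1) (p + 1) =
      q ^ p * (1 - q ^ (H + 1)) * selCoeff q H p := by
  induction H generalizing p with
  | zero => cases p <;> simp [selCoeff]
  | succ H ih =>
    have e1 := selCoeff_succ q (H + 1) p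
    have e3 := ih p
    cases p with
    | zero =>
      simp only [selCoeff_zero] at *
      linear_combination (1 - q) * e1 + e3
    | succ p =>
      have e4 := ih p
      have e5 := selCoeff_succ q H p
      linear_combination (1 - q ^ (p + 2)) * e1 + e3 - q ^ (p + 1) * (1 - q ^ (H + 1)) * e5
        + q ^ (H + 1) * e4

/-- The generating function of the shuffles of `j` equal letters with `H` smaller ones, by
inversions and by the number of trailing letters (marked by `z`). -/
def shufCoeff (q z : A) : ℕ → ℕ → A
  | 0, j => z ^ j
  | _ + 1, 0 => 1
  | H + 1, j + 1 => q ^ (H + 1) * shufCoeff q z (H + 1) j + shufCoeff q z H (j + 1)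

theorem shufCoeff_zero (q z : A) (H : ℕ) : shufCoeff q z H 0 = 1 := by
  cases H <;> simp [shufCoeff]

/-- `shufCoeff` without trailing letters. -/
def shufCoeff' (q : A) : ℕ → ℕ → A := shufCoeff q 0

theorem shufCoeff_succ_succ (q z : A) (H j : ℕ) :
    shufCoeff q z (H + 1) (j + 1) = q ^ (H + 1) * shufCoeff q z (H + 1) j
      + shufCoeff q z H (j + 1) := by
  rw [shufCoeff]

/-- This removes the variable `z` from `h_(j+1)(z, q, …, q^H)`: either some letter is trailing, or
none is. -/
theorem shufCoeff_succ (q z : A) (H j : ℕ) :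
    shufCoeff q z H (j + 1) = z * shufCoeff q z H j + shufCoeff' q H (j + 1) := by
  induction H generalizing j with
  | zero => simp [shufCoeff, shufCoeff', pow_succ']
  | succ H ih =>
    have e1 := shufCoeff_succ_succ q z H j
    have e2 := shufCoeff_succ_succ q 0 H j
    have e3 := ih j
    unfold shufCoeff' at *
    induction j with
    | zero =>
      simp only [shufCoeff_zero] at *
      linear_combination e1 - e2 + e3
    | succ j ihj =>
      have e4 := shufCoeff_succ_succ q z H j
      have e5 := ihj e4 (shufCoeff_succ_succ q 0 H j) (ih j)
      linear_combination e1 - e2 + e3 + q ^ (H + 1) * e5 - z * e4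

/-- The absorption identity for `h_j(q, …, q^H)`, which is `q^j` times the Gaussian binomial of `H +
j - 1` over `j`. -/
theorem shufCoeff'_mul (q : A) (H j : ℕ) :
    (1 - q ^ (j + 1)) * shufCoeff' q H (j + 1) = q * (1 - q ^ (H + j)) * shufCoeff' q H j := by
  unfold shufCoeff'
  induction H generalizing j with
  | zero => cases j <;> simp [shufCoeff]
  | succ H ih =>
    have e1 := shufCoeff_succ_succ q 0 H j
    have e2 := ih j
    induction j with
    | zero =>
      simp only [shufCoeff_zero] at *
      linear_combination (1 - q) * e1 + e2
    | succ j ihj =>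
      have e3 := shufCoeff_succ_succ q 0 H j
      have e4 := ihj e3 (ih j)
      linear_combination (1 - q ^ (j + 2)) * e1 + e2 - q * (1 - q ^ (H + j + 1)) * e3
        + q ^ (H + 1) * e4

/-- Filling places: the sequence obtained by adding `c` copies of a new largest letter. -/
def fillSum (q z : A) (V : ℕ → A) (c o : ℕ) : A :=
  ∑ p ∈ Finset.range (c + 1), selCoeff q (o + p) p * shufCoeff q z (o + p) (c - p) * V (o + p)

theorem fillSum_zero (q z : A) (V : ℕ → A) (o : ℕ) : fillSum q z V 0 o = V o := by
  simp [fillSum, selCoeff_zero, shufCoeff_zero]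

theorem fillSum_succ (q z : A) (V : ℕ → A) (c o : ℕ) :
    fillSum q z V (c + 1) o = z * fillSum q z V c o + fillSum q 0 V (c + 1) o := by
  unfold fillSum
  have key : ∑ p ∈ Finset.range (c + 1),
      selCoeff q (o + p) p * shufCoeff q z (o + p) (c + 1 - p) * V (o + p) =
      ∑ p ∈ Finset.range (c + 1),
        z * (selCoeff q (o + p) p * shufCoeff q z (o + p) (c - p) * V (o + p)) +
      ∑ p ∈ Finset.range (c + 1),
        selCoeff q (o + p) p * shufCoeff q 0 (o + p) (c + 1 - p) * V (o + p) := by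
    rw [← Finset.sum_add_distrib]
    refine Finset.sum_congr rfl fun p hp => ?_
    have hp' : c + 1 - p = (c - p) + 1 := by have := Finset.mem_range.1 hp; omega
    rw [hp', shufCoeff_succ q z]
    unfold shufCoeff'; ring
  rw [Finset.sum_range_succ, Finset.sum_range_succ _ (c + 1), Finset.mul_sum, key, Nat.sub_self,
    shufCoeff_zero, shufCoeff_zero]
  ring

/-- `ShiftRec` rewrites `shiftOp (V H)` through `V H` and `V (H + 1)`, and the coefficients of each
`V (o + p)` then agree by the two absorption identities. The resulting recurrence in `c` mentions no
index other than `o`, which is what makes it comparable with `maj`, where only `o = 0` is available.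
-/
theorem fillSum'_succ {q t : A} {τ : A →+* A} (hq : τ q = q) {N : ℕ} {V : ℕ → A}
    (h : ShiftRec q t τ N V) (c o : ℕ) :
    (1 - q ^ (c + 1)) * fillSum q 0 V (c + 1) o =
      q * fillSum q 0 V c o - q ^ c * shiftOp q t τ N (fillSum q 0 V c o) := by
  have hsel : ∀ H p, τ (selCoeff q H p) = selCoeff q H p := by
    intro H
    induction H with
    | zero => intro p; cases p <;> simp [selCoeff]
    | succ H ih => intro p; cases p <;> simp [selCoeff, ih, hq]
  have hshuf : ∀ H p, τ (shufCoeff q 0 H p) = shufCoeff q 0 H p := by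
    intro H
    induction H with
    | zero => intro p; simp [shufCoeff]
    | succ H ih =>
      intro p
      induction p with
      | zero => simp [shufCoeff]
      | succ p ihp => simp [shufCoeff, ih, ihp, hq]
  have hshift : ∀ H, shiftOp q t τ N (V H) =
      q ^ (H + 1) * V H - (1 - q ^ (H + 1)) * V (H + 1) := by
    intro H; linear_combination h H
  unfold fillSum
  rw [shiftOp_sum]
  have e1 : ∀ p, shiftOp q t τ N (selCoeff q (o + p) p * shufCoeff q 0 (o + p) (c - p) * V (o + p))
      = selCoeff q (o + p) p * shufCoeff q 0 (o + p) (c - p) *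
        (q ^ (o + p + 1) * V (o + p) - (1 - q ^ (o + p + 1)) * V (o + p + 1)) := by
    intro p
    rw [shiftOp_mul _ _ _ _ (by rw [map_mul, hsel, hshuf]), hshift]
  simp only [e1]
  -- `F` is cut off at `p = c + 1`, where `c - p` would truncate, so that both sides are sums over
  -- the same range and a shift of index can be applied.
  set F : ℕ → A := fun p => if p < c + 1 then q * (1 - q ^ (c + (o + p))) *
    (selCoeff q (o + p) p * shufCoeff q 0 (o + p) (c - p) * V (o + p)) else 0 with hF
  have hF1 : ∑ p ∈ Finset.range (c + 1 + 1), F p = ∑ p ∈ Finset.range (c + 1),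
      q * (1 - q ^ (c + (o + p))) *
        (selCoeff q (o + p) p * shufCoeff q 0 (o + p) (c - p) * V (o + p)) := by
    rw [Finset.sum_range_succ]
    simp only [hF, lt_irrefl, if_false, add_zero]
    exact Finset.sum_congr rfl fun p hp => if_pos (Finset.mem_range.1 hp)
  have key : (1 - q ^ (c + 1)) * ∑ p ∈ Finset.range (c + 1 + 1),
      selCoeff q (o + p) p * shufCoeff q 0 (o + p) (c + 1 - p) * V (o + p) =
      ∑ p ∈ Finset.range (c + 1 + 1), F p + ∑ p ∈ Finset.range (c + 1),
        q ^ c * (1 - q ^ (o + p + 1)) * (selCoeff q (o + p) p * shufCoeff q 0 (o + p) (c - p)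
          * V (o + p + 1)) := by
    rw [Finset.sum_range_succ', Finset.sum_range_succ' F, add_right_comm,
      ← Finset.sum_add_distrib, mul_add, Finset.mul_sum]
    congr 1
    · refine Finset.sum_congr rfl fun p hp => ?_
      have e2 := selCoeff_mul q (o + p) p
      simp only [hF]
      split_ifs with hpc
      -- Since `c + 1 = (p + 1) + (j + 1)`, the factor splits as `1 - q^(c+1) = (1 - q^(j+1)) +
      -- q^(j+1) * (1 - q^(p+1))`. The first part is absorbed by `shufCoeff`, the second by
      -- `selCoeff`.
      · obtain ⟨j, rfl⟩ : ∃ j, c = p + 1 + j := ⟨c - (p + 1), by omega⟩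
        have e1 := shufCoeff'_mul q (o + p + 1) j
        have e3 := shufCoeff_succ_succ q 0 (o + p) j
        unfold shufCoeff' at e1
        rw [show p + 1 + j + 1 - (p + 1) = j + 1 by omega, show p + 1 + j - p = j + 1 by omega,
          show p + 1 + j - (p + 1) = j by omega, ← add_assoc]
        linear_combination V (o + p + 1) * (selCoeff q (o + p + 1) (p + 1) * e1
          + q ^ (j + 1) * shufCoeff q 0 (o + p) (j + 1) * e2
          + q ^ (j + 1) * (1 - q ^ (p + 1)) * selCoeff q (o + p + 1) (p + 1) * e3)
      · have : p = c := by have := Finset.mem_range.1 hp; omega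
        subst this
        rw [Nat.sub_self, Nat.sub_self, shufCoeff_zero, shufCoeff_zero, ← add_assoc]
        linear_combination V (o + p + 1) * e2
    · have e1 := shufCoeff'_mul q o c
      unfold shufCoeff' at e1
      simp only [hF, Nat.zero_lt_succ, if_true, add_zero, selCoeff_zero, Nat.sub_zero]
      linear_combination V o * e1
  rw [key, hF1, Finset.mul_sum, Finset.mul_sum, ← Finset.sum_add_distrib, ← Finset.sum_sub_distrib]
  refine Finset.sum_congr rfl fun p _ => ?_
  ring

/-- By `fillSum'_succ`, the next sequence times `1 - q^(c+1)` is the operator `q - q^c * shiftOp`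
applied to the current one. That operator commutes with everything in the recurrence because `τ`
fixes `q`, so the recurrence carries over once the nonzero factor is cancelled. -/
theorem ShiftRec.fillSum' [IsDomain A] {q t : A} {τ : A →+* A} (hq : τ q = q)
    (hq1 : ∀ k, 1 - q ^ (k + 1) ≠ 0) {N : ℕ} {V : ℕ → A}
    (h : ShiftRec q t τ N V) (c : ℕ) : ShiftRec q t τ N (fillSum q 0 V c) := by
  induction c with
  | zero =>
    intro H
    simp only [fillSum_zero]
    exact h H
  | succ c ih =>
    intro H
    apply mul_left_cancel₀ (hq1 c)
    have hs : τ (1 - q ^ (c + 1)) = 1 - q ^ (c + 1) := by simp [hq]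
    have e1 := fillSum'_succ hq h c (H + 1)
    have e2 := fillSum'_succ hq h c H
    have e3 := ih H
    have hp : ∀ k, τ (q ^ k) = q ^ k := fun k => by rw [map_pow, hq]
    have e4 : shiftOp q t τ N ((1 - q ^ (c + 1)) * fillSum q 0 V (c + 1) H) =
      q * shiftOp q t τ N (fillSum q 0 V c H)
        - q ^ c * shiftOp q t τ N (shiftOp q t τ N (fillSum q 0 V c H)) := by
      rw [e2, shiftOp_sub, shiftOp_mul _ _ _ _ hq, shiftOp_mul _ _ _ _ (hp c)]
    have e5 : shiftOp q t τ N ((1 - q ^ (H + 1)) * fillSum q 0 V c (H + 1)) =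
        q ^ (H + 1) * shiftOp q t τ N (fillSum q 0 V c H)
          - shiftOp q t τ N (shiftOp q t τ N (fillSum q 0 V c H)) := by
      rw [e3, shiftOp_sub, shiftOp_mul _ _ _ _ (hp _)]
    rw [shiftOp_mul _ _ _ _ hs] at e4
    rw [shiftOp_mul _ _ _ _ (by simp [hq])] at e5
    linear_combination (1 - q ^ (H + 1)) * e1 - q ^ (H + 1) * e2 + q * e3 + e4 - q ^ c * e5

theorem ShiftRec.fillSum [IsDomain A] {q t z : A} {τ : A →+* A} (hq : τ q = q) (hz : τ z = z)
    (hq1 : ∀ k, 1 - q ^ (k + 1) ≠ 0) {N : ℕ} {V : ℕ → A}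
    (h : ShiftRec q t τ N V) (c : ℕ) : ShiftRec q t τ N (fillSum q z V c) := by
  induction c with
  | zero =>
    intro H
    simp only [fillSum_zero]
    exact h H
  | succ c ih =>
    intro H
    rw [fillSum_succ q z, fillSum_succ q z, shiftOp_add, shiftOp_mul _ _ _ _ hz]
    linear_combination z * ih H + h.fillSum' hq hq1 (c + 1) H

/-- Adding `c` copies of a new largest letter to words with `N` letters. -/
def transfer (q t z : A) (N c : ℕ) (V : ℕ → A) : ℕ → A :=
  openSteps q t N (fillSum q z V c) c

theorem ShiftRec.transfer [IsDomain A] {q t z : A} {τ : A →+* A} (hq : τ q = q) (ht : τ t = q * t)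
    (hz : τ z = z) (hq1 : ∀ k, 1 - q ^ (k + 1) ≠ 0) {N : ℕ} {V : ℕ → A}
    (h : ShiftRec q t τ N V) (c : ℕ) : ShiftRec q t τ (N + c) (transfer q t z N c V) :=
  (h.fillSum hq hz hq1 c).openSteps hq ht c

/-- The initial term of the transferred sequence is determined by the initial term of `V`. -/
theorem transfer_zero_eq [IsDomain A] {q t z : A} {τ : A →+* A} (hq : τ q = q)
    (hq1 : ∀ k, 1 - q ^ (k + 1) ≠ 0) {N : ℕ} {V : ℕ → A} (h : ShiftRec q t τ N V)
    {T D : ℕ → A} (hT0 : T 0 = V 0) (hD0 : D 0 = V 0)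
    (hT : ∀ c, T (c + 1) = z * T c + D (c + 1))
    (hD : ∀ c, (1 - q ^ (c + 1)) * D (c + 1) = q * D c - q ^ c * shiftOp q t τ N (D c)) (c : ℕ) :
    T c = WordStat.transfer q t z N c V 0 := by
  have hD' : ∀ c, D c = WordStat.fillSum q 0 V c 0 := by
    intro c
    induction c with
    | zero => rw [hD0, fillSum_zero]
    | succ c ih =>
      apply mul_left_cancel₀ (hq1 c)
      rw [hD, fillSum'_succ hq h, ih]
  rw [WordStat.transfer, openSteps_zero]
  induction c with
  | zero => rw [hT0, fillSum_zero]
  | succ c ih => rw [hT, ih, fillSum_succ, hD']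

end Algebra

/-! ### Words of given content and the insertion of copies of one letter -/

section Words

/-- The words with content `s`. -/
def perms (s : Multiset ℕ) : Finset (List ℕ) := s.lists.toFinset

theorem mem_perms {s : Multiset ℕ} {w : List ℕ} : w ∈ perms s ↔ (w : Multiset ℕ) = s := by
  unfold perms
  rw [Multiset.mem_toFinset, Multiset.mem_lists_iff]
  exact eq_comm

/-- Prepend a letter to all words of a set. -/
def consF (b : ℕ) (S : Finset (List ℕ)) : Finset (List ℕ) :=
  S.map ⟨List.cons b, List.cons_injective⟩

theorem mem_consF {b : ℕ} {S : Finset (List ℕ)} {w : List ℕ} :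
    w ∈ consF b S ↔ ∃ l ∈ S, b :: l = w := by
  simp [consF]

@[simp] theorem cons_mem_consF {b c : ℕ} {S : Finset (List ℕ)} {w : List ℕ} :
    c :: w ∈ consF b S ↔ b = c ∧ w ∈ S := by
  simp [consF, and_comm, eq_comm]

@[simp] theorem nil_notMem_consF {b : ℕ} {S : Finset (List ℕ)} : [] ∉ consF b S := by
  simp [consF]

theorem sum_consF {M : Type*} [AddCommMonoid M] (b : ℕ) (S : Finset (List ℕ)) (f : List ℕ → M) :
    ∑ w ∈ consF b S, f w = ∑ w ∈ S, f (b :: w) := by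
  simp [consF]

theorem disjoint_consF {b c : ℕ} (h : b ≠ c) (S T : Finset (List ℕ)) :
    Disjoint (consF b S) (consF c T) := by
  rw [Finset.disjoint_left]
  intro w hw hw'
  obtain ⟨l, -, rfl⟩ := mem_consF.1 hw
  exact h (cons_mem_consF.1 hw').1.symm

/-- The words obtained by inserting `k` copies of `x` into `u`. -/
def ins (x : ℕ) : List ℕ → ℕ → Finset (List ℕ)
  | [], k => {List.replicate k x}
  | y :: u, 0 => {y :: u}
  | y :: u, k + 1 => consF x (ins x (y :: u) k) ∪ consF y (ins x u (k + 1))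

theorem ins_zero (x : ℕ) (u : List ℕ) : ins x u 0 = {u} := by
  cases u <;> simp [ins]

theorem mem_ins {x : ℕ} {u : List ℕ} (hu : x ∉ u) {k : ℕ} {w : List ℕ} :
    w ∈ ins x u k ↔ w.filter (· ≠ x) = u ∧ w.count x = k := by
  induction w generalizing u k with
  | nil =>
    rcases u with _ | ⟨y, u⟩
    · cases k <;> simp [ins, List.replicate_succ]
    · cases k <;> simp [ins]
  | cons b w ih =>
    rcases u with _ | ⟨y, u⟩
    · have : b :: w ∈ ins x [] k ↔ b :: w = List.replicate k x := by simp [ins]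
      rw [this, List.eq_replicate_iff, List.filter_eq_nil_iff]
      constructor
      · rintro ⟨h1, h2⟩
        refine ⟨fun a ha => by simp [h2 a ha], ?_⟩
        rw [← h1, List.count_eq_length]
        exact fun a ha => (h2 a ha).symm
      · rintro ⟨h1, h2⟩
        have h3 : ∀ a ∈ b :: w, a = x := fun a ha => by simpa using h1 a ha
        refine ⟨?_, h3⟩
        rw [← h2, eq_comm, List.count_eq_length]
        exact fun a ha => (h3 a ha).symm
    · have hy : x ≠ y := fun h => hu (by simp [h])
      have hu' : x ∉ u := fun h => hu (by simp [h])
      rcases k with _ | k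
      · rw [ins_zero, Finset.mem_singleton]
        constructor
        · rintro h
          rw [h]
          refine ⟨List.filter_eq_self.2 ?_, List.count_eq_zero.2 hu⟩
          intro a ha
          simp only [ne_eq, decide_not, Bool.not_eq_eq_eq_not, Bool.not_true, decide_eq_false_iff_not]
          rintro rfl
          exact hu ha
        · rintro ⟨h1, h2⟩
          rw [← h1, eq_comm, List.filter_eq_self]
          intro a ha
          have := List.count_eq_zero.1 h2
          simp only [ne_eq, decide_not, Bool.not_eq_eq_eq_not, Bool.not_true, decide_eq_false_iff_not]
          rintro rfl
          exact this ha
      · rw [ins, Finset.mem_union, cons_mem_consF, cons_mem_consF, ih hu, ih hu']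
        by_cases hb : b = x
        · subst hb
          simp [hy.symm]
        · have h1 : (b :: w).filter (· ≠ x) = b :: w.filter (· ≠ x) := by simp [hb]
          have h2 : (b :: w).count x = w.count x := List.count_cons_of_ne hb
          rw [h1, h2, List.cons.injEq, and_assoc]
          simp only [Ne.symm hb, false_and, false_or, eq_comm]

theorem sum_ins_succ {M : Type*} [AddCommMonoid M] {x y : ℕ} (hy : x ≠ y) (u : List ℕ) (k : ℕ)
    (f : List ℕ → M) :
    ∑ w ∈ ins x (y :: u) (k + 1), f w =
      ∑ w ∈ ins x (y :: u) k, f (x :: w) + ∑ w ∈ ins x u (k + 1), f (y :: w) := by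
  rw [ins, Finset.sum_union (disjoint_consF hy _ _), sum_consF, sum_consF]

theorem coe_ins {x : ℕ} {u : List ℕ} {k : ℕ} {w : List ℕ} (hw : w ∈ ins x u k) :
    (w : Multiset ℕ) = u + Multiset.replicate k x := by
  induction w generalizing u k with
  | nil =>
    rcases u with _ | ⟨y, u⟩
    · cases k <;> simp_all [ins, List.replicate_succ]
    · cases k <;> simp_all [ins]
  | cons b w ih =>
    rcases u with _ | ⟨y, u⟩
    · simp only [ins, Finset.mem_singleton] at hw
      rw [hw]; simp [Multiset.coe_replicate]
    · cases k with
      | zero => simp_all [ins]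
      | succ k =>
        simp only [ins, Finset.mem_union, cons_mem_consF] at hw
        rcases hw with ⟨rfl, hw⟩ | ⟨rfl, hw⟩
        · rw [← Multiset.cons_coe, ih hw, Multiset.replicate_succ, Multiset.add_cons]
        · rw [← Multiset.cons_coe, ih hw, ← Multiset.cons_coe, Multiset.cons_add]

theorem sum_perms_add {M : Type*} [AddCommMonoid M] {x : ℕ} {s : Multiset ℕ} (hx : x ∉ s) (k : ℕ)
    (f : List ℕ → M) :
    ∑ w ∈ perms (s + Multiset.replicate k x), f w = ∑ u ∈ perms s, ∑ w ∈ ins x u k, f w := by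
  have hmap : ∀ w ∈ perms (s + Multiset.replicate k x), w.filter (· ≠ x) ∈ perms s := by
    intro w hw
    rw [mem_perms] at hw ⊢
    rw [← Multiset.filter_coe, hw, Multiset.filter_add]
    rw [Multiset.filter_eq_self.2, Multiset.filter_eq_nil.2, add_zero]
    · intro a ha; simp [Multiset.eq_of_mem_replicate ha]
    · rintro a ha rfl; exact hx ha
  rw [← Finset.sum_fiberwise_of_maps_to hmap]
  refine Finset.sum_congr rfl fun u hu => Finset.sum_congr ?_ fun _ _ => rfl
  have hxu : x ∉ u := by rw [mem_perms] at hu; rw [← hu] at hx; simpa using hx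
  ext w
  rw [Finset.mem_filter, mem_perms, mem_ins hxu]
  constructor
  · rintro ⟨h1, h2⟩
    refine ⟨h2, ?_⟩
    rw [← Multiset.coe_count, h1, Multiset.count_add, Multiset.count_eq_zero.2 hx]
    simp
  · rintro ⟨h1, h2⟩
    refine ⟨?_, h1⟩
    rw [coe_ins ((mem_ins hxu).2 ⟨h1, h2⟩), mem_perms.1 hu]

theorem sum_perms_reverse {M : Type*} [AddCommMonoid M] (s : Multiset ℕ) (f : List ℕ → M) :
    ∑ w ∈ perms s, f w.reverse = ∑ w ∈ perms s, f w := by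
  refine Finset.sum_nbij' List.reverse List.reverse ?_ ?_ ?_ ?_ ?_ <;>
    simp [mem_perms]

end Words

/-! ### The major index: inserting copies of a maximal letter -/

section Maj

variable {A : Type*} [CommRing A]

/-- The product of the weights `z` of the weak right-to-left minima. -/
def rlWeight (z : ℕ → A) : List ℕ → A
  | [] => 1
  | b :: l => (if ∀ y ∈ l, b ≤ y then z b else 1) * rlWeight z l

/-- The weight `t^des q^maj` of the reverse of a word. -/
def majWeight (q t : A) : List ℕ → A
  | [] => 1
  | b :: l => majWeight q t l * if b < l.headD b then t * q ^ l.length else 1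

/-- The generating function of the insertions of `k` letters `x` into a word. -/
def majIns (q t : A) (x : ℕ) (u : List ℕ) (k : ℕ) : A := ∑ w ∈ ins x u k, majWeight q t w

/-- The part of `majIns` coming from the words without trailing `x`. -/
def majIns' (q t : A) (x : ℕ) : List ℕ → ℕ → A
  | [], 0 => 1
  | [], _ + 1 => 0
  | y :: u, k => ∑ w ∈ ins x u k, majWeight q t (y :: w)

theorem majIns_zero (q t : A) (x : ℕ) (u : List ℕ) : majIns q t x u 0 = majWeight q t u := by
  simp [majIns, ins_zero]

theorem majIns'_zero (q t : A) (x : ℕ) (u : List ℕ) : majIns' q t x u 0 = majWeight q t u := by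
  cases u <;> simp [majIns', ins_zero, majWeight]

theorem mem_of_mem_ins {x : ℕ} {u w : List ℕ} {k : ℕ} (hw : w ∈ ins x u k) {a : ℕ} (ha : a ∈ w) :
    a = x ∨ a ∈ u := by
  have := coe_ins hw
  have h2 : a ∈ (w : Multiset ℕ) := by simpa
  rw [this, Multiset.mem_add, Multiset.mem_replicate] at h2
  rcases h2 with h2 | h2
  · exact Or.inr (by simpa using h2)
  · exact Or.inl h2.2

theorem headD_le_of_forall {l : List ℕ} {x : ℕ} (h : ∀ a ∈ l, a ≤ x) : l.headD x ≤ x := by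
  cases l with
  | nil => simp
  | cons a l => simpa using h a (by simp)

theorem majWeight_cons_max (q t : A) {x : ℕ} {l : List ℕ} (h : ∀ a ∈ l, a ≤ x) :
    majWeight q t (x :: l) = majWeight q t l := by
  rw [majWeight, if_neg (not_lt.2 (headD_le_of_forall h)), mul_one]

theorem majWeight_replicate (q t : A) (x k : ℕ) : majWeight q t (List.replicate k x) = 1 := by
  induction k with
  | zero => simp [majWeight]
  | succ k ih =>
    rw [List.replicate_succ, majWeight_cons_max, ih]
    intro a ha; exact (List.eq_of_mem_replicate ha).le

/-- Words are stored reversed, so a leading `x` is the last letter of the actual word. Being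
maximal, it creates no descent and costs nothing. -/
theorem majIns_succ (q t : A) {x : ℕ} {u : List ℕ} (hu : ∀ y ∈ u, y < x) (k : ℕ) :
    majIns q t x u (k + 1) = majIns q t x u k + majIns' q t x u (k + 1) := by
  rcases u with _ | ⟨y, u⟩
  · simp [majIns, majIns', ins, majWeight_replicate]
  · have hy : x ≠ y := fun h => absurd (hu y (by simp)) (by omega)
    rw [majIns, sum_ins_succ hy, majIns, majIns']
    congr 1
    refine Finset.sum_congr rfl fun w hw => majWeight_cons_max q t fun a ha => ?_
    rcases mem_of_mem_ins hw ha with h | h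
    · exact h.le
    · exact (hu a h).le

theorem length_of_mem_ins {x : ℕ} {u w : List ℕ} {k : ℕ} (hw : w ∈ ins x u k) :
    w.length = u.length + k := by
  have := congrArg Multiset.card (coe_ins hw)
  simpa using this

theorem majIns'_cons_zero (q t : A) (x y : ℕ) (u : List ℕ) :
    majIns' q t x (y :: u) 0 =
      majIns' q t x u 0 * if y < u.headD y then t * q ^ u.length else 1 := by
  rw [majIns'_zero, majIns'_zero, majWeight]

/-- Either an `x` is next to `y`, where it forms a descent at the position given by the length of
the rest, or the neighbour of `y` is the old one. -/
theorem majIns'_cons_succ (q t : A) {x y : ℕ} (hy : y < x) {u : List ℕ} (hu : ∀ y ∈ u, y < x)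
    (k : ℕ) :
    majIns' q t x (y :: u) (k + 1) = t * q ^ (u.length + k + 1) * majIns q t x u k +
      majIns' q t x u (k + 1) * if y < u.headD y then t * q ^ (u.length + k + 1) else 1 := by
  rcases u with _ | ⟨y', u⟩
  · have e : majWeight q t (x :: List.replicate k x) = 1 := by
      rw [← List.replicate_succ, majWeight_replicate]
    rw [majIns', majIns, majIns', ins, ins, Finset.sum_singleton, Finset.sum_singleton,
      List.replicate_succ, majWeight, e, majWeight_replicate]
    simp [hy]
  · have hy' : x ≠ y' := fun h => absurd (hu y' (by simp)) (by omega)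
    rw [majIns', sum_ins_succ hy', majIns, Finset.mul_sum, majIns', Finset.sum_mul]
    congr 1
    · refine Finset.sum_congr rfl fun w hw => ?_
      have h1 : ∀ a ∈ w, a ≤ x := fun a ha => by
        rcases mem_of_mem_ins hw ha with h | h
        · exact h.le
        · exact (hu a h).le
      rw [majWeight, majWeight_cons_max q t h1]
      simp [hy, length_of_mem_ins hw]
      ring
    · refine Finset.sum_congr rfl fun w hw => ?_
      rw [majWeight]
      simp [length_of_mem_ins hw]
      congr 3
      ring

theorem majIns_rec_of_majIns'_rec {q t : A} {τ : A →+* A} {x : ℕ} {u : List ℕ}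
    (hu : ∀ y ∈ u, y < x)
    (h : ∀ k, (1 - q ^ (k + 1)) * majIns' q t x u (k + 1) =
      q * majIns' q t x u k - q ^ k * shiftOp q t τ u.length (majIns' q t x u k)) (k : ℕ) :
    (1 - q ^ (k + 1)) * majIns q t x u (k + 1) =
      majIns q t x u k - q ^ k * shiftOp q t τ u.length (majIns q t x u k) := by
  induction k with
  | zero =>
    have h0 := h 0
    rw [majIns_succ q t hu]
    rw [majIns'_zero, ← majIns_zero q t x u] at h0
    linear_combination h0
  | succ k ih =>
    have h1 := h (k + 1)
    have e1 := majIns_succ q t hu k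
    have e2 := congrArg (shiftOp q t τ u.length) e1
    rw [shiftOp_add] at e2
    rw [majIns_succ q t hu (k + 1)]
    linear_combination h1 + q * ih - q * e1 + q ^ (k + 1) * e2

/-- The recurrence of `fillSum'_succ`, here for a single word and with `τ` acting on its weight. In
the induction on the word, `majIns'` of the longer word is expressed through `majIns` and `majIns'`
of the shorter one, which satisfy companion recurrences; the change of length in `shiftOp` is
compensated by moving `t` through it. -/
theorem majIns'_rec {q t : A} {τ : A →+* A} (hq : τ q = q) (ht : τ t = q * t) {x : ℕ} {u : List ℕ}
    (hu : ∀ y ∈ u, y < x) (k : ℕ) :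
    (1 - q ^ (k + 1)) * majIns' q t x u (k + 1) =
      q * majIns' q t x u k - q ^ k * shiftOp q t τ u.length (majIns' q t x u k) := by
  have hp : ∀ k, τ (q ^ k) = q ^ k := fun k => by rw [map_pow, hq]
  revert k
  induction u with
  | nil =>
    intro k
    rcases k with _ | k
    · simp [majIns', shiftOp]; ring
    · simp [majIns', shiftOp_zero]
  | cons y u ih =>
    have hy : y < x := hu y (by simp)
    have hu' : ∀ y ∈ u, y < x := fun a ha => hu a (by simp [ha])
    have hD := ih hu'
    have hT := majIns_rec_of_majIns'_rec hu' hD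
    intro k
    have hsucc := fun k => majIns'_cons_succ q t hy hu' k
    have hzero := majIns'_cons_zero q t x y u
    have hTD := fun k => majIns_succ q t hu' k
    have hTD0 : majIns' q t x u 0 = majIns q t x u 0 := by rw [majIns_zero, majIns'_zero]
    have hlift : ∀ v, shiftOp q t τ (u.length + 1) v = shiftOp q t τ u.length v
        + (q ^ (u.length + 2) - q ^ (u.length + 1)) * t * v := fun v => by
      simp only [shiftOp]; ring
    have hmul : ∀ k v, shiftOp q t τ (u.length + 1) (t * q ^ k * v) =
        q * t * q ^ k * shiftOp q t τ u.length v := fun k v => by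
      rw [show t * q ^ k * v = q ^ k * (t * v) by ring, shiftOp_mul _ _ _ _ (hp k),
        shiftOp_t_mul ht]
      ring
    simp only [List.length_cons]
    split_ifs at hsucc hzero with hlt
    -- When `y` already forms a descent with its neighbour, it still does with an `x` in between,
    -- and always at position `u.length + k`. The two cases of `hsucc` then merge into one multiple
    -- of `majIns`.
    · have hform : ∀ k, majIns' q t x (y :: u) k = t * q ^ (u.length + k) * majIns q t x u k := by
        intro k
        rcases k with _ | k
        · rw [hzero, hTD0]; simp only [Nat.add_zero]; ring
        · rw [hsucc, hTD, ← add_assoc]; ring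
      rw [hform, hform, hmul]
      linear_combination t * q ^ (u.length + k + 1) * hT k
    · rcases k with _ | k
      · rw [hsucc, hzero, mul_one, mul_one, hlift, hTD0]
        have := hD 0
        rw [hTD0] at this
        linear_combination this
      · rw [hsucc, hsucc, mul_one, mul_one, shiftOp_add, hmul, hlift]
        linear_combination hD (k + 1) + t * q ^ (u.length + k + 3) * hT k
          + t * q ^ (u.length + k + 2) * (1 - q) * hTD k

theorem rlWeight_append_singleton_max (z : ℕ → A) {x : ℕ} {l : List ℕ} (h : ∀ a ∈ l, a ≤ x) :
    rlWeight z (l ++ [x]) = z x * rlWeight z l := by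
  induction l with
  | nil => simp [rlWeight]
  | cons b l ih =>
    have hb : b ≤ x := h b (by simp)
    rw [List.cons_append, rlWeight, rlWeight, ih fun a ha => h a (by simp [ha])]
    simp only [List.mem_append, List.mem_singleton, or_imp, forall_and, forall_eq, hb, and_true]
    ring

/-- The letter `y < x` stays to the right of every inserted `x`. Hence no such `x` is a minimum, and
a letter that is at most `y` is at most `x` as well, so the other minima are unaffected. -/
theorem rlWeight_append_ins (z : ℕ → A) {x : ℕ} {u w r : List ℕ} {k : ℕ} (hu : ∀ a ∈ u, a < x)
    {y : ℕ} (hy : y < x) (hyr : y ∈ r) (hw : w ∈ ins x u k) :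
    rlWeight z (w ++ r) = rlWeight z (u ++ r) := by
  have hxu : x ∉ u := fun h => lt_irrefl _ (hu x h)
  obtain ⟨rfl, -⟩ := (mem_ins hxu).1 hw
  clear hw hu hxu
  induction w with
  | nil => rfl
  | cons b w ih =>
    by_cases hb : b = x
    · subst hb
      rw [List.cons_append, rlWeight, if_neg, one_mul, ih]
      · simp
      · intro h; exact absurd (h y (by simp [hyr])) (by omega)
    · have e : (b :: w).filter (· ≠ x) = b :: w.filter (· ≠ x) := by simp [hb]
      rw [e, List.cons_append, List.cons_append, rlWeight, rlWeight, ih]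
      congr 1
      refine if_congr ⟨fun h a ha => h a ?_, fun h a ha => ?_⟩ rfl rfl
      · simp only [List.mem_append, List.mem_filter] at ha ⊢
        tauto
      · by_cases hax : a = x
        · have := h y (by simp [hyr]); omega
        · refine h a ?_
          simp only [List.mem_append, List.mem_filter] at ha ⊢
          simpa [hax] using ha

/-- The generating function of `(des, maj)` and the right-to-left minima. -/
def majGF (q t : A) (z : ℕ → A) (s : Multiset ℕ) : A :=
  ∑ w ∈ perms s, majWeight q t w * rlWeight z w.reverse

theorem ins_reverse {x : ℕ} {u w : List ℕ} (hx : x ∉ u) {k : ℕ} (hw : w ∈ ins x u k) :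
    w.reverse ∈ ins x u.reverse k := by
  rw [mem_ins hx] at hw
  rw [mem_ins (by simpa), List.filter_reverse, hw.1, List.count_reverse]
  exact ⟨rfl, hw.2⟩

theorem sum_ins_majWeight_succ (q t : A) (z : ℕ → A) {x : ℕ} {u : List ℕ} (hu : ∀ y ∈ u, y < x)
    (k : ℕ) :
    ∑ w ∈ ins x u (k + 1), majWeight q t w * rlWeight z w.reverse =
      z x * ∑ w ∈ ins x u k, majWeight q t w * rlWeight z w.reverse +
        majIns' q t x u (k + 1) * rlWeight z u.reverse := by
  rcases u with _ | ⟨y, u⟩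
  · have h : ∀ k, rlWeight z (List.replicate k x) = z x ^ k := by
      intro k
      induction k with
      | zero => simp [rlWeight]
      | succ k ih =>
        rw [List.replicate_succ, rlWeight, ih, if_pos, pow_succ']
        intro a ha; exact (List.eq_of_mem_replicate ha).ge
    simp only [ins, Finset.sum_singleton, majIns', majWeight_replicate, List.reverse_replicate, h]
    ring
  · have hy : y < x := hu y (by simp)
    have hu' : ∀ y ∈ u, y < x := fun a ha => hu a (by simp [ha])
    rw [sum_ins_succ (by omega), majIns', Finset.mul_sum, Finset.sum_mul]
    congr 1
    · refine Finset.sum_congr rfl fun w hw => ?_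
      have h1 : ∀ a ∈ w, a ≤ x := fun a ha => by
        rcases mem_of_mem_ins hw ha with h | h
        · exact h.le
        · exact (hu a h).le
      rw [majWeight_cons_max q t h1, List.reverse_cons, rlWeight_append_singleton_max]
      · ring
      · simpa using h1
    · refine Finset.sum_congr rfl fun w hw => ?_
      rw [List.reverse_cons, List.reverse_cons, rlWeight_append_ins z (u := u.reverse)
        (by simpa using hu') hy (by simp) (ins_reverse (fun h => lt_irrefl _ (hu' x h)) hw)]

/-- `transfer_zero_eq` applies with `D` the part without trailing `x`. Its hypotheses hold word by
word: a trailing `x` is a right-to-left minimum and yields the factor `z x`, and the minima of the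
old word contribute a constant fixed by `τ`. -/
theorem majGF_eq_transfer [IsDomain A] {q t : A} {z : ℕ → A} {τ : A →+* A} (hq : τ q = q)
    (ht : τ t = q * t) (hz : ∀ x, τ (z x) = z x) (hq1 : ∀ k, 1 - q ^ (k + 1) ≠ 0)
    {s : Multiset ℕ} {x : ℕ} (hs : ∀ y ∈ s, y < x) {V : ℕ → A}
    (hV : ShiftRec q t τ (Multiset.card s) V) (h0 : majGF q t z s = V 0) (c : ℕ) :
    majGF q t z (s + Multiset.replicate c x) = transfer q t (z x) (Multiset.card s) c V 0 := by
  have hx : x ∉ s := fun h => lt_irrefl _ (hs x h)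
  have hrl : ∀ l : List ℕ, τ (rlWeight z l) = rlWeight z l := by
    intro l
    induction l with
    | nil => simp [rlWeight]
    | cons b l ih => rw [rlWeight, map_mul, ih]; split_ifs <;> simp [hz]
  have hmem : ∀ u ∈ perms s, (∀ y ∈ u, y < x) ∧ u.length = Multiset.card s := by
    intro u hu
    rw [mem_perms] at hu
    subst hu
    exact ⟨by simpa using hs, by simp⟩
  refine transfer_zero_eq hq hq1 hV (T := fun c => majGF q t z (s + Multiset.replicate c x))
    (D := fun c => ∑ u ∈ perms s, majIns' q t x u c * rlWeight z u.reverse) ?_ ?_ ?_ ?_ c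
  · simp [h0]
  · rw [← h0]; simp [majIns'_zero, majGF]
  · intro c
    simp only [majGF]
    rw [sum_perms_add hx, sum_perms_add hx, Finset.mul_sum, ← Finset.sum_add_distrib]
    exact Finset.sum_congr rfl fun u hu => sum_ins_majWeight_succ q t z (hmem u hu).1 c
  · intro c
    simp only [shiftOp_sum, Finset.mul_sum]
    rw [← Finset.sum_sub_distrib]
    refine Finset.sum_congr rfl fun u hu => ?_
    have := majIns'_rec hq ht (hmem u hu).1 c
    rw [(hmem u hu).2] at this
    rw [mul_comm (majIns' q t x u c), shiftOp_mul _ _ _ _ (hrl _)]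
    linear_combination rlWeight z u.reverse * this

end Maj

/-! ### Deleting and restoring letters: tight words and words with isolated placeholders -/

section Blocks

/-- A general fibration of a sum. -/
theorem sum_eq_sum_fibers {α β M : Type*} [DecidableEq β] [AddCommMonoid M] {S : Finset α}
    {T : Finset β} (g : α → β) (fib : β → Finset α) (hg : ∀ w ∈ S, g w ∈ T)
    (h : ∀ v ∈ T, ∀ w, w ∈ fib v ↔ w ∈ S ∧ g w = v) (f : α → M) :
    ∑ w ∈ S, f w = ∑ v ∈ T, ∑ w ∈ fib v, f w := by
  rw [← Finset.sum_fiberwise_of_maps_to hg]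
  refine Finset.sum_congr rfl fun v hv => Finset.sum_congr ?_ fun _ _ => rfl
  ext w
  rw [Finset.mem_filter, h v hv]

theorem headD_lt_iff {l : List ℕ} {d c : ℕ} (hcd : c ≤ d) :
    l.headD d < c ↔ ∃ y < c, l.head? = some y := by
  cases l with
  | nil => simpa using hcd
  | cons a l => simp

/-- The letters above `x` are followed by letters below `m`. -/
def Good (x m : ℕ) : List ℕ → Prop
  | [] => True
  | b :: l => (x < b → l.headD m < m) ∧ Good x m l

/-- The letters not below `x` are followed by letters below `x`. -/
def Tight (x : ℕ) : List ℕ → Prop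
  | [] => True
  | b :: l => (x ≤ b → l.headD x < x) ∧ Tight x l

/-- Remove the letters satisfying `P` that are not followed by a letter below `x`. -/
def removeP (x : ℕ) (P : ℕ → Prop) [DecidablePred P] : List ℕ → List ℕ
  | [] => []
  | b :: l => if P b ∧ ¬ l.headD x < x then removeP x P l else b :: removeP x P l

/-- A deleted letter is not below `x` and is not followed by a letter below `x`, so deletion neither
exposes nor hides a head below `x`. -/
theorem head?_removeP {x : ℕ} {P : ℕ → Prop} [DecidablePred P] (hP : ∀ b, P b → x ≤ b)
    (w : List ℕ) {y : ℕ} (hy : y < x) :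
    (removeP x P w).head? = some y ↔ w.head? = some y := by
  induction w with
  | nil => simp [removeP]
  | cons b w ih =>
    rw [removeP]
    split_ifs with h
    · rw [ih]
      have h1 := hP b h.1
      have h2 := h.2
      rw [headD_lt_iff le_rfl] at h2
      simp only [List.head?_cons, Option.some.injEq]
      constructor
      · intro h3; exact absurd ⟨y, hy, h3⟩ h2
      · rintro rfl; omega
    · simp

theorem headD_removeP_lt {x : ℕ} {P : ℕ → Prop} [DecidablePred P] (hP : ∀ b, P b → x ≤ b)
    (w : List ℕ) : (removeP x P w).headD x < x ↔ w.headD x < x := by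
  rw [headD_lt_iff le_rfl, headD_lt_iff le_rfl]
  exact exists_congr fun y => and_congr_right fun hy => head?_removeP hP w hy

theorem countP_removeP {x : ℕ} {P : ℕ → Prop} [DecidablePred P] (hP : ∀ b, P b → x ≤ b)
    (w : List ℕ) {y : ℕ} (hy : y ≤ x) :
    (removeP x P w).countP (· < y) = w.countP (· < y) := by
  induction w with
  | nil => simp [removeP]
  | cons b w ih =>
    rw [removeP]
    split_ifs with h
    · rw [ih, List.countP_cons_of_neg]
      have := hP b h.1
      simp; omega
    · simp only [List.countP_cons, ih]

theorem count_removeP_le (x : ℕ) (P : ℕ → Prop) [DecidablePred P] (w : List ℕ) (y : ℕ) :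
    (removeP x P w).count y ≤ w.count y := by
  induction w with
  | nil => simp [removeP]
  | cons b w ih =>
    rw [removeP]
    split_ifs with h
    · exact ih.trans (List.count_le_count_cons ..)
    · simp only [List.count_cons]; omega

/-- `Good x x` already controls the letters above `x`, and what is deleted is precisely the copies
of `x` that violate tightness. -/
theorem Good.tight_removeP {x : ℕ} {w : List ℕ} (h : Good x x w) :
    Tight x (removeP x (· = x) w) := by
  have hP : ∀ b, b = x → x ≤ b := fun b hb => hb.ge
  induction w with
  | nil => simp [removeP, Tight]
  | cons b w ih =>
    rw [removeP]
    split_ifs with h'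
    · exact ih h.2
    · refine ⟨fun hb => ?_, ih h.2⟩
      rw [headD_removeP_lt hP]
      rcases hb.eq_or_lt with rfl | hb
      · simpa using h'
      · exact h.1 hb

/-- Insert `k` letters `x` in front of letters not below `x` or at the end. -/
def closeIns (x : ℕ) : List ℕ → ℕ → Finset (List ℕ)
  | [], k => {List.replicate k x}
  | y :: u, 0 => {y :: u}
  | y :: u, k + 1 => if y < x then consF y (closeIns x u (k + 1)) else
      consF x (closeIns x (y :: u) k) ∪ consF y (closeIns x u (k + 1))

theorem closeIns_zero (x : ℕ) (u : List ℕ) : closeIns x u 0 = {u} := by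
  cases u <;> simp [closeIns]

theorem coe_closeIns {x : ℕ} {u : List ℕ} {k : ℕ} {w : List ℕ} (hw : w ∈ closeIns x u k) :
    (w : Multiset ℕ) = u + Multiset.replicate k x := by
  induction w generalizing u k with
  | nil =>
    rcases u with _ | ⟨y, u⟩
    · cases k <;> simp_all [closeIns, List.replicate_succ]
    · cases k
      · simp_all [closeIns]
      · rw [closeIns] at hw; split_ifs at hw <;> simp at hw
  | cons b w ih =>
    rcases u with _ | ⟨y, u⟩
    · simp only [closeIns, Finset.mem_singleton] at hw
      rw [hw]; simp [Multiset.coe_replicate]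
    · cases k with
      | zero => simp_all [closeIns]
      | succ k =>
        have hw' : (x = b ∧ w ∈ closeIns x (y :: u) k) ∨ (y = b ∧ w ∈ closeIns x u (k + 1)) := by
          rw [closeIns] at hw
          split_ifs at hw
          · exact Or.inr (by simpa using hw)
          · simpa using hw
        rcases hw' with ⟨rfl, hw'⟩ | ⟨rfl, hw'⟩
        · rw [← Multiset.cons_coe, ih hw', Multiset.replicate_succ, Multiset.add_cons]
        · rw [← Multiset.cons_coe, ih hw', ← Multiset.cons_coe, Multiset.cons_add]

/-- In a tight word every old `x` is followed by a smaller letter, while an inserted one never is.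
The inserted copies can therefore be recognized, and `closeIns` is the fibre of the deletion. -/
theorem mem_closeIns {x : ℕ} {v : List ℕ} (hv : Tight x v) {k : ℕ} {w : List ℕ} :
    w ∈ closeIns x v k ↔
      Good x x w ∧ removeP x (· = x) w = v ∧ w.count x = v.count x + k := by
  have hP : ∀ b, b = x → x ≤ b := fun b hb => hb.ge
  induction w generalizing v k with
  | nil =>
    rcases v with _ | ⟨y, v⟩
    · cases k <;> simp [closeIns, removeP, Good, List.replicate_succ]
    · simp only [removeP, List.nil_eq, reduceCtorEq, false_and, and_false, iff_false]
      cases k with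
      | zero => simp [closeIns]
      | succ k => rw [closeIns]; split_ifs <;> simp
  | cons b w ih =>
    have hsmall := headD_removeP_lt hP w
    have ih' : ∀ v k, Tight x v → (w ∈ closeIns x v k ↔ Good x x w ∧ removeP x (· = x) w = v ∧
        w.count x = v.count x + k) := fun v k h => ih h
    clear ih
    rcases v with _ | ⟨y, v⟩
    · have e : b :: w ∈ closeIns x [] k ↔ ∃ k', k = k' + 1 ∧ b = x ∧ w ∈ closeIns x [] k' := by
        cases k <;> simp [closeIns, List.replicate_succ]
      rw [e, removeP]
      constructor
      · rintro ⟨k', rfl, rfl, hw⟩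
        rw [ih' [] k' (by trivial)] at hw
        obtain ⟨h1, h2, h3⟩ := hw
        rw [h2] at hsmall
        have hs : ¬ w.headD b < b := by rw [← hsmall]; simp
        refine ⟨⟨by simp, h1⟩, ?_, ?_⟩
        · rw [if_pos ⟨rfl, hs⟩, h2]
        · simp [h3]
      · rintro ⟨h1, h2, h3⟩
        split_ifs at h2 with h
        obtain ⟨rfl, hs⟩ := h
        refine ⟨w.count b, ?_, rfl, ?_⟩
        · simpa using h3.symm
        · rw [ih' [] _ (by trivial)]; exact ⟨h1.2, h2, by simp⟩
    · by_cases hy : y < x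
      · have e : b :: w ∈ closeIns x (y :: v) k ↔ b = y ∧ w ∈ closeIns x v k := by
          cases k with
          | zero => simp [closeIns_zero]
          | succ k => rw [closeIns, if_pos hy, cons_mem_consF]; simp [eq_comm]
        rw [e, ih' v k hv.2, removeP]
        constructor
        · rintro ⟨rfl, h1, h2, h3⟩
          refine ⟨⟨fun h => absurd hy (by omega), h1⟩, ?_, ?_⟩
          · rw [if_neg (by rintro ⟨rfl, -⟩; omega), h2]
          · rw [List.count_cons_of_ne (by omega), List.count_cons_of_ne (by omega), h3]
        · rintro ⟨h1, h2, h3⟩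
          split_ifs at h2 with h
          · exfalso
            rw [h2] at hsmall
            exact h.2 (hsmall.1 (by simpa using hy))
          · obtain ⟨rfl, h4⟩ := List.cons.inj h2
            refine ⟨rfl, h1.2, h4, ?_⟩
            rwa [List.count_cons_of_ne (by omega), List.count_cons_of_ne (by omega)] at h3
      · have hvs := hv.1 (not_lt.1 hy)
        have e : b :: w ∈ closeIns x (y :: v) k ↔
            (∃ k', k = k' + 1 ∧ b = x ∧ w ∈ closeIns x (y :: v) k') ∨
              (b = y ∧ w ∈ closeIns x v k) := by
          cases k with
          | zero => simp [closeIns_zero]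
          | succ k => rw [closeIns, if_neg hy]; simp [eq_comm]
        rw [e, removeP]
        constructor
        · rintro (⟨k', rfl, rfl, hw⟩ | ⟨rfl, hw⟩)
          · rw [ih' _ _ hv] at hw
            obtain ⟨h1, h2, h3⟩ := hw
            rw [h2] at hsmall
            have hs : ¬ w.headD b < b := by rw [← hsmall]; simpa using hy
            refine ⟨⟨by simp, h1⟩, ?_, ?_⟩
            · rw [if_pos ⟨rfl, hs⟩, h2]
            · simp only [List.count_cons_self, h3]; omega
          · rw [ih' _ _ hv.2] at hw
            obtain ⟨h1, h2, h3⟩ := hw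
            rw [h2] at hsmall
            have hs := hsmall.1 hvs
            refine ⟨⟨fun _ => hs, h1⟩, ?_, ?_⟩
            · rw [if_neg (by simp only [not_and, not_not]; exact fun _ => hs), h2]
            · simp only [List.count_cons, h3]; omega
        · rintro ⟨h1, h2, h3⟩
          split_ifs at h2 with h
          · obtain ⟨rfl, hs⟩ := h
            left
            have hle := count_removeP_le b (· = b) w b
            rw [h2] at hle
            simp only [List.count_cons_self] at h3
            refine ⟨k - 1, by omega, rfl, ?_⟩
            rw [ih' _ _ hv]
            exact ⟨h1.2, h2, by omega⟩
          · obtain ⟨rfl, h4⟩ := List.cons.inj h2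
            right
            rw [ih' _ _ hv.2]
            refine ⟨rfl, h1.2, h4, ?_⟩
            simp only [List.count_cons] at h3
            omega

/-- Replace `p` of the letters `B` by `x`. -/
def subst (x B : ℕ) : List ℕ → ℕ → Finset (List ℕ)
  | [], 0 => {[]}
  | [], _ + 1 => ∅
  | b :: l, 0 => {b :: l}
  | b :: l, p + 1 => if b = B then consF B (subst x B l (p + 1)) ∪ consF x (subst x B l p) else
      consF b (subst x B l (p + 1))

theorem subst_zero (x B : ℕ) (l : List ℕ) : subst x B l 0 = {l} := by
  cases l <;> simp [subst]

/-- The letter `x` becomes `B`. -/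
def raise (x B a : ℕ) : ℕ := if a = x then B else a

theorem mem_subst {x B : ℕ} (hxB : x < B) {v : List ℕ} (hv : x ∉ v) {p : ℕ} {w : List ℕ} :
    w ∈ subst x B v p ↔ w.map (raise x B) = v ∧ w.count x = p := by
  induction w generalizing v p with
  | nil =>
    rcases v with _ | ⟨y, v⟩
    · cases p <;> simp [subst]
    · simp only [List.map_nil, List.nil_eq, reduceCtorEq, false_and, iff_false]
      cases p with
      | zero => simp [subst]
      | succ k => rw [subst]; split_ifs <;> simp
  | cons b w ih =>
    rcases v with _ | ⟨y, v⟩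
    · cases p <;> simp [subst]
    · have hy : x ≠ y := fun h => hv (by simp [h])
      have hv' : x ∉ v := fun h => hv (by simp [h])
      have e : b :: w ∈ subst x B (y :: v) p ↔
          (b = y ∧ w ∈ subst x B v p) ∨ (∃ p', p = p' + 1 ∧ y = B ∧ b = x ∧ w ∈ subst x B v p') := by
        cases p with
        | zero => simp [subst, subst_zero]
        | succ p =>
          rw [subst]
          split_ifs with h
          · subst h; simp [eq_comm]
          · simp [h, eq_comm]
      rw [e, List.map_cons, List.cons.injEq, List.count_cons, ih hv']
      simp only [ih hv']
      unfold raise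
      constructor
      · rintro (⟨rfl, h1, h2⟩ | ⟨p', rfl, rfl, rfl, h1, h2⟩)
        · simp [Ne.symm hy, h1, h2]
        · simp [h1, h2]
      · rintro ⟨⟨h1, h2⟩, h3⟩
        by_cases hb : b = x
        · right; simp [hb] at h1 h3; exact ⟨w.count x, h3.symm, h1.symm, hb, h2, rfl⟩
        · left; simp [hb] at h1 h3; exact ⟨h1, h2, h3⟩

theorem tight_iff_good_map_raise {x B : ℕ} (hxB : x < B) (w : List ℕ) :
    Tight x w ↔ Good x x (w.map (raise x B)) := by
  induction w with
  | nil => simp [Tight, Good]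
  | cons b w ih =>
    rw [Tight, List.map_cons, Good, ih]
    refine and_congr_left fun _ => ?_
    have h1 : x < raise x B b ↔ x ≤ b := by
      unfold raise; split_ifs with h <;> omega
    have h2 : (w.map (raise x B)).headD x < x ↔ w.headD x < x := by
      cases w with
      | nil => simp
      | cons a w => simp only [List.map_cons, List.headD_cons, raise]; split_ifs <;> omega
    rw [h1, h2]

end Blocks

/-! ### The `mak` weight under inserting `x` and under turning placeholders into `x` -/

section MakWeight

/-- The number of descents with top at least `b`. -/
def descTop (b : ℕ) : List ℕ → ℕ
  | [] => 0
  | c :: l => descTop b l + if l.headD c < c ∧ b ≤ c then 1 else 0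

/-- `w` and `v` look the same for letters up to `x`, except for `r` additional descents. -/
structure Similar (x r : ℕ) (w v : List ℕ) : Prop where
  head : ∀ y < x, (w.head? = some y ↔ v.head? = some y)
  count : ∀ y ≤ x, w.countP (· < y) = v.countP (· < y)
  top : ∀ y ≤ x, descTop y w = descTop y v + r

theorem Similar.headD {x r : ℕ} {w v : List ℕ} (h : Similar x r w v) {y : ℕ} (hy : y ≤ x) :
    w.headD y < y ↔ v.headD y < y := by
  rw [headD_lt_iff le_rfl, headD_lt_iff le_rfl]
  exact exists_congr fun a => and_congr_right fun ha => h.head a (by omega)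

theorem Similar.forall_le {x r : ℕ} {w v : List ℕ} (h : Similar x r w v) {y : ℕ} (hy : y ≤ x) :
    (∀ a ∈ w, y ≤ a) ↔ ∀ a ∈ v, y ≤ a := by
  have := h.count y hy
  have e : ∀ l : List ℕ, (∀ a ∈ l, y ≤ a) ↔ l.countP (· < y) = 0 := by
    intro l; rw [List.countP_eq_zero]; simp
  rw [e, e, this]

theorem Tight.descTop_eq {x : ℕ} {v : List ℕ} (hv : Tight x v) :
    descTop x v = v.countP (x ≤ ·) := by
  induction v with
  | nil => simp [descTop]
  | cons b v ih =>
    rw [descTop, List.countP_cons, ih hv.2]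
    congr 1
    by_cases hb : x ≤ b
    · have := hv.1 hb
      rw [headD_lt_iff le_rfl] at this
      obtain ⟨y, hy, h⟩ := this
      have : v.headD b < b := by rw [headD_lt_iff le_rfl]; exact ⟨y, by omega, h⟩
      simp only [this, hb, true_and, decide_true]
    · simp [hb]

/-- A deleted `x` is not a descent top. It is not a descent bottom either, since letters above `x`
are followed by letters below `x`. -/
theorem similar_removeP {x : ℕ} {w : List ℕ} (hw : Good x x w) :
    Similar x 0 w (removeP x (· = x) w) := by
  have hP : ∀ b, b = x → x ≤ b := fun b hb => hb.ge
  refine ⟨fun y hy => (head?_removeP hP w hy).symm, fun y hy => (countP_removeP hP w hy).symm, ?_⟩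
  intro y hy
  rw [add_zero]
  induction w with
  | nil => simp [removeP]
  | cons b w ih =>
    rw [removeP]
    split_ifs with h
    · obtain ⟨rfl, h⟩ := h
      rw [descTop, ih hw.2, if_neg fun h' => h h'.1, add_zero]
    · rw [descTop, descTop, ih hw.2]
      congr 1
      refine if_congr (and_congr_left fun _ => ?_) rfl rfl
      by_cases hb : x ≤ b
      · have h1 : w.headD x < x := by
          rcases hb.eq_or_lt with rfl | hb
          · simpa using h
          · exact hw.1 hb
        rw [headD_lt_iff le_rfl] at h1
        obtain ⟨a, ha, h2⟩ := h1
        have h3 := (head?_removeP hP w ha).2 h2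
        rw [headD_lt_iff le_rfl, headD_lt_iff le_rfl]
        exact ⟨fun _ => ⟨a, by omega, h3⟩, fun _ => ⟨a, by omega, h2⟩⟩
      · rw [headD_lt_iff le_rfl, headD_lt_iff le_rfl]
        exact exists_congr fun a => and_congr_right fun ha => (head?_removeP hP w (by omega)).symm

theorem similar_map_raise {x B : ℕ} (hxB : x < B) {w : List ℕ} (hw : Tight x w) :
    Similar x 0 w (w.map (raise x B)) := by
  have hr : ∀ a y, y ≤ x → (raise x B a < y ↔ a < y) := by
    intro a y hy; unfold raise; split_ifs <;> omega
  have hr' : ∀ a y, y < x → (raise x B a = y ↔ a = y) := by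
    intro a y hy; unfold raise; split_ifs <;> omega
  have hhead : ∀ (w : List ℕ), ∀ y < x, (w.head? = some y ↔ (w.map (raise x B)).head? = some y) := by
    intro w y hy
    cases w with
    | nil => simp
    | cons a w => simp [hr' a y hy]
  refine ⟨hhead w, ?_, ?_⟩
  · intro y hy
    rw [List.countP_map]
    congr 1
    funext a
    simp [hr a y hy]
  · intro y hy
    rw [add_zero]
    induction w with
    | nil => simp
    | cons b w ih =>
      rw [List.map_cons, descTop, descTop, ih hw.2]
      congr 1
      have h2 : y ≤ raise x B b ↔ y ≤ b := by
        have := hr b y hy; omega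
      simp only [h2]
      refine if_congr (and_congr_left fun _ => ?_) rfl rfl
      by_cases hb : x ≤ b
      · have h1 := hw.1 hb
        rw [headD_lt_iff le_rfl] at h1
        obtain ⟨a, ha, h2⟩ := h1
        have h3 := (hhead w a ha).1 h2
        have h4 : x ≤ raise x B b := by have := hr b x le_rfl; omega
        rw [headD_lt_iff le_rfl, headD_lt_iff le_rfl]
        exact ⟨fun _ => ⟨a, by omega, h3⟩, fun _ => ⟨a, by omega, h2⟩⟩
      · have h4 : raise x B b = b := by unfold raise; split_ifs <;> omega
        rw [h4, headD_lt_iff le_rfl, headD_lt_iff le_rfl]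
        exact exists_congr fun a => and_congr_right fun ha => hhead w a (by omega)

variable {A : Type*} [CommRing A]

/-- The factor of `makWeight` contributed by a letter in front of a word. -/
def makFactor (q t : A) (z : ℕ → A) (B b : ℕ) (l : List ℕ) : A :=
  (if b < B then q ^ descTop b l else 1) *
    (if l.headD b < b then t * q ^ (1 + l.countP (· < l.headD b)) else 1) *
    (if ∀ y ∈ l, b ≤ y then z b else 1)

/-- The weight `t^des q^mak` times the weight of the right-to-left minima. The embracing numbers
of the letters from `B` on are not counted. -/
def makWeight (q t : A) (z : ℕ → A) (B : ℕ) : List ℕ → A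
  | [] => 1
  | b :: l => makWeight q t z B l * makFactor q t z B b l

/-- The factor of a letter `y` depends on the rest of the word only through the descents with top at
least `y`, a head below `y` with the number of letters below that head, and whether some letter is
below `y`. `Similar` preserves all of this except for `r` extra descents. -/
theorem Similar.makFactor_eq (q t : A) (z : ℕ → A) {B x r : ℕ} {w v : List ℕ}
    (h : Similar x r w v) {y : ℕ} (hy : y ≤ x) (hyB : y < B) :
    makFactor q t z B y w = q ^ r * makFactor q t z B y v := by
  unfold makFactor
  rw [if_pos hyB, if_pos hyB, h.top y hy]
  simp only [h.headD hy, h.forall_le hy]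
  by_cases hv : v.headD y < y
  · have h1 := hv
    rw [headD_lt_iff le_rfl] at h1
    obtain ⟨a, ha, h2⟩ := h1
    have h3 := (h.head a (by omega)).2 h2
    have e1 : v.headD y = a := by rw [List.headD_eq_head?_getD, h2]; rfl
    have e2 : w.headD y = a := by rw [List.headD_eq_head?_getD, h3]; rfl
    rw [if_pos hv, if_pos hv, e1, e2, h.count a (by omega)]
    ring
  · rw [if_neg hv, if_neg hv]
    ring

theorem makFactor_of_head {q t : A} {z : ℕ → A} {B y a : ℕ} {w : List ℕ} (hw : w.head? = some a)
    (hay : a < y) : makFactor q t z B y w =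
      (if y < B then q ^ descTop y w else 1) * (t * q ^ (1 + w.countP (· < a))) := by
  have e : w.headD y = a := by rw [List.headD_eq_head?_getD, hw]; rfl
  have hne : ¬ ∀ y' ∈ w, y ≤ y' := fun h => by
    have := h a (List.mem_of_mem_head? hw)
    omega
  unfold makFactor
  rw [e, if_pos hay, if_neg hne, mul_one]

theorem Similar.makFactor_top_eq (q t : A) (z : ℕ → A) {B x r : ℕ} {w v : List ℕ}
    (h : Similar x r w v) (hxB : x < B) (hv : v.headD x < x) :
    makFactor q t z B B w = makFactor q t z B B v := by
  rw [headD_lt_iff le_rfl] at hv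
  obtain ⟨a, ha, h2⟩ := hv
  have h3 := (h.head a (by omega)).2 h2
  rw [makFactor_of_head h2 (by omega), makFactor_of_head h3 (by omega), h.count a (by omega)]
  simp

theorem Similar.makFactor_eq_top (q t : A) (z : ℕ → A) {B x : ℕ} {w v : List ℕ}
    (h : Similar x 0 w v) (hxB : x < B) (hv : v.headD x < x) :
    makFactor q t z B x w = q ^ descTop x v * makFactor q t z B B v := by
  rw [headD_lt_iff le_rfl] at hv
  obtain ⟨a, ha, h2⟩ := hv
  have h3 := (h.head a (by omega)).2 h2
  rw [makFactor_of_head h2 (by omega), makFactor_of_head h3 (by omega), h.count a (by omega),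
    if_pos hxB, h.top x le_rfl]
  simp

theorem makWeight_replicate (q t : A) (z : ℕ → A) {B x : ℕ} (hxB : x < B) (k : ℕ) :
    makWeight q t z B (List.replicate k x) = z x ^ k := by
  have hd : ∀ k, descTop x (List.replicate k x) = 0 := by
    intro k
    induction k with
    | zero => simp [descTop]
    | succ k ih => rw [List.replicate_succ, descTop, ih]; cases k <;> simp [List.replicate_succ]
  induction k with
  | zero => simp [makWeight]
  | succ k ih =>
    rw [List.replicate_succ, makWeight, ih, makFactor, hd, if_pos, if_neg, if_pos]
    · ring
    · intro y hy; exact (List.eq_of_mem_replicate hy).ge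
    · cases k <;> simp [List.replicate_succ]
    · exact hxB

/-- An inserted `x` makes no descent. In a tight word the letters from `x` on are descent tops with
bottoms below `x`, so the embracing number of an inserted `x` is the number of those to its right.
The new copies thus behave as if shuffled with these letters, and the copies at the end are
right-to-left minima. -/
theorem sum_closeIns_makWeight (q t : A) (z : ℕ → A) {B x : ℕ} (hxB : x < B) {v : List ℕ}
    (hv : Tight x v) (hvB : ∀ b ∈ v, b ≤ x ∨ b = B) (k : ℕ) :
    ∑ w ∈ closeIns x v k, makWeight q t z B w =
      shufCoeff q (z x) (v.countP (x ≤ ·)) k * makWeight q t z B v := by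
  have hsim : ∀ {v : List ℕ}, Tight x v → ∀ {k w}, w ∈ closeIns x v k → Similar x 0 w v := by
    intro v hv k w hw
    obtain ⟨h1, h2, -⟩ := (mem_closeIns hv).1 hw
    have := similar_removeP h1
    rwa [h2] at this
  induction v generalizing k with
  | nil => simp [closeIns, makWeight_replicate q t z hxB, shufCoeff, makWeight]
  | cons y v ih =>
    have ih' := ih hv.2 fun b hb => hvB b (by simp [hb])
    induction k with
    | zero => rw [closeIns_zero, Finset.sum_singleton, shufCoeff_zero, one_mul]
    | succ k ihk =>
      rw [closeIns]
      split_ifs with hy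
      · rw [sum_consF, List.countP_cons_of_neg (by simpa using hy), makWeight, ← mul_assoc, ← ih',
          Finset.sum_mul]
        refine Finset.sum_congr rfl fun w hw => ?_
        rw [makWeight, (hsim hv.2 hw).makFactor_eq q t z hy.le (by omega), pow_zero, one_mul]
      · have hy' := not_lt.1 hy
        have hsm := hv.1 hy'
        -- This holds even for `y = x`: in the first set the leading letter is followed by nothing
        -- below `x`, in the second by a letter below `x`.
        have hd : Disjoint (consF x (closeIns x (y :: v) k)) (consF y (closeIns x v (k + 1))) := by
          rw [Finset.disjoint_left]
          intro w hw hw'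
          obtain ⟨l, hl, rfl⟩ := mem_consF.1 hw
          obtain ⟨rfl, hl'⟩ := cons_mem_consF.1 hw'
          have h1 := (hsim hv hl).headD le_rfl
          have h2 := (hsim hv.2 hl').headD le_rfl
          have := h1.1 (h2.2 hsm)
          simp at this
        have h1 : ∀ w ∈ closeIns x (y :: v) k, makWeight q t z B (x :: w) =
            q ^ (v.countP (x ≤ ·) + 1) * makWeight q t z B w := by
          intro w hw
          have hs := hsim hv hw
          have e1 : descTop x w = v.countP (x ≤ ·) + 1 := by
            rw [hs.top x le_rfl, hv.descTop_eq, List.countP_cons_of_pos (by simpa using hy')]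
          rw [makWeight, makFactor, if_pos hxB, e1, if_neg, if_neg]
          · ring
          · rw [hs.forall_le le_rfl]
            rw [headD_lt_iff le_rfl] at hsm
            obtain ⟨a, ha, h2⟩ := hsm
            intro h
            have := h a (List.mem_cons_of_mem _ (List.mem_of_mem_head? h2))
            omega
          · rw [hs.headD le_rfl]; simpa using hy'
        have h2 : ∀ w ∈ closeIns x v (k + 1), makWeight q t z B (y :: w) =
            makWeight q t z B w * makFactor q t z B y v := by
          intro w hw
          have hs := hsim hv.2 hw
          rw [makWeight]
          rcases hvB y (by simp) with h | rfl
          · rw [hs.makFactor_eq q t z h (by omega), pow_zero, one_mul]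
          · rw [hs.makFactor_top_eq q t z hxB hsm]
        rw [Finset.sum_union hd, sum_consF, sum_consF, Finset.sum_congr rfl h1,
          Finset.sum_congr rfl h2, ← Finset.mul_sum, ← Finset.sum_mul, ihk, ih',
          List.countP_cons_of_pos (by simpa using hy'), shufCoeff_succ_succ, makWeight]
        ring

theorem Good.tight {x B : ℕ} (hxB : x < B) {v : List ℕ} (hv : Good x x v)
    (hvB : ∀ b ∈ v, b < x ∨ b = B) : Tight x v := by
  induction v with
  | nil => trivial
  | cons b v ih =>
    refine ⟨fun h => hv.1 ?_, ih hv.2 fun a ha => hvB a (by simp [ha])⟩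
    have := hvB b (by simp)
    omega

/-- A placeholder that becomes `x` keeps its descent but now has its embracing number counted. This
is the number of original placeholders to its right, replaced or not, since each is still a descent
top not below `x`. -/
theorem sum_subst_makWeight (q t : A) (z : ℕ → A) {B x : ℕ} (hxB : x < B) {v : List ℕ}
    (hv : Good x x v) (hvB : ∀ b ∈ v, b < x ∨ b = B) (p : ℕ) :
    ∑ w ∈ subst x B v p, makWeight q t z B w =
      selCoeff q (v.count B) p * makWeight q t z B v := by
  induction v generalizing p with
  | nil => cases p <;> simp [subst, selCoeff]
  | cons b v ih =>
    have hvB' : ∀ b ∈ v, b < x ∨ b = B := fun a ha => hvB a (by simp [ha])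
    have ih' := ih hv.2 hvB'
    have hsim : ∀ {p w}, w ∈ subst x B v p → Similar x 0 w v := by
      intro p w hw
      have hx : x ∉ v := fun h => by have := hvB' x h; omega
      obtain ⟨rfl, -⟩ := (mem_subst hxB hx).1 hw
      exact similar_map_raise hxB ((tight_iff_good_map_raise hxB w).2 hv.2)
    rcases p with _ | p
    · rw [subst_zero, selCoeff_zero, Finset.sum_singleton, one_mul]
    · rw [subst]
      split_ifs with hb
      · subst hb
        have hsm := hv.1 hxB
        have e : descTop x v = v.count b := by
          rw [(hv.2.tight hxB hvB').descTop_eq, List.count]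
          refine List.countP_congr fun a ha => ?_
          have := hvB' a ha
          simp; omega
        have h1 : ∀ w ∈ subst x b v (p + 1), makWeight q t z b (b :: w) =
            makWeight q t z b w * makFactor q t z b b v := fun w hw => by
          rw [makWeight, (hsim hw).makFactor_top_eq q t z hxB hsm]
        have h2 : ∀ w ∈ subst x b v p, makWeight q t z b (x :: w) =
            makWeight q t z b w * (q ^ v.count b * makFactor q t z b b v) := fun w hw => by
          rw [makWeight, (hsim hw).makFactor_eq_top q t z hxB hsm, e]
        rw [Finset.sum_union (disjoint_consF (by omega) _ _), sum_consF, sum_consF,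
          Finset.sum_congr rfl h1, Finset.sum_congr rfl h2, ← Finset.sum_mul, ← Finset.sum_mul,
          ih', ih', List.count_cons_self, selCoeff_succ, makWeight]
        ring
      · have hb' : b < x := by have := hvB b (by simp); omega
        have h1 : ∀ w ∈ subst x B v (p + 1), makWeight q t z B (b :: w) =
            makWeight q t z B w * makFactor q t z B b v := fun w hw => by
          rw [makWeight, (hsim hw).makFactor_eq q t z hb'.le (by omega), pow_zero, one_mul]
        rw [sum_consF, Finset.sum_congr rfl h1, ← Finset.sum_mul, ih',
          List.count_cons_of_ne hb, makWeight]
        ring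

end MakWeight

/-! ### New placeholders in front of `x`, and the transfer step for `mak` -/

section MakTransfer

/-- Put a letter `B` in front of `r` of the letters `x`. -/
def prefixIns (x B : ℕ) : List ℕ → ℕ → Finset (List ℕ)
  | [], 0 => {[]}
  | [], _ + 1 => ∅
  | b :: l, 0 => {b :: l}
  | b :: l, r + 1 =>
    if b = x then consF x (prefixIns x B l (r + 1)) ∪ consF B (consF x (prefixIns x B l r))
    else consF b (prefixIns x B l (r + 1))

theorem prefixIns_zero (x B : ℕ) (l : List ℕ) : prefixIns x B l 0 = {l} := by
  cases l <;> simp [prefixIns]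

theorem coe_prefixIns {x B : ℕ} {v : List ℕ} {r : ℕ} {w : List ℕ} (hw : w ∈ prefixIns x B v r) :
    (w : Multiset ℕ) = v + Multiset.replicate r B := by
  induction v generalizing r w with
  | nil => cases r <;> simp_all [prefixIns]
  | cons b v ih =>
    cases r with
    | zero => simp_all [prefixIns]
    | succ r =>
      rw [prefixIns] at hw
      split_ifs at hw with hb
      · rw [Finset.mem_union, mem_consF, mem_consF] at hw
        rcases hw with ⟨l, hl, rfl⟩ | ⟨l, hl, rfl⟩
        · rw [← Multiset.cons_coe, ih hl, hb, ← Multiset.cons_coe, Multiset.cons_add]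
        · obtain ⟨l', hl', rfl⟩ := mem_consF.1 hl
          rw [← Multiset.cons_coe, ← Multiset.cons_coe, ih hl', hb, ← Multiset.cons_coe,
            Multiset.replicate_succ, Multiset.add_cons, Multiset.cons_add]
      · obtain ⟨l, hl, rfl⟩ := mem_consF.1 hw
        rw [← Multiset.cons_coe, ih hl, ← Multiset.cons_coe, Multiset.cons_add]

theorem Good.removeP_gt {x : ℕ} {w : List ℕ} (h : Good x (x + 1) w) :
    Good x x (removeP x (x < ·) w) := by
  have hP : ∀ b, x < b → x ≤ b := fun b hb => hb.le
  induction w with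
  | nil => simp [removeP, Good]
  | cons b w ih =>
    rw [removeP]
    split_ifs with h'
    · exact ih h.2
    · refine ⟨fun hb => ?_, ih h.2⟩
      rw [headD_removeP_lt hP]
      simpa [hb] using h'

theorem head_eq_of_headD {x : ℕ} {w : List ℕ} (h1 : w.headD (x + 1) < x + 1)
    (h2 : ¬ w.headD x < x) : ∃ w', w = x :: w' := by
  cases w with
  | nil => simp at h1
  | cons a w =>
    simp only [List.headD_cons] at h1 h2
    obtain rfl : a = x := by omega
    exact ⟨w, rfl⟩

theorem removeP_gt_cons_self (x : ℕ) (w : List ℕ) :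
    removeP x (x < ·) (x :: w) = x :: removeP x (x < ·) w := by
  rw [removeP, if_neg (by simp)]

/-- A placeholder followed by a letter below `x + 1` but not below `x` stands in front of an `x`.
The old placeholders stand in front of smaller letters, so the new ones can be recognized and
`prefixIns` is the fibre of their deletion. -/
theorem mem_prefixIns {x B : ℕ} (hxB : x < B) {v : List ℕ} (hv : Good x x v) {r : ℕ} {w : List ℕ}
    (hw : ∀ b ∈ w, x < b → b = B) :
    w ∈ prefixIns x B v r ↔
      Good x (x + 1) w ∧ removeP x (x < ·) w = v ∧ w.count B = v.count B + r := by
  have hP : ∀ b, x < b → x ≤ b := fun b hb => hb.le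
  induction w generalizing v r with
  | nil =>
    rcases v with _ | ⟨y, v⟩
    · cases r <;> simp [prefixIns, removeP, Good]
    · simp only [removeP, List.nil_eq, reduceCtorEq, false_and, and_false, iff_false]
      cases r with
      | zero => simp [prefixIns]
      | succ k => rw [prefixIns]; split_ifs <;> simp
  | cons b w ih =>
    have hsmall := headD_removeP_lt hP w
    have ih' : ∀ v r, Good x x v → (w ∈ prefixIns x B v r ↔ Good x (x + 1) w ∧
        removeP x (x < ·) w = v ∧ w.count B = v.count B + r) :=
      fun v k h => ih h fun a ha => hw a (by simp [ha])
    clear ih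
    rw [removeP]
    rcases v with _ | ⟨y, v⟩
    · have e : b :: w ∉ prefixIns x B [] r := by cases r <;> simp [prefixIns]
      simp only [e, false_iff, not_and]
      intro h1 h2
      split_ifs at h2 with h
      obtain ⟨w', rfl⟩ := head_eq_of_headD (h1.1 h.1) h.2
      rw [removeP_gt_cons_self] at h2
      simp at h2
    · by_cases hy : y = x
      · subst hy
        have e : b :: w ∈ prefixIns y B (y :: v) r ↔ (b = y ∧ w ∈ prefixIns y B v r) ∨
            ∃ r' w', r = r' + 1 ∧ b = B ∧ w = y :: w' ∧ w ∈ prefixIns y B (y :: v) r' := by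
          have e' : ∀ r' w', y :: w' ∈ prefixIns y B (y :: v) r' ↔ w' ∈ prefixIns y B v r' := by
            intro r' w'
            cases r' with
            | zero => simp [prefixIns_zero]
            | succ r' => rw [prefixIns, if_pos rfl]; simp [hxB.ne']
          cases r with
          | zero => simp [prefixIns_zero]
          | succ r =>
            rw [prefixIns, if_pos rfl, Finset.mem_union, cons_mem_consF, cons_mem_consF, mem_consF]
            refine or_congr (by simp [eq_comm]) ?_
            constructor
            · rintro ⟨rfl, l, hl, rfl⟩
              exact ⟨r, l, rfl, rfl, rfl, (e' r l).2 hl⟩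
            · rintro ⟨r', w', h, rfl, rfl, hl⟩
              obtain rfl : r = r' := by omega
              exact ⟨rfl, w', (e' r w').1 hl, rfl⟩
        rw [e]
        constructor
        · rintro (⟨rfl, h⟩ | ⟨r', w', rfl, rfl, rfl, h⟩)
          · rw [ih' _ _ hv.2] at h
            obtain ⟨h1, h2, h3⟩ := h
            refine ⟨⟨by simp, h1⟩, by rw [if_neg (by simp), h2], ?_⟩
            rw [List.count_cons_of_ne (by omega), List.count_cons_of_ne (by omega), h3]
          · rw [ih' _ _ hv] at h
            obtain ⟨h1, h2, h3⟩ := h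
            refine ⟨⟨by simp, h1⟩, by rw [if_pos (by simpa using hxB), h2], ?_⟩
            rw [List.count_cons_self, h3]; omega
        · rintro ⟨h1, h2, h3⟩
          split_ifs at h2 with h
          · right
            obtain ⟨w', rfl⟩ := head_eq_of_headD (h1.1 h.1) h.2
            obtain rfl := hw b (by simp) h.1
            have hle := count_removeP_le y (y < ·) (y :: w') b
            rw [h2] at hle
            rw [List.count_cons_self] at h3
            refine ⟨r - 1, w', by omega, rfl, rfl, ?_⟩
            rw [ih' _ _ hv]
            exact ⟨h1.2, h2, by omega⟩
          · left
            obtain ⟨rfl, h4⟩ := List.cons.inj h2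
            rw [ih' _ _ hv.2]
            rw [List.count_cons_of_ne (by omega), List.count_cons_of_ne (by omega)] at h3
            exact ⟨rfl, h1.2, h4, h3⟩
      · have e : b :: w ∈ prefixIns x B (y :: v) r ↔ b = y ∧ w ∈ prefixIns x B v r := by
          cases r with
          | zero => simp [prefixIns_zero]
          | succ k => rw [prefixIns, if_neg hy, cons_mem_consF]; simp [eq_comm]
        rw [e, ih' _ _ hv.2]
        constructor
        · rintro ⟨rfl, h1, h2, h3⟩
          have hs : x < b → w.headD x < x := fun hb => by
            rw [← hsmall, h2]; exact hv.1 hb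
          refine ⟨⟨fun hb => ?_, h1⟩, ?_, ?_⟩
          · have := hs hb
            rw [headD_lt_iff le_rfl] at this ⊢
            obtain ⟨a, ha, h⟩ := this
            exact ⟨a, by omega, h⟩
          · rw [if_neg (by simp only [not_and, not_not]; exact hs), h2]
          · simp only [List.count_cons, h3]; omega
        · rintro ⟨h1, h2, h3⟩
          split_ifs at h2 with h
          · exfalso
            obtain ⟨w', rfl⟩ := head_eq_of_headD (h1.1 h.1) h.2
            rw [removeP_gt_cons_self] at h2
            exact hy (List.cons.inj h2).1.symm
          · obtain ⟨rfl, h4⟩ := List.cons.inj h2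
            refine ⟨rfl, h1.2, h4, ?_⟩
            simp only [List.count_cons] at h3
            omega

/-- Each deleted letter is a `B` in front of an `x`, hence a descent top, and no other descent
changes. -/
theorem descTop_removeP_gt {x B : ℕ} {w : List ℕ} (hxB : x < B) (hw : Good x (x + 1) w)
    (hwB : ∀ b ∈ w, x < b → b = B) {y : ℕ} (hy : y ≤ x) :
    descTop y w + (removeP x (x < ·) w).count B = descTop y (removeP x (x < ·) w) + w.count B := by
  have hP : ∀ b, x < b → x ≤ b := fun b hb => hb.le
  induction w with
  | nil => simp [removeP]
  | cons b w ih =>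
    have ih' := ih hw.2 fun a ha => hwB a (by simp [ha])
    rw [removeP]
    split_ifs with h
    · obtain ⟨w', rfl⟩ := head_eq_of_headD (hw.1 h.1) h.2
      obtain rfl := hwB b (by simp) h.1
      rw [descTop, List.count_cons_self, if_pos]
      · omega
      · simp only [List.headD_cons]; omega
    · have e : w.headD b < b ↔ (removeP x (x < ·) w).headD b < b := by
        by_cases hb : x < b
        · have h1 : w.headD x < x := by simpa [hb] using h
          rw [headD_lt_iff le_rfl] at h1
          obtain ⟨a, ha, h2⟩ := h1
          have h3 := (head?_removeP hP w ha).2 h2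
          rw [headD_lt_iff le_rfl, headD_lt_iff le_rfl]
          exact ⟨fun _ => ⟨a, by omega, h3⟩, fun _ => ⟨a, by omega, h2⟩⟩
        · rw [headD_lt_iff le_rfl, headD_lt_iff le_rfl]
          exact exists_congr fun a => and_congr_right fun ha =>
            (head?_removeP hP w (by omega)).symm
      rw [descTop, descTop]
      simp only [e, List.count_cons]
      omega

theorem similar_prefixIns {x B : ℕ} (hxB : x < B) {v : List ℕ} (hv : Good x x v)
    (hvB : ∀ b ∈ v, b ≤ x ∨ b = B) {r : ℕ} {w : List ℕ} (hw : w ∈ prefixIns x B v r) :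
    Similar x r w v := by
  have hP : ∀ b, x < b → x ≤ b := fun b hb => hb.le
  have hwB : ∀ b ∈ w, x < b → b = B := by
    intro b hb hxb
    have h := coe_prefixIns hw
    have hb' : b ∈ (w : Multiset ℕ) := hb
    rw [h, Multiset.mem_add] at hb'
    rcases hb' with hb' | hb'
    · have := hvB b hb'; omega
    · exact Multiset.eq_of_mem_replicate hb'
  obtain ⟨h1, rfl, h3⟩ := (mem_prefixIns hxB hv hwB).1 hw
  refine ⟨fun y hy => (head?_removeP hP w hy).symm, fun y hy => (countP_removeP hP w hy).symm, ?_⟩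
  intro y hy
  have := descTop_removeP_gt hxB h1 hwB hy
  omega

variable {A : Type*} [CommRing A]

/-- A new `B` in front of an `x` contributes `t * q^(1 + k)`, with `k` letters below `x` to its
right, and multiplies by `q` the factor of each letter up to `x` on its left. In total the exponent
is `N + 1` plus the number of `x` to the left, where `N` counts all letters below `x`; so the
exponents offered are `N + 1, …, N + c`. -/
theorem sum_prefixIns_makWeight (q t : A) (z : ℕ → A) {B x : ℕ} (hxB : x < B) {v : List ℕ}
    (hv : Good x x v) (hvB : ∀ b ∈ v, b ≤ x ∨ b = B) (r : ℕ) :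
    ∑ w ∈ prefixIns x B v r, makWeight q t z B w =
      openCoeff q t (v.countP (· < x)) (v.count x) r * makWeight q t z B v := by
  induction v generalizing r with
  | nil => cases r <;> simp [prefixIns, openCoeff]
  | cons b v ih =>
    have hvB' : ∀ b ∈ v, b ≤ x ∨ b = B := fun a ha => hvB a (by simp [ha])
    have ih' := ih hv.2 hvB'
    have hsim : ∀ {r w}, w ∈ prefixIns x B v r → Similar x r w v := fun hw =>
      similar_prefixIns hxB hv.2 hvB' hw
    rcases r with _ | r
    · rw [prefixIns_zero, openCoeff_zero, Finset.sum_singleton, one_mul]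
    · rw [prefixIns]
      split_ifs with hb
      · subst hb
        have h1 : ∀ w ∈ prefixIns b B v (r + 1), makWeight q t z B (b :: w) =
            makWeight q t z B w * (q ^ (r + 1) * makFactor q t z B b v) := fun w hw => by
          rw [makWeight, (hsim hw).makFactor_eq q t z le_rfl hxB]
        have h2 : ∀ w ∈ prefixIns b B v r, makWeight q t z B (B :: b :: w) =
            makWeight q t z B w * ((q ^ r * makFactor q t z B b v) *
              (t * q ^ (1 + v.countP (· < b)))) := fun w hw => by
          rw [makWeight, makWeight, (hsim hw).makFactor_eq q t z le_rfl hxB,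
            makFactor_of_head (y := B) (List.head?_cons ..) hxB, if_neg (lt_irrefl _),
            List.countP_cons_of_neg (by simp), (hsim hw).count b le_rfl]
          ring
        rw [Finset.sum_union (disjoint_consF (by omega) _ _), sum_consF, sum_consF, sum_consF,
          Finset.sum_congr rfl h1, Finset.sum_congr rfl h2, ← Finset.sum_mul, ← Finset.sum_mul,
          ih', ih', List.count_cons_self, List.countP_cons_of_neg (by simp), openCoeff_succ_left,
          makWeight]
        ring
      · rw [sum_consF, List.count_cons_of_ne hb]
        rcases hvB b (by simp) with h | rfl
        · have hb' : b < x := by omega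
          have h1 : ∀ w ∈ prefixIns x B v (r + 1), makWeight q t z B (b :: w) =
              makWeight q t z B w * (q ^ (r + 1) * makFactor q t z B b v) := fun w hw => by
            rw [makWeight, (hsim hw).makFactor_eq q t z h (by omega)]
          rw [Finset.sum_congr rfl h1, ← Finset.sum_mul, ih', List.countP_cons_of_pos (by simpa),
            openCoeff_shift, makWeight]
          ring
        · have h1 : ∀ w ∈ prefixIns x b v (r + 1), makWeight q t z b (b :: w) =
              makWeight q t z b w * makFactor q t z b b v := fun w hw => by
            rw [makWeight, (hsim hw).makFactor_top_eq q t z hxB (hv.1 hxB)]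
          rw [Finset.sum_congr rfl h1, ← Finset.sum_mul, ih',
            List.countP_cons_of_neg (by simp; omega), makWeight]
          ring

open Classical in
/-- The words with content `s` and `H` letters `B`, where letters above `x` are followed by
letters below `m`. -/
noncomputable def goodPerms (x m B : ℕ) (s : Multiset ℕ) (H : ℕ) : Finset (List ℕ) :=
  (perms (s + Multiset.replicate H B)).filter (Good x m)

open Classical in
theorem mem_goodPerms {x m B : ℕ} {s : Multiset ℕ} {H : ℕ} {w : List ℕ} :
    w ∈ goodPerms x m B s H ↔ (w : Multiset ℕ) = s + Multiset.replicate H B ∧ Good x m w := by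
  rw [goodPerms, Finset.mem_filter, mem_perms]

theorem mem_of_coe_eq_add {w : List ℕ} {s : Multiset ℕ} {H B : ℕ}
    (h : (w : Multiset ℕ) = s + Multiset.replicate H B) {b : ℕ} (hb : b ∈ w) : b ∈ s ∨ b = B := by
  have hb' : b ∈ (w : Multiset ℕ) := hb
  rw [h, Multiset.mem_add] at hb'
  exact hb'.imp_right Multiset.eq_of_mem_replicate

theorem sum_goodPerms_prefix (q t : A) (z : ℕ → A) {B x : ℕ} (hxB : x < B) {s : Multiset ℕ}
    (hs : ∀ b ∈ s, b ≤ x) (H : ℕ) :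
    ∑ w ∈ goodPerms x (x + 1) B s H, makWeight q t z B w =
      ∑ r ∈ Finset.range (H + 1), openCoeff q t (s.countP (· < x)) (s.count x) r *
        ∑ w ∈ goodPerms x x B s (H - r), makWeight q t z B w := by
  have hBs : B ∉ s := fun h => by have := hs B h; omega
  have hcount : ∀ {w : List ℕ} {H}, (w : Multiset ℕ) = s + Multiset.replicate H B →
      w.count B = H := by
    intro w H h
    rw [← Multiset.coe_count, h, Multiset.count_add, Multiset.count_eq_zero.2 hBs]
    simp
  have hwB : ∀ {w : List ℕ} {H}, (w : Multiset ℕ) = s + Multiset.replicate H B →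
      ∀ b ∈ w, b ≤ x ∨ b = B := fun h b hb => (mem_of_coe_eq_add h hb).imp_left (hs b)
  have hwB' : ∀ {w : List ℕ} {H}, (w : Multiset ℕ) = s + Multiset.replicate H B →
      ∀ b ∈ w, x < b → b = B := fun h b hb hxb => (hwB h b hb).resolve_left (by omega)
  have hmap : ∀ w ∈ goodPerms x (x + 1) B s H,
      H - (removeP x (x < ·) w).count B ∈ Finset.range (H + 1) := by
    intro w _
    rw [Finset.mem_range]; omega
  rw [← Finset.sum_fiberwise_of_maps_to hmap]
  refine Finset.sum_congr rfl fun r hr => ?_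
  have hr' : r ≤ H := by have := Finset.mem_range.1 hr; omega
  have hfib : ∀ w, w ∈ (goodPerms x (x + 1) B s H).filter
      (fun w => H - (removeP x (x < ·) w).count B = r) → w ∈ prefixIns x B (removeP x (x < ·) w) r := by
    intro w hw
    rw [Finset.mem_filter, mem_goodPerms] at hw
    obtain ⟨⟨h1, h2⟩, h3⟩ := hw
    rw [mem_prefixIns hxB h2.removeP_gt (hwB' h1)]
    refine ⟨h2, rfl, ?_⟩
    have := count_removeP_le x (x < ·) w B
    rw [hcount h1] at this ⊢
    omega
  have hsplit : s + Multiset.replicate H B =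
      s + Multiset.replicate (H - r) B + Multiset.replicate r B := by
    rw [add_assoc, ← Multiset.replicate_add, Nat.sub_add_cancel hr']
  rw [sum_eq_sum_fibers (T := goodPerms x x B s (H - r)) (removeP x (x < ·))
    (fun v => prefixIns x B v r), Finset.mul_sum]
  · refine Finset.sum_congr rfl fun v hv => ?_
    rw [mem_goodPerms] at hv
    rw [sum_prefixIns_makWeight q t z hxB hv.2 (hwB hv.1)]
    congr 2
    · rw [← Multiset.coe_countP, hv.1, Multiset.countP_add, Nat.add_eq_left, Multiset.countP_eq_zero]
      intro a ha
      rw [Multiset.eq_of_mem_replicate ha]; omega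
    · rw [← Multiset.coe_count, hv.1, Multiset.count_add, Nat.add_eq_left,
        Multiset.count_replicate, if_neg (by omega)]
  · intro w hw
    have h := coe_prefixIns (hfib w hw)
    rw [Finset.mem_filter, mem_goodPerms] at hw
    rw [mem_goodPerms]
    refine ⟨?_, hw.1.2.removeP_gt⟩
    rw [hw.1.1, hsplit] at h
    exact (add_right_cancel h).symm
  · intro v hv w
    rw [mem_goodPerms] at hv
    rw [Finset.mem_filter, mem_goodPerms]
    constructor
    · intro h
      have h1 := coe_prefixIns h
      rw [hv.1, ← hsplit] at h1
      obtain ⟨h2, h3, h4⟩ := (mem_prefixIns hxB hv.2 (hwB' h1)).1 h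
      refine ⟨⟨⟨h1, h2⟩, ?_⟩, h3⟩
      rw [h3, hcount hv.1]; omega
    · rintro ⟨h, rfl⟩
      exact hfib w (by rw [Finset.mem_filter, mem_goodPerms]; exact h)

theorem coe_subst {x B : ℕ} {v : List ℕ} {p : ℕ} {w : List ℕ} (hw : w ∈ subst x B v p) :
    (w : Multiset ℕ) + Multiset.replicate p B = v + Multiset.replicate p x := by
  induction v generalizing p w with
  | nil => cases p <;> simp_all [subst]
  | cons b v ih =>
    cases p with
    | zero => simp_all [subst]
    | succ p =>
      rw [subst] at hw
      split_ifs at hw with hb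
      · rw [Finset.mem_union, mem_consF, mem_consF] at hw
        rcases hw with ⟨l, hl, rfl⟩ | ⟨l, hl, rfl⟩
        · rw [← Multiset.cons_coe, Multiset.cons_add, ih hl, hb, ← Multiset.cons_coe,
            Multiset.cons_add]
        · rw [← Multiset.cons_coe, ← Multiset.cons_coe, Multiset.replicate_succ,
            Multiset.replicate_succ, Multiset.add_cons, Multiset.add_cons, Multiset.cons_add,
            Multiset.cons_add, ih hl, hb, Multiset.cons_swap]
      · obtain ⟨l, hl, rfl⟩ := mem_consF.1 hw
        rw [← Multiset.cons_coe, ← Multiset.cons_coe, Multiset.cons_add, ih hl, Multiset.cons_add]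

theorem count_eq_of_coe_eq {x B : ℕ} (hxB : x < B) {s : Multiset ℕ} (hs : ∀ b ∈ s, b < x)
    {w : List ℕ} {p o : ℕ}
    (h : (w : Multiset ℕ) = s + Multiset.replicate p x + Multiset.replicate o B) :
    w.count x = p ∧ w.count B = o ∧ w.countP (x ≤ ·) = p + o := by
  have h1 : x ∉ s := fun h => lt_irrefl _ (hs x h)
  have h2 : B ∉ s := fun h => by have := hs B h; omega
  rw [← Multiset.coe_count, ← Multiset.coe_count, ← Multiset.coe_countP, h]
  simp only [Multiset.count_add, Multiset.countP_add, Multiset.count_eq_zero.2 h1,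
    Multiset.count_eq_zero.2 h2, Multiset.count_replicate, hxB.ne, hxB.ne', if_true, if_false]
  refine ⟨by simp, by simp, ?_⟩
  rw [Multiset.countP_eq_zero.2, Multiset.countP_eq_card.2, Multiset.countP_eq_card.2]
  · simp
  · intro a ha; rw [Multiset.eq_of_mem_replicate ha]; omega
  · intro a ha; rw [Multiset.eq_of_mem_replicate ha]
  · intro a ha; have := hs a ha; omega

theorem subst_fiber_iff {x B : ℕ} (hxB : x < B) {s : Multiset ℕ} (hs : ∀ b ∈ s, b < x) {p o : ℕ}
    {v : List ℕ} (hv : (v : Multiset ℕ) = s + Multiset.replicate (o + p) B) (w : List ℕ) :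
    w ∈ subst x B v p ↔
      (w : Multiset ℕ) = s + Multiset.replicate p x + Multiset.replicate o B ∧
        w.map (raise x B) = v := by
  have hx : x ∉ v := fun h => by
    rcases mem_of_coe_eq_add hv h with h | h
    · exact lt_irrefl _ (hs x h)
    · omega
  constructor
  · intro h
    refine ⟨?_, ((mem_subst hxB hx).1 h).1⟩
    have := coe_subst h
    rw [hv, Multiset.replicate_add, ← add_assoc, add_right_comm _ _ (Multiset.replicate p x)] at this
    rw [add_right_cancel this, add_right_comm]
  · rintro ⟨h1, h2⟩
    exact (mem_subst hxB hx).2 ⟨h2, (count_eq_of_coe_eq hxB hs h1).1⟩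

theorem coe_map_raise {x B : ℕ} {s : Multiset ℕ} (hs : ∀ b ∈ s, b < x) {p o : ℕ}
    {w : List ℕ} (hw : (w : Multiset ℕ) = s + Multiset.replicate p x + Multiset.replicate o B) :
    ((w.map (raise x B) : List ℕ) : Multiset ℕ) = s + Multiset.replicate (o + p) B := by
  rw [← Multiset.map_coe, hw, Multiset.map_add, Multiset.map_add, Multiset.map_replicate,
    Multiset.map_replicate]
  have h1 : s.map (raise x B) = s := by
    conv_rhs => rw [← Multiset.map_id s]
    refine Multiset.map_congr rfl fun a ha => ?_
    have := hs a ha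
    simp only [raise, id]; split_ifs <;> omega
  have h2 : raise x B x = B := by simp [raise]
  have h3 : raise x B B = B := by simp [raise]
  rw [h1, h2, h3, add_assoc, ← Multiset.replicate_add, add_comm p]

-- Two fibrations in succession. Deleting the copies of `x` not followed by a smaller letter leaves
-- a tight word with `p` copies of `x`; raising these to `B` gives a word with `o + p` placeholders
-- and no `x`.
open Classical in
theorem sum_goodPerms_fill (q t : A) (z : ℕ → A) {B x : ℕ} (hxB : x < B) {s : Multiset ℕ}
    (hs : ∀ b ∈ s, b < x) (c o : ℕ) :
    ∑ w ∈ goodPerms x x B (s + Multiset.replicate c x) o, makWeight q t z B w =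
      fillSum q (z x) (fun H => ∑ w ∈ goodPerms x x B s H, makWeight q t z B w) c o := by
  have hmap : ∀ w ∈ goodPerms x x B (s + Multiset.replicate c x) o,
      (removeP x (· = x) w).count x ∈ Finset.range (c + 1) := by
    intro w hw
    rw [mem_goodPerms] at hw
    have h1 := count_removeP_le x (· = x) w x
    rw [(count_eq_of_coe_eq hxB hs hw.1).1] at h1
    rw [Finset.mem_range]; omega
  rw [← Finset.sum_fiberwise_of_maps_to hmap, fillSum]
  refine Finset.sum_congr rfl fun p hp => ?_
  have hp' : p ≤ c := by have := Finset.mem_range.1 hp; omega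
  have hsplit : s + Multiset.replicate c x + Multiset.replicate o B =
      s + Multiset.replicate p x + Multiset.replicate o B + Multiset.replicate (c - p) x := by
    rw [add_right_comm _ (Multiset.replicate o B) (Multiset.replicate (c - p) x), add_assoc s (Multiset.replicate p x),
      ← Multiset.replicate_add, Nat.add_sub_cancel' hp']
  have hfib : ∀ w, w ∈ (goodPerms x x B (s + Multiset.replicate c x) o).filter
      (fun w => (removeP x (· = x) w).count x = p) →
      w ∈ closeIns x (removeP x (· = x) w) (c - p) := by
    intro w hw
    rw [Finset.mem_filter, mem_goodPerms] at hw
    obtain ⟨⟨h1, h2⟩, h3⟩ := hw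
    rw [mem_closeIns h2.tight_removeP]
    refine ⟨h2, rfl, ?_⟩
    rw [(count_eq_of_coe_eq hxB hs h1).1, h3]
    omega
  rw [sum_eq_sum_fibers (T := (perms (s + Multiset.replicate p x + Multiset.replicate o B)).filter
    (Tight x)) (removeP x (· = x)) (fun v => closeIns x v (c - p))]
  · have h1 : ∀ v ∈ (perms (s + Multiset.replicate p x + Multiset.replicate o B)).filter (Tight x),
        ∑ w ∈ closeIns x v (c - p), makWeight q t z B w =
          shufCoeff q (z x) (o + p) (c - p) * makWeight q t z B v := by
      intro v hv
      rw [Finset.mem_filter, mem_perms] at hv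
      rw [sum_closeIns_makWeight q t z hxB hv.2, (count_eq_of_coe_eq hxB hs hv.1).2.2, add_comm p]
      intro b hb
      refine (mem_of_coe_eq_add hv.1 hb).imp_left fun h => ?_
      rcases Multiset.mem_add.1 h with h | h
      · exact (hs b h).le
      · exact (Multiset.eq_of_mem_replicate h).le
    rw [Finset.sum_congr rfl h1, ← Finset.mul_sum,
      sum_eq_sum_fibers (T := goodPerms x x B s (o + p)) (List.map (raise x B))
        (fun v => subst x B v p)]
    · have h2 : ∀ v ∈ goodPerms x x B s (o + p), ∑ w ∈ subst x B v p, makWeight q t z B w =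
          selCoeff q (o + p) p * makWeight q t z B v := by
        intro v hv
        rw [mem_goodPerms] at hv
        rw [sum_subst_makWeight q t z hxB hv.2
          fun b hb => (mem_of_coe_eq_add hv.1 hb).imp_left (hs b)]
        have := count_eq_of_coe_eq hxB hs (p := 0) (o := o + p) (w := v) (by simpa using hv.1)
        rw [this.2.1]
      rw [Finset.sum_congr rfl h2, ← Finset.mul_sum]
      ring
    · intro w hw
      rw [Finset.mem_filter, mem_perms] at hw
      rw [mem_goodPerms]
      exact ⟨coe_map_raise hs hw.1, (tight_iff_good_map_raise hxB w).1 hw.2⟩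
    · intro v hv w
      rw [mem_goodPerms] at hv
      rw [Finset.mem_filter, mem_perms, subst_fiber_iff hxB hs hv.1, and_assoc]
      refine and_congr_right fun _ => ⟨fun h => ⟨?_, h⟩, fun h => h.2⟩
      rw [tight_iff_good_map_raise hxB, h]
      exact hv.2
  · intro w hw
    have h := coe_closeIns (hfib w hw)
    rw [Finset.mem_filter, mem_goodPerms] at hw
    rw [Finset.mem_filter, mem_perms]
    refine ⟨?_, hw.1.2.tight_removeP⟩
    rw [hw.1.1, hsplit] at h
    exact (add_right_cancel h).symm
  · intro v hv w
    rw [Finset.mem_filter, mem_perms] at hv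
    rw [Finset.mem_filter, mem_goodPerms]
    constructor
    · intro h
      have h1 := coe_closeIns h
      rw [hv.1, ← hsplit] at h1
      obtain ⟨h2, h3, h4⟩ := (mem_closeIns hv.2).1 h
      refine ⟨⟨⟨h1, h2⟩, ?_⟩, h3⟩
      rw [h3, (count_eq_of_coe_eq hxB hs hv.1).1]
    · rintro ⟨h, rfl⟩
      exact hfib w (by rw [Finset.mem_filter, mem_goodPerms]; exact h)

/-- Both thresholds single out exactly the letters `B`, as the ordinary letters are at most `x`. -/
theorem goodPerms_succ {x B : ℕ} (hxB : x + 1 < B) {s : Multiset ℕ} (hs : ∀ b ∈ s, b ≤ x) (H : ℕ) :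
    goodPerms (x + 1) (x + 1) B s H = goodPerms x (x + 1) B s H := by
  ext w
  rw [mem_goodPerms, mem_goodPerms]
  refine and_congr_right fun h => ?_
  have hw : ∀ b ∈ w, b ≤ x ∨ b = B := fun b hb => (mem_of_coe_eq_add h hb).imp_left (hs b)
  clear h
  induction w with
  | nil => simp [Good]
  | cons b w ih =>
    have ih' := ih fun a ha => hw a (by simp [ha])
    have := hw b (by simp)
    have e : x + 1 < b ↔ x < b := by omega
    exact and_congr (by rw [e]) ih'

/-- The `mak` side: words with `H` isolated letters `B`. -/
noncomputable def makGF (q t : A) (z : ℕ → A) (x B : ℕ) (s : Multiset ℕ) (H : ℕ) : A :=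
  ∑ w ∈ goodPerms x x B s H, makWeight q t z B w

/-- With `x` present, placeholders in front of an `x` are first forbidden, which gives `fillSum`,
and then allowed, which gives `openSteps`. -/
theorem makGF_eq_transfer (q t : A) (z : ℕ → A) {B x : ℕ} (hxB : x + 1 < B) {s : Multiset ℕ}
    (hs : ∀ b ∈ s, b < x) (c : ℕ) :
    makGF q t z (x + 1) B (s + Multiset.replicate c x) =
      transfer q t (z x) (Multiset.card s) c (makGF q t z x B s) := by
  funext H
  have hs' : ∀ b ∈ s + Multiset.replicate c x, b ≤ x := by
    intro b hb
    rcases Multiset.mem_add.1 hb with h | h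
    · exact (hs b h).le
    · exact (Multiset.eq_of_mem_replicate h).le
  have hx : x ∉ s := fun h => lt_irrefl _ (hs x h)
  rw [makGF, goodPerms_succ hxB hs', sum_goodPerms_prefix q t z (by omega) hs', transfer,
    openSteps_eq_sum]
  refine Finset.sum_congr rfl fun r _ => ?_
  rw [sum_goodPerms_fill q t z (by omega) hs]
  congr 2
  · rw [Multiset.countP_add, Multiset.countP_eq_card.2 hs, Nat.add_eq_left,
      Multiset.countP_eq_zero]
    intro a ha; rw [Multiset.eq_of_mem_replicate ha]; omega
  · rw [Multiset.count_add, Multiset.count_eq_zero.2 hx]; simp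

end MakTransfer

/-! ### Denert's statistic: placeholders among the excedances, and the transfer step for `den` -/

section Den

/-- The excedance letters of `w` relative to `a`. -/
def excPart : List ℕ → List ℕ → List ℕ
  | a :: as, b :: w => if a < b then b :: excPart as w else excPart as w
  | _, _ => []

/-- The letters of `w` that are not excedances relative to `a`. -/
def nexPart : List ℕ → List ℕ → List ℕ
  | a :: as, b :: w => if a < b then nexPart as w else b :: nexPart as w
  | _, w => w

/-- The number of letters that are at most `b`, where pairs of letters from `B` on are ignored. -/
def countLe (B b : ℕ) (l : List ℕ) : ℕ :=
  if b < B then l.countP (· ≤ b) else l.countP (· < B)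

theorem excPart_append {a w₁ : List ℕ} (h : w₁.length = a.length) (w₃ : List ℕ) :
    excPart a (w₁ ++ w₃) = excPart a w₁ := by
  induction a generalizing w₁ with
  | nil => simp [excPart]
  | cons a as ih =>
    rcases w₁ with _ | ⟨b, w⟩
    · simp at h
    · simp only [List.cons_append, excPart]
      rw [ih (by simpa using h)]

theorem nexPart_append {a w₁ : List ℕ} (h : w₁.length = a.length) (w₃ : List ℕ) :
    nexPart a (w₁ ++ w₃) = nexPart a w₁ ++ w₃ := by
  induction a generalizing w₁ with
  | nil => simp_all [nexPart]
  | cons a as ih =>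
    rcases w₁ with _ | ⟨b, w⟩
    · simp at h
    · simp only [List.cons_append, nexPart]
      rw [ih (by simpa using h)]
      split_ifs <;> simp

theorem excPart_snoc {a w₁ : List ℕ} (h : w₁.length = a.length) (x b : ℕ) :
    excPart (a ++ [x]) (w₁ ++ [b]) = excPart a w₁ ++ if x < b then [b] else [] := by
  induction a generalizing w₁ with
  | nil =>
    obtain rfl := List.length_eq_zero_iff.1 h
    simp [excPart]
  | cons a as ih =>
    rcases w₁ with _ | ⟨c, w⟩
    · simp at h
    · simp only [List.cons_append, excPart]
      rw [ih (by simpa using h)]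
      split_ifs <;> simp

theorem nexPart_snoc {a w₁ : List ℕ} (h : w₁.length = a.length) (x b : ℕ) :
    nexPart (a ++ [x]) (w₁ ++ [b]) = nexPart a w₁ ++ if x < b then [] else [b] := by
  induction a generalizing w₁ with
  | nil =>
    obtain rfl := List.length_eq_zero_iff.1 h
    simp [nexPart]
  | cons a as ih =>
    rcases w₁ with _ | ⟨c, w⟩
    · simp at h
    · simp only [List.cons_append, nexPart]
      rw [ih (by simpa using h)]
      split_ifs <;> simp

theorem excPart_map_raise {x B : ℕ} (hxB : x < B) {a : List ℕ} (ha : ∀ y ∈ a, y < x)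
    (w : List ℕ) : excPart a (w.map (raise x B)) = (excPart a w).map (raise x B) := by
  induction a generalizing w with
  | nil => simp [excPart]
  | cons a as ih =>
    rcases w with _ | ⟨b, w⟩
    · simp [excPart]
    · have h1 : a < raise x B b ↔ a < b := by
        have := ha a (by simp)
        unfold raise; split_ifs <;> omega
      simp only [List.map_cons, excPart, h1]
      rw [ih fun y hy => ha y (by simp [hy])]
      split_ifs <;> simp

theorem nexPart_map_raise {x B : ℕ} (hxB : x < B) {a : List ℕ} (ha : ∀ y ∈ a, y < x)
    {w : List ℕ} (hw : w.length = a.length) : nexPart a (w.map (raise x B)) = nexPart a w := by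
  induction a generalizing w with
  | nil =>
    obtain rfl := List.length_eq_zero_iff.1 hw
    simp [nexPart]
  | cons a as ih =>
    rcases w with _ | ⟨b, w⟩
    · simp [nexPart]
    · have h0 := ha a (by simp)
      have h1 : a < raise x B b ↔ a < b := by
        unfold raise; split_ifs <;> omega
      simp only [List.map_cons, nexPart, h1]
      rw [ih (fun y hy => ha y (by simp [hy])) (by simpa using hw)]
      split_ifs with h
      · rfl
      · have : raise x B b = b := by unfold raise; split_ifs <;> omega
        rw [this]

theorem count_excPart {x : ℕ} {a : List ℕ} (ha : ∀ y ∈ a, y < x) {w : List ℕ}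
    (hw : w.length = a.length) : (excPart a w).count x = w.count x := by
  induction a generalizing w with
  | nil =>
    obtain rfl := List.length_eq_zero_iff.1 hw
    simp [excPart]
  | cons a as ih =>
    rcases w with _ | ⟨b, w⟩
    · simp [excPart]
    · have h0 := ha a (by simp)
      have ih' := ih (fun y hy => ha y (by simp [hy])) (w := w) (by simpa using hw)
      simp only [excPart]
      split_ifs with h
      · simp only [List.count_cons, ih']
      · rw [ih', List.count_cons_of_ne (by omega)]

theorem mem_of_mem_excPart {a w : List ℕ} {b : ℕ} (h : b ∈ excPart a w) : b ∈ w := by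
  induction a generalizing w with
  | nil => simp [excPart] at h
  | cons a as ih =>
    rcases w with _ | ⟨c, w⟩
    · simp [excPart] at h
    · simp only [excPart] at h
      split_ifs at h
      · rcases List.mem_cons.1 h with h | h
        · simp [h]
        · simp [ih h]
      · simp [ih h]

theorem nexPart_lt {x : ℕ} {a w : List ℕ} (ha : ∀ y ∈ a, y < x) (hw : w.length = a.length) {b : ℕ}
    (h : b ∈ nexPart a w) : b < x := by
  induction a generalizing w with
  | nil =>
    obtain rfl := List.length_eq_zero_iff.1 hw
    simp [nexPart] at h
  | cons a as ih =>
    rcases w with _ | ⟨c, w⟩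
    · simp [nexPart] at h
    · have ih' := fun h => ih (fun y hy => ha y (by simp [hy])) (w := w) (by simpa using hw) h
      have := ha a (by simp)
      simp only [nexPart] at h
      split_ifs at h
      · exact ih' h
      · rcases List.mem_cons.1 h with h | h
        · omega
        · exact ih' h

variable {A : Type*} [CommRing A]

/-- The weight of the excedances; positions are counted from `k` on. -/
def excWeight (q t : A) (B : ℕ) : ℕ → List ℕ → List ℕ → A
  | k, a :: as, b :: w => (if a < b then t * q ^ (k + countLe B b (excPart as w)) else 1) *
      excWeight q t B (k + 1) as w
  | _, _, _ => 1

/-- The weight of the letters that are not excedances. -/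
def nexWeight (q : A) (z : ℕ → A) : List ℕ → A
  | [] => 1
  | b :: l => q ^ l.countP (· < b) * (if ∀ y ∈ l, b ≤ y then z b else 1) * nexWeight q z l

/-- The weight `t^exc q^den` times the weight of the right-to-left minima. -/
def denWeight (q t : A) (z : ℕ → A) (B : ℕ) (a w : List ℕ) : A :=
  excWeight q t B 1 a w * nexWeight q z (nexPart a w)

theorem excWeight_append (q t : A) (B k : ℕ) {a w₁ : List ℕ} (h : w₁.length = a.length)
    (w₃ : List ℕ) : excWeight q t B k a (w₁ ++ w₃) = excWeight q t B k a w₁ := by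
  induction a generalizing w₁ k with
  | nil => simp [excWeight]
  | cons a as ih =>
    rcases w₁ with _ | ⟨b, w⟩
    · simp at h
    · simp only [List.cons_append, excWeight]
      rw [ih _ (by simpa using h), excPart_append (by simpa using h)]

theorem excWeight_snoc (q t : A) (B k : ℕ) {a w₁ : List ℕ} (h : w₁.length = a.length) {x b : ℕ}
    (hb : b ≤ x ∨ b = B) :
    excWeight q t B k (a ++ [x]) (w₁ ++ [b]) =
      excWeight q t B k a w₁ * if x < b then t * q ^ (k + a.length) else 1 := by
  induction a generalizing w₁ k with
  | nil =>
    obtain rfl := List.length_eq_zero_iff.1 h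
    simp [excWeight, excPart, countLe]
  | cons a as ih =>
    rcases w₁ with _ | ⟨c, w⟩
    · simp at h
    · have h' : w.length = as.length := by simpa using h
      have e : countLe B c (excPart (as ++ [x]) (w ++ [b])) = countLe B c (excPart as w) := by
        rw [excPart_snoc h']
        unfold countLe
        split_ifs with h1 h2 h2
        · rw [List.countP_append, List.countP_singleton, if_neg (by simp; omega), add_zero]
        · simp
        · rw [List.countP_append, List.countP_singleton, if_neg (by simp; omega), add_zero]
        · simp
      simp only [List.cons_append, excWeight, e]
      rw [ih _ h', List.length_cons, mul_assoc, show k + 1 + as.length = k + (as.length + 1) by ring]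

theorem countP_lt_of_mem_ins {x : ℕ} {v w : List ℕ} {k : ℕ} (hw : w ∈ ins x v k) {b : ℕ}
    (hb : b ≤ x) : w.countP (· < b) = v.countP (· < b) := by
  have := congrArg (Multiset.countP (· < b)) (coe_ins hw)
  rw [Multiset.countP_add, Multiset.coe_countP, Multiset.coe_countP] at this
  rw [this, Nat.add_eq_left, Multiset.countP_eq_zero]
  intro a ha
  rw [Multiset.eq_of_mem_replicate ha]; omega

theorem forall_le_iff_of_mem_ins {x : ℕ} {v w : List ℕ} {k : ℕ} (hw : w ∈ ins x v k) {b : ℕ}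
    (hb : b ≤ x) : (∀ y ∈ w, b ≤ y) ↔ ∀ y ∈ v, b ≤ y := by
  have h := countP_lt_of_mem_ins hw hb
  have e : ∀ l : List ℕ, (∀ a ∈ l, b ≤ a) ↔ l.countP (· < b) = 0 := by
    intro l; rw [List.countP_eq_zero]; simp
  rw [e, e, h]

theorem nexWeight_replicate (q : A) (z : ℕ → A) (x k : ℕ) :
    nexWeight q z (List.replicate k x) = z x ^ k := by
  induction k with
  | zero => simp [nexWeight]
  | succ k ih =>
    rw [List.replicate_succ, nexWeight, ih, if_pos, List.countP_eq_zero.2, pow_zero, pow_succ',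
      one_mul]
    · intro y hy; simp [List.eq_of_mem_replicate hy]
    · intro y hy; exact (List.eq_of_mem_replicate hy).ge

/-- An `x` inserted among smaller letters has one inversion with each smaller letter to its right;
the copies at the end have none and are right-to-left minima. -/
theorem sum_ins_nexWeight (q : A) (z : ℕ → A) {x : ℕ} {v : List ℕ} (hv : ∀ b ∈ v, b < x) (k : ℕ) :
    ∑ w ∈ ins x v k, nexWeight q z w = shufCoeff q (z x) v.length k * nexWeight q z v := by
  induction v generalizing k with
  | nil => simp [ins, nexWeight_replicate, shufCoeff, nexWeight]
  | cons y v ih =>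
    have hy : y < x := hv y (by simp)
    have ih' := ih fun b hb => hv b (by simp [hb])
    induction k with
    | zero => rw [ins_zero, Finset.sum_singleton, shufCoeff_zero, one_mul]
    | succ k ihk =>
      have h1 : ∀ w ∈ ins x (y :: v) k, nexWeight q z (x :: w) =
          q ^ (v.length + 1) * nexWeight q z w := by
        intro w hw
        have hne : ¬ ∀ b ∈ w, x ≤ b := by
          rw [forall_le_iff_of_mem_ins hw le_rfl]
          intro h; have := h y (by simp); omega
        rw [nexWeight, countP_lt_of_mem_ins hw le_rfl, if_neg hne, List.countP_eq_length.2,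
          List.length_cons, mul_one]
        simpa using hv
      have h2 : ∀ w ∈ ins x v (k + 1), nexWeight q z (y :: w) =
          q ^ v.countP (· < y) * (if ∀ b ∈ v, y ≤ b then z y else 1) * nexWeight q z w := by
        intro w hw
        rw [nexWeight, countP_lt_of_mem_ins hw hy.le]
        simp only [forall_le_iff_of_mem_ins hw hy.le]
      rw [sum_ins_succ (by omega), Finset.sum_congr rfl h1, Finset.sum_congr rfl h2,
        ← Finset.mul_sum, ← Finset.mul_sum, ihk, ih', List.length_cons, shufCoeff_succ_succ,
        nexWeight]
      ring

theorem sum_ins_nexWeight_append (q : A) (z : ℕ → A) {x : ℕ} {v u : List ℕ} (hv : ∀ b ∈ v, b < x)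
    (hu : ∀ b ∈ u, b < x) (k : ℕ) :
    ∑ w ∈ ins x v k, nexWeight q z (u ++ w) =
      shufCoeff q (z x) v.length k * nexWeight q z (u ++ v) := by
  induction u with
  | nil => simpa using sum_ins_nexWeight q z hv k
  | cons y u ih =>
    have hy : y < x := hu y (by simp)
    have h2 : ∀ w ∈ ins x v k, nexWeight q z (y :: u ++ w) =
        q ^ (u ++ v).countP (· < y) * (if ∀ b ∈ u ++ v, y ≤ b then z y else 1) *
          nexWeight q z (u ++ w) := by
      intro w hw
      rw [List.cons_append, nexWeight, List.countP_append, countP_lt_of_mem_ins hw hy.le,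
        List.countP_append]
      simp only [List.mem_append, or_imp, forall_and, forall_le_iff_of_mem_ins hw hy.le]
    rw [Finset.sum_congr rfl h2, ← Finset.mul_sum, ih fun b hb => hu b (by simp [hb]),
      List.cons_append, nexWeight]
    ring

theorem countP_map_raise_add_count {x B : ℕ} (hxB : x < B) (e : List ℕ) :
    (e.map (raise x B)).countP (· < B) + e.count x = e.countP (· < B) := by
  induction e with
  | nil => simp
  | cons b e ih =>
    simp only [List.map_cons, List.countP_cons, List.count_cons]
    rw [← ih]
    by_cases hb : b = x
    · simp [raise, hb, hxB]; ring
    · simp [raise, hb]; ring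

/-- Besides smaller letters, the first placeholder counts exactly the copies of `x` to its right:
all `p + 1` of them if it stays `B`, the remaining `p` if it becomes `x` itself. This is the
recursion `selCoeff_succ_left`. -/
theorem sum_subst_excWeight (q t : A) {x B : ℕ} (hxB : x < B) {a v : List ℕ}
    (ha : ∀ y ∈ a, y < x) (hv : ∀ b ∈ v, b < x ∨ b = B) (hlen : v.length = a.length) (k p : ℕ) :
    ∑ w ∈ subst x B v p, excWeight q t B k a w =
      selCoeff q (v.count B) p * excWeight q t B k a v := by
  induction v generalizing a k p with
  | nil => cases p <;> simp [subst, selCoeff]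
  | cons b v ih =>
    rcases a with _ | ⟨a, as⟩
    · simp at hlen
    have ha0 := ha a (by simp)
    have ha' : ∀ y ∈ as, y < x := fun y hy => ha y (by simp [hy])
    have hv' : ∀ b ∈ v, b < x ∨ b = B := fun c hc => hv c (by simp [hc])
    have hlen' : v.length = as.length := by simpa using hlen
    have hxv : x ∉ v := fun h => by have := hv' x h; omega
    rcases p with _ | p
    · rw [subst_zero, selCoeff_zero, Finset.sum_singleton, one_mul]
    have hsub : ∀ {p w}, w ∈ subst x B v p → w.map (raise x B) = v ∧ w.count x = p := fun hw =>
      (mem_subst hxB hxv).1 hw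
    have hcB : ∀ {p w}, w ∈ subst x B v p →
        (excPart as w).countP (· < B) = (excPart as v).countP (· < B) + p := by
      intro p w hw
      obtain ⟨h1, h2⟩ := hsub hw
      have hl : w.length = as.length := by rw [← hlen', ← h1, List.length_map]
      rw [← h1, excPart_map_raise hxB ha', ← countP_map_raise_add_count hxB (excPart as w),
        count_excPart ha' hl, h2]
    rw [subst]
    split_ifs with hb
    · subst hb
      have h1 : ∀ w ∈ subst x b v (p + 1), excWeight q t b k (a :: as) (b :: w) =
          t * q ^ (k + (excPart as v).countP (· < b) + (p + 1)) * excWeight q t b (k + 1) as w := by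
        intro w hw
        rw [excWeight, if_pos (by omega), countLe, if_neg (lt_irrefl _), hcB hw, add_assoc]
      have h2 : ∀ w ∈ subst x b v p, excWeight q t b k (a :: as) (x :: w) =
          t * q ^ (k + (excPart as v).countP (· < b) + p) * excWeight q t b (k + 1) as w := by
        intro w hw
        have e : (excPart as w).countP (· ≤ x) = (excPart as w).countP (· < b) := by
          refine List.countP_congr fun c hc => ?_
          have h3 : raise x b c ∈ v := by
            rw [← (hsub hw).1]; exact List.mem_map_of_mem (mem_of_mem_excPart hc)
          have h4 := hv' _ h3
          unfold raise at h4
          split_ifs at h4 with h5 <;> simp <;> omega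
        rw [excWeight, if_pos ha0, countLe, if_pos hxB, e, hcB hw, add_assoc]
      rw [Finset.sum_union (disjoint_consF (by omega) _ _), sum_consF, sum_consF,
        Finset.sum_congr rfl h1, Finset.sum_congr rfl h2, ← Finset.mul_sum, ← Finset.mul_sum,
        ih ha' hv' hlen', ih ha' hv' hlen', List.count_cons_self, selCoeff_succ_left, excWeight,
        if_pos (by omega), countLe, if_neg (lt_irrefl _)]
      ring
    · have hb' : b < x := by have := hv b (by simp); omega
      have h1 : ∀ w ∈ subst x B v (p + 1), excWeight q t B k (a :: as) (b :: w) =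
          (if a < b then t * q ^ (k + countLe B b (excPart as v)) else 1) *
            excWeight q t B (k + 1) as w := by
        intro w hw
        have e : (excPart as v).countP (· ≤ b) = (excPart as w).countP (· ≤ b) := by
          rw [← (hsub hw).1, excPart_map_raise hxB ha', List.countP_map]
          refine List.countP_congr fun c _ => ?_
          simp only [Function.comp, raise]
          split_ifs <;> simp <;> omega
        have hbB : b < B := by omega
        have e' : countLe B b (excPart as w) = countLe B b (excPart as v) := by
          rw [countLe, countLe, if_pos hbB, if_pos hbB, e]
        rw [excWeight, e']
      rw [sum_consF, Finset.sum_congr rfl h1, ← Finset.mul_sum, ih ha' hv' hlen',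
        List.count_cons_of_ne hb, excWeight]
      ring

/-- The words with content `s` and `H` letters `B`, all among the first `N` positions. -/
def denPerms (N B : ℕ) (s : Multiset ℕ) (H : ℕ) : Finset (List ℕ) :=
  (perms (s + Multiset.replicate H B)).filter fun w => B ∉ w.drop N

theorem mem_denPerms {N B : ℕ} {s : Multiset ℕ} {H : ℕ} {w : List ℕ} :
    w ∈ denPerms N B s H ↔ (w : Multiset ℕ) = s + Multiset.replicate H B ∧ B ∉ w.drop N := by
  rw [denPerms, Finset.mem_filter, mem_perms]

/-- The `den` side. -/
def denGF (q t : A) (z : ℕ → A) (B : ℕ) (a : List ℕ) (s : Multiset ℕ) (H : ℕ) : A :=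
  ∑ w ∈ denPerms a.length B s H, denWeight q t z B a w

theorem length_eq_of_coe_eq {w : List ℕ} {s : Multiset ℕ} {H B : ℕ}
    (h : (w : Multiset ℕ) = s + Multiset.replicate H B) : w.length = Multiset.card s + H := by
  simpa using congrArg Multiset.card h

theorem exists_split {w : List ℕ} {N : ℕ} (h : N < w.length) :
    ∃ w₁ b w₃, w = w₁ ++ b :: w₃ ∧ w₁.length = N := by
  refine ⟨w.take N, w[N], w.drop (N + 1), ?_, ?_⟩
  · rw [← List.drop_eq_getElem_cons h, List.take_append_drop]
  · rw [List.length_take]; omega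

theorem denWeight_snoc (q t : A) (z : ℕ → A) {B x : ℕ} {a w₁ : List ℕ}
    (h : w₁.length = a.length) {b : ℕ} (hb : b ≤ x) (w₃ : List ℕ) :
    denWeight q t z B (a ++ [x]) (w₁ ++ b :: w₃) = denWeight q t z B a (w₁ ++ b :: w₃) := by
  have h' : (w₁ ++ [b]).length = (a ++ [x]).length := by simp [h]
  have e : w₁ ++ b :: w₃ = (w₁ ++ [b]) ++ w₃ := by simp
  unfold denWeight
  rw [excWeight_append q t B 1 h, nexPart_append h, e, excWeight_append q t B 1 h',
    nexPart_append h', excWeight_snoc q t B 1 h (Or.inl hb), nexPart_snoc h,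
    if_neg (by omega), if_neg (by omega)]
  simp

theorem denWeight_snoc_top (q t : A) (z : ℕ → A) {B x : ℕ} (hxB : x < B) {a w₁ : List ℕ}
    (h : w₁.length = a.length) (w₃ : List ℕ) :
    denWeight q t z B (a ++ [x]) (w₁ ++ B :: w₃) =
      t * q ^ (a.length + 1) * denWeight q t z B a (w₁ ++ w₃) := by
  have h' : (w₁ ++ [B]).length = (a ++ [x]).length := by simp [h]
  have e : w₁ ++ B :: w₃ = (w₁ ++ [B]) ++ w₃ := by simp
  unfold denWeight
  rw [excWeight_append q t B 1 h, nexPart_append h, e, excWeight_append q t B 1 h',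
    nexPart_append h', excWeight_snoc q t B 1 h (Or.inr rfl), nexPart_snoc h, if_pos hxB,
    if_pos hxB, List.append_nil]
  ring

/-- The position `a.length + 1` is now compared with `x`. An ordinary letter there is at most `x`,
so it is no excedance and no weight changes. A placeholder there is the last excedance; it
contributes only `t` and its position, and deleting it affects no other factor. -/
theorem denGF_snoc (q t : A) (z : ℕ → A) {B x : ℕ} (hxB : x < B) {s : Multiset ℕ}
    (hs : ∀ b ∈ s, b ≤ x) {a : List ℕ} (ha : a.length < Multiset.card s) :
    denGF q t z B (a ++ [x]) s = openStep q t a.length (denGF q t z B a s) := by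
  funext H
  have hBs : B ∉ s := fun h => by have := hs B h; omega
  have hlen : (a ++ [x]).length = a.length + 1 := by simp
  have hsplit : ∀ {w : List ℕ} {H}, (w : Multiset ℕ) = s + Multiset.replicate H B →
      ∃ w₁ b w₃, w = w₁ ++ b :: w₃ ∧ w₁.length = a.length := fun h =>
    exists_split (by rw [length_eq_of_coe_eq h]; omega)
  have h1 : (denPerms (a.length + 1) B s H).filter (fun w => B ∉ w.drop a.length) =
      denPerms a.length B s H := by
    ext w
    rw [Finset.mem_filter, mem_denPerms, mem_denPerms, and_assoc]
    refine and_congr_right fun _ => ⟨fun h => h.2, fun h => ⟨fun h' => h ?_, h⟩⟩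
    rw [← List.drop_drop] at h'
    exact List.mem_of_mem_drop h'
  have h2 : ∑ w ∈ denPerms a.length B s H, denWeight q t z B (a ++ [x]) w = denGF q t z B a s H := by
    refine Finset.sum_congr rfl fun w hw => ?_
    rw [mem_denPerms] at hw
    obtain ⟨w₁, b, w₃, rfl, hl⟩ := hsplit hw.1
    refine denWeight_snoc q t z hl ?_ w₃
    have hbB : b ≠ B := by
      rintro rfl
      apply hw.2
      rw [← hl, List.drop_left]; simp
    rcases mem_of_coe_eq_add hw.1 (b := b) (by simp) with h | h
    · exact hs b h
    · exact absurd h hbB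
  rw [denGF, hlen, ← Finset.sum_filter_add_sum_filter_not _ (fun w => B ∉ w.drop a.length), h1, h2]
  rcases H with _ | H
  · rw [openStep, Finset.sum_eq_zero, add_zero]
    intro w hw
    exfalso
    rw [Finset.mem_filter, mem_denPerms] at hw
    apply hw.2
    intro h
    have h' : B ∈ (w : Multiset ℕ) := List.mem_of_mem_drop h
    rw [hw.1.1] at h'
    simp at h'
    exact hBs h'
  · rw [openStep]
    congr 1
    rw [denGF, Finset.mul_sum]
    refine Finset.sum_nbij' (fun w => w.take a.length ++ w.drop (a.length + 1))
      (fun v => v.take a.length ++ B :: v.drop a.length) ?_ ?_ ?_ ?_ ?_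
    · intro w hw
      rw [Finset.mem_filter, mem_denPerms] at hw
      obtain ⟨⟨hw1, hw2⟩, hw3⟩ := hw
      obtain ⟨w₁, b, w₃, rfl, hl⟩ := hsplit hw1
      simp only [← hl, List.take_left, List.drop_append, Nat.add_sub_cancel_left,
        List.drop_succ_cons, List.drop_zero, List.drop_of_length_le (Nat.le_succ _),
        List.nil_append] at hw2 hw3 ⊢
      obtain rfl : B = b := by simpa [hw2] using hw3
      rw [mem_denPerms, List.drop_left]
      refine ⟨?_, hw2⟩
      rw [← Multiset.coe_add] at hw1 ⊢
      rw [← Multiset.cons_coe, Multiset.add_cons, Multiset.replicate_succ, Multiset.add_cons] at hw1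
      exact (Multiset.cons_inj_right _).1 hw1
    · intro v hv
      rw [mem_denPerms] at hv
      have hlv : a.length ≤ v.length := by rw [length_eq_of_coe_eq hv.1]; omega
      have hl : (v.take a.length).length = a.length := by rw [List.length_take]; omega
      rw [Finset.mem_filter, mem_denPerms]
      refine ⟨⟨?_, ?_⟩, ?_⟩
      · rw [← Multiset.coe_add, ← Multiset.cons_coe, Multiset.add_cons, Multiset.coe_add,
          List.take_append_drop, hv.1, Multiset.replicate_succ, Multiset.add_cons]
      · rw [List.drop_append, hl, List.drop_of_length_le (by omega), Nat.add_sub_cancel_left]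
        simpa using hv.2
      · rw [List.drop_append, hl, List.drop_of_length_le (by omega), Nat.sub_self]
        simp
    · intro w hw
      rw [Finset.mem_filter, mem_denPerms] at hw
      obtain ⟨⟨hw1, hw2⟩, hw3⟩ := hw
      obtain ⟨w₁, b, w₃, rfl, hl⟩ := hsplit hw1
      simp only [← hl, List.take_left, List.drop_append, Nat.add_sub_cancel_left,
        List.drop_succ_cons, List.drop_zero, List.drop_of_length_le (Nat.le_succ _),
        List.nil_append] at hw2 hw3 ⊢
      obtain rfl : B = b := by simpa [hw2] using hw3
      simp
    · intro v hv
      rw [mem_denPerms] at hv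
      have hlv : a.length ≤ v.length := by rw [length_eq_of_coe_eq hv.1]; omega
      have hl : (v.take a.length).length = a.length := by rw [List.length_take]; omega
      rw [List.take_append_of_le_length (by omega), List.take_of_length_le (by omega),
        List.drop_append, hl, List.drop_of_length_le (by omega), Nat.add_sub_cancel_left]
      simp
    · intro w hw
      rw [Finset.mem_filter, mem_denPerms] at hw
      obtain ⟨⟨hw1, hw2⟩, hw3⟩ := hw
      obtain ⟨w₁, b, w₃, rfl, hl⟩ := hsplit hw1
      have e1 : (w₁ ++ b :: w₃).take a.length = w₁ := by rw [← hl, List.take_left]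
      have e2 : (w₁ ++ b :: w₃).drop a.length = b :: w₃ := by rw [← hl, List.drop_left]
      have e3 : (w₁ ++ b :: w₃).drop (a.length + 1) = w₃ := by rw [← List.drop_drop, e2]; simp
      rw [e3] at hw2
      rw [e2] at hw3
      obtain rfl : B = b := by simpa [hw2] using hw3
      rw [e1, e3, denWeight_snoc_top q t z hxB hl]

/-- Replacing placeholders changes only the excedance weight, and inserting behind the first
`a.length` positions changes only the other weight. The double sum therefore factors. -/
theorem sum_subst_ins_denWeight (q t : A) (z : ℕ → A) {x B : ℕ} (hxB : x < B) {a v₁ v₃ : List ℕ}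
    (ha : ∀ y ∈ a, y < x) (hv₁ : ∀ b ∈ v₁, b < x ∨ b = B) (hv₃ : ∀ b ∈ v₃, b < x)
    (hlen : v₁.length = a.length) (p j : ℕ) :
    ∑ w₁ ∈ subst x B v₁ p, ∑ w₃ ∈ ins x v₃ j, denWeight q t z B a (w₁ ++ w₃) =
      selCoeff q (v₁.count B) p * shufCoeff q (z x) v₃.length j *
        denWeight q t z B a (v₁ ++ v₃) := by
  have hxv : x ∉ v₁ := fun h => by have := hv₁ x h; omega
  have h1 : ∀ w₁ ∈ subst x B v₁ p, ∑ w₃ ∈ ins x v₃ j, denWeight q t z B a (w₁ ++ w₃) =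
      excWeight q t B 1 a w₁ * (shufCoeff q (z x) v₃.length j *
        nexWeight q z (nexPart a v₁ ++ v₃)) := by
    intro w₁ hw₁
    obtain ⟨rfl, -⟩ := (mem_subst hxB hxv).1 hw₁
    rw [List.length_map] at hlen
    rw [nexPart_map_raise hxB ha hlen,
      ← sum_ins_nexWeight_append q z hv₃ (fun b hb => nexPart_lt ha hlen hb), Finset.mul_sum]
    refine Finset.sum_congr rfl fun w₃ _ => ?_
    rw [denWeight, excWeight_append q t B 1 hlen, nexPart_append hlen]
  rw [Finset.sum_congr rfl h1, ← Finset.sum_mul, sum_subst_excWeight q t hxB ha hv₁ hlen,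
    denWeight, excWeight_append q t B 1 hlen, nexPart_append hlen]
  ring

/-- The words obtained from `v` by turning `p` letters `B` among the first `N` letters into `x`
and by inserting `j` letters `x` behind them. -/
def denFiber (x B N p j : ℕ) (v : List ℕ) : Finset (List ℕ) :=
  (subst x B (v.take N) p ×ˢ ins x (v.drop N) j).image fun u => u.1 ++ u.2

theorem length_of_mem_subst {x B : ℕ} {v w : List ℕ} {p : ℕ} (h : w ∈ subst x B v p) :
    w.length = v.length := by
  simpa using congrArg Multiset.card (coe_subst h)

theorem mem_denFiber {x B N p j : ℕ} (hxB : x < B) {v : List ℕ} (hx : x ∉ v) (hN : N ≤ v.length)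
    {w : List ℕ} : w ∈ denFiber x B N p j v ↔ (N ≤ w.length ∧ (w.take N).count x = p ∧
      (w.drop N).count x = j) ∧ (w.take N).map (raise x B) ++ (w.drop N).filter (· ≠ x) = v := by
  have hx₁ : x ∉ v.take N := fun h => hx (List.mem_of_mem_take h)
  have hx₃ : x ∉ v.drop N := fun h => hx (List.mem_of_mem_drop h)
  simp only [denFiber, Finset.mem_image, Finset.mem_product, Prod.exists]
  constructor
  · rintro ⟨w₁, w₃, ⟨h1, h3⟩, rfl⟩
    have hl := length_of_mem_subst h1
    rw [List.length_take, min_eq_left hN] at hl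
    rw [mem_subst hxB hx₁] at h1
    rw [mem_ins hx₃] at h3
    rw [List.take_left' hl, List.drop_left' hl, h1.1, h1.2, h3.1, h3.2, List.take_append_drop]
    exact ⟨⟨by simp [hl], rfl, rfl⟩, rfl⟩
  · rintro ⟨⟨h0, h1, h2⟩, h3⟩
    have hl : ((w.take N).map (raise x B)).length = N := by simpa using h0
    refine ⟨w.take N, w.drop N, ⟨?_, ?_⟩, List.take_append_drop ..⟩
    · rw [mem_subst hxB hx₁, ← h3, List.take_left' hl]
      exact ⟨rfl, h1⟩
    · rw [mem_ins hx₃, ← h3, List.drop_left' hl]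
      exact ⟨rfl, h2⟩

theorem coe_denFiber {x B N p j : ℕ} {v w : List ℕ} (h : w ∈ denFiber x B N p j v) :
    (w : Multiset ℕ) + Multiset.replicate p B = v + Multiset.replicate (p + j) x := by
  simp only [denFiber, Finset.mem_image, Finset.mem_product, Prod.exists] at h
  obtain ⟨w₁, w₃, ⟨h1, h3⟩, rfl⟩ := h
  rw [← Multiset.coe_add, coe_ins h3, add_right_comm, ← add_assoc, add_right_comm, coe_subst h1,
    Multiset.replicate_add]
  conv_rhs => rw [← List.take_append_drop N v, ← Multiset.coe_add]
  abel

theorem sum_denFiber {M : Type*} [AddCommMonoid M] {x B N p j : ℕ} {v : List ℕ}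
    (f : List ℕ → M) :
    ∑ w ∈ denFiber x B N p j v, f w =
      ∑ w₁ ∈ subst x B (v.take N) p, ∑ w₃ ∈ ins x (v.drop N) j, f (w₁ ++ w₃) := by
  rw [denFiber, Finset.sum_image, Finset.sum_product]
  rintro ⟨w₁, w₃⟩ h ⟨w₁', w₃'⟩ h' he
  have h1 := length_of_mem_subst (Finset.mem_product.1 h).1
  have h2 := length_of_mem_subst (Finset.mem_product.1 h').1
  obtain ⟨rfl, rfl⟩ := List.append_inj he (h1.trans h2.symm)
  rfl

/-- All letters of `a` are below `x`, so an `x` in the first `a.length` positions is an excedance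
and comes from a placeholder, while any other `x` is an insertion into the tail. With `p` of the
first kind, the tail before insertion has length `o + p`, because the word has `a.length + o + p`
letters. -/
theorem denGF_fill (q t : A) (z : ℕ → A) {B x : ℕ} (hxB : x < B) {s : Multiset ℕ}
    (hs : ∀ b ∈ s, b < x) {a : List ℕ} (ha : ∀ y ∈ a, y < x) (hl : a.length = Multiset.card s)
    (c : ℕ) : denGF q t z B a (s + Multiset.replicate c x) = fillSum q (z x) (denGF q t z B a s) c := by
  funext o
  have hmap : ∀ w ∈ denPerms a.length B (s + Multiset.replicate c x) o,
      (w.take a.length).count x ∈ Finset.range (c + 1) := by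
    intro w hw
    rw [mem_denPerms] at hw
    have h1 := (List.take_sublist a.length w).count_le x
    rw [(count_eq_of_coe_eq hxB hs hw.1).1] at h1
    rw [Finset.mem_range]; omega
  rw [denGF, ← Finset.sum_fiberwise_of_maps_to hmap, fillSum]
  refine Finset.sum_congr rfl fun p hp => ?_
  have hp' : p ≤ c := by have := Finset.mem_range.1 hp; omega
  have hpc : p + (c - p) = c := by omega
  have hsplit : s + Multiset.replicate c x + Multiset.replicate o B + Multiset.replicate p B =
      s + Multiset.replicate (o + p) B + Multiset.replicate c x := by
    rw [Multiset.replicate_add]; abel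
  have hfib : ∀ w ∈ (denPerms a.length B (s + Multiset.replicate c x) o).filter
      (fun w => (w.take a.length).count x = p),
      w ∈ denFiber x B a.length p (c - p)
        ((w.take a.length).map (raise x B) ++ (w.drop a.length).filter (· ≠ x)) := by
    intro w hw
    rw [Finset.mem_filter, mem_denPerms] at hw
    obtain ⟨⟨h1, h2⟩, h3⟩ := hw
    have hlw := length_eq_of_coe_eq h1
    rw [Multiset.card_add] at hlw
    rw [mem_denFiber hxB]
    · refine ⟨⟨by omega, h3, ?_⟩, rfl⟩
      have := (count_eq_of_coe_eq hxB hs h1).1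
      rw [← List.take_append_drop a.length w, List.count_append, h3] at this
      omega
    · simp only [List.mem_append, List.mem_map, List.mem_filter, not_or]
      refine ⟨?_, by simp⟩
      rintro ⟨b, -, hb⟩
      unfold raise at hb
      split_ifs at hb <;> omega
    · rw [List.length_append, List.length_map, List.length_take]; omega
  rw [sum_eq_sum_fibers (T := denPerms a.length B s (o + p))
    (fun w => (w.take a.length).map (raise x B) ++ (w.drop a.length).filter (· ≠ x))
    (denFiber x B a.length p (c - p))]
  · rw [denGF, Finset.mul_sum]
    refine Finset.sum_congr rfl fun v hv => ?_
    rw [mem_denPerms] at hv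
    have hlv := length_eq_of_coe_eq hv.1
    have hN : a.length ≤ v.length := by omega
    have hvB : ∀ b ∈ v, b < x ∨ b = B := fun b hb => (mem_of_coe_eq_add hv.1 hb).imp_left (hs b)
    rw [sum_denFiber, sum_subst_ins_denWeight q t z hxB ha, List.take_append_drop]
    · have h1 : (v.take a.length).count B = o + p := by
        have h2 := count_eq_of_coe_eq hxB hs (p := 0) (o := o + p) (w := v) (by simpa using hv.1)
        rw [← h2.2.1]
        conv_rhs => rw [← List.take_append_drop a.length v, List.count_append,
          List.count_eq_zero.2 hv.2, add_zero]
      have h2 : (v.drop a.length).length = o + p := by rw [List.length_drop]; omega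
      rw [h1, h2]
    · exact fun b hb => hvB b (List.mem_of_mem_take hb)
    · exact fun b hb => (hvB b (List.mem_of_mem_drop hb)).resolve_right
        (by rintro rfl; exact hv.2 hb)
    · rw [List.length_take]; omega
  · intro w hw
    have h := coe_denFiber (hfib w hw)
    rw [Finset.mem_filter, mem_denPerms] at hw
    obtain ⟨⟨h1, h2⟩, h3⟩ := hw
    have hlw := length_eq_of_coe_eq h1
    rw [Multiset.card_add] at hlw
    rw [mem_denPerms]
    rw [h1, hsplit, hpc] at h
    refine ⟨(add_right_cancel h).symm, ?_⟩
    rw [List.drop_left' (by rw [List.length_map, List.length_take]; omega)]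
    exact fun h => h2 (List.mem_of_mem_filter h)
  · intro v hv w
    rw [mem_denPerms] at hv
    have hlv := length_eq_of_coe_eq hv.1
    have hxv : x ∉ v := fun h => by
      rcases mem_of_coe_eq_add hv.1 h with h | h
      · exact lt_irrefl _ (hs x h)
      · omega
    constructor
    · intro h
      have h1 := coe_denFiber h
      rw [hv.1, hpc, ← hsplit] at h1
      obtain ⟨⟨h2, h3, h4⟩, h5⟩ := (mem_denFiber hxB hxv (by omega)).1 h
      rw [Finset.mem_filter, mem_denPerms]
      refine ⟨⟨⟨add_right_cancel h1, ?_⟩, h3⟩, h5⟩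
      intro h6
      apply hv.2
      rw [← h5, List.drop_left' (by rw [List.length_map, List.length_take]; omega)]
      exact List.mem_filter.2 ⟨h6, by simpa using hxB.ne'⟩
    · rintro ⟨h, rfl⟩
      exact hfib w h

theorem denGF_eq_transfer (q t : A) (z : ℕ → A) {B x : ℕ} (hxB : x < B) {s : Multiset ℕ}
    (hs : ∀ b ∈ s, b < x) {a : List ℕ} (ha : ∀ y ∈ a, y < x) (hl : a.length = Multiset.card s)
    (c : ℕ) : denGF q t z B (a ++ List.replicate c x) (s + Multiset.replicate c x) =
      transfer q t (z x) (Multiset.card s) c (denGF q t z B a s) := by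
  have hs' : ∀ b ∈ s + Multiset.replicate c x, b ≤ x := by
    intro b hb
    rcases Multiset.mem_add.1 hb with h | h
    · exact (hs b h).le
    · exact (Multiset.eq_of_mem_replicate h).le
  -- The content receives all `c` copies of `x` at once, and only then is `a` extended one letter at
  -- a time; this secures `a.length < card` at every step.
  have key : ∀ j ≤ c, denGF q t z B (a ++ List.replicate j x) (s + Multiset.replicate c x) =
      openSteps q t (Multiset.card s) (fillSum q (z x) (denGF q t z B a s) c) j := by
    intro j
    induction j with
    | zero => intro _; simpa [openSteps] using denGF_fill q t z hxB hs ha hl c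
    | succ j ih =>
      intro hj
      rw [List.replicate_succ', ← List.append_assoc, denGF_snoc q t z hxB hs', ih (by omega),
        openSteps]
      · simp [hl]
      · simp [hl]; omega
  exact key c le_rfl

end Den

/-! ### Induction over the letters -/

section Levels

variable {A : Type*} [CommRing A]

theorem sort_add_replicate {s : Multiset ℕ} {x : ℕ} (hs : ∀ b ∈ s, b < x) (c : ℕ) :
    (s + Multiset.replicate c x).sort (· ≤ ·) = s.sort (· ≤ ·) ++ List.replicate c x := by
  refine List.Perm.eq_of_pairwise' (r := (· ≤ ·)) (Multiset.pairwise_sort _ _) ?_ ?_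
  · rw [List.pairwise_append]
    refine ⟨Multiset.pairwise_sort _ _, ?_, ?_⟩
    · rw [List.pairwise_replicate]; right; exact le_rfl
    · intro a ha b hb
      rw [List.eq_of_mem_replicate hb]
      exact (hs a (by simpa using ha)).le
  · rw [← Multiset.coe_eq_coe, Multiset.sort_eq, ← Multiset.coe_add, Multiset.sort_eq,
      Multiset.coe_replicate]

theorem goodPerms_zero_zero {B : ℕ} (hB : 0 < B) (H : ℕ) :
    goodPerms 0 0 B 0 H = if H = 0 then {[]} else ∅ := by
  ext w
  rw [mem_goodPerms, zero_add]
  rcases w with _ | ⟨b, w⟩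
  · rcases H with _ | H
    · simp [Good]
    · simp [Multiset.replicate_succ]
  · rcases H with _ | H
    · simp
    · simp only [Good, Nat.succ_ne_zero, if_false, Finset.notMem_empty, iff_false]
      rintro ⟨h1, h2, -⟩
      have : b ∈ Multiset.replicate (H + 1) B := by rw [← h1]; simp
      rw [Multiset.eq_of_mem_replicate this] at h2
      exact absurd (h2 hB) (by omega)

theorem denPerms_zero {B : ℕ} (H : ℕ) :
    denPerms 0 B 0 H = if H = 0 then {[]} else ∅ := by
  ext w
  rw [mem_denPerms, zero_add]
  rcases w with _ | ⟨b, w⟩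
  · rcases H with _ | H
    · simp
    · simp [Multiset.replicate_succ]
  · rcases H with _ | H
    · simp
    · simp only [Nat.succ_ne_zero, if_false, Finset.notMem_empty, iff_false]
      rintro ⟨h1, h2⟩
      have : b ∈ Multiset.replicate (H + 1) B := by rw [← h1]; simp
      rw [Multiset.eq_of_mem_replicate this] at h2
      simp at h2

theorem eq_filter_add_replicate {s : Multiset ℕ} {x : ℕ} (hs : ∀ b ∈ s, b < x + 1) :
    s = s.filter (· < x) + Multiset.replicate (s.count x) x := by
  rw [← Multiset.filter_eq']
  have h : s.filter (fun b => ¬ b < x) = s.filter (· = x) :=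
    Multiset.filter_congr fun b hb => by have := hs b hb; omega
  rw [← h, Multiset.filter_add_not]

/-- The induction runs over the bound `x`, and the multiplicity of a letter may be zero. The
recurrence must be carried along, because the `maj` step needs it for the previous content. -/
theorem gf_eq_and_shiftRec [IsDomain A] {q t : A} {z : ℕ → A} {τ : A →+* A} (hq : τ q = q)
    (ht : τ t = q * t) (hz : ∀ x, τ (z x) = z x) (hq1 : ∀ k, 1 - q ^ (k + 1) ≠ 0) {B x : ℕ}
    (hxB : x < B) {s : Multiset ℕ} (hs : ∀ b ∈ s, b < x) :
    makGF q t z x B s = denGF q t z B (s.sort (· ≤ ·)) s ∧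
      ShiftRec q t τ (Multiset.card s) (makGF q t z x B s) ∧
      majGF q t z s = makGF q t z x B s 0 := by
  induction x generalizing s with
  | zero =>
    obtain rfl : s = 0 := Multiset.eq_zero_of_forall_notMem fun b hb => by
      have := hs b hb; omega
    -- The empty content has no room for placeholders. The recurrence at `H = 0` then reads `0 = q -
    -- (q * t + q * (1 - t))`.
    have h1 : makGF q t z 0 B 0 = fun H => if H = 0 then 1 else 0 := by
      funext H
      rw [makGF, goodPerms_zero_zero hxB]
      split_ifs <;> simp [makWeight]
    refine ⟨?_, ?_, ?_⟩
    · rw [h1]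
      funext H
      rw [denGF]
      simp only [Multiset.sort_zero, List.length_nil, denPerms_zero]
      split_ifs <;> simp [denWeight, excWeight, nexWeight, nexPart]
    · rw [h1]
      intro H
      rcases H with _ | H
      · simp [shiftOp]; ring
      · simp [shiftOp]
    · rw [h1, majGF]
      have : perms 0 = {[]} := by ext w; simp [mem_perms]
      simp [this, majWeight, rlWeight]
  | succ x ih =>
    obtain ⟨u, c, hu, rfl⟩ : ∃ u c, (∀ b ∈ u, b < x) ∧ s = u + Multiset.replicate c x :=
      ⟨_, _, fun b hb => (Multiset.mem_filter.1 hb).2, eq_filter_add_replicate hs⟩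
    obtain ⟨h1, h2, h3⟩ := ih (by omega) hu
    rw [makGF_eq_transfer q t z hxB hu]
    refine ⟨?_, ?_, ?_⟩
    · rw [sort_add_replicate hu, denGF_eq_transfer q t z (by omega) hu, h1]
      · intro y hy; exact hu y (by simpa using hy)
      · simp
    · rw [Multiset.card_add, Multiset.card_replicate]
      exact h2.transfer hq ht (hz x) hq1 c
    · exact majGF_eq_transfer hq ht hz hq1 hu h2 h3 c

theorem good_of_forall_le {x m : ℕ} {w : List ℕ} (h : ∀ b ∈ w, b ≤ x) : Good x m w := by
  induction w with
  | nil => trivial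
  | cons b w ih =>
    exact ⟨fun hb => absurd (h b (by simp)) (by omega), ih fun a ha => h a (by simp [ha])⟩

/-- The equidistribution in terms of the recursively defined weights. -/
theorem sum_weights_eq [IsDomain A] {q t : A} {z : ℕ → A} {τ : A →+* A} (hq : τ q = q)
    (ht : τ t = q * t) (hz : ∀ x, τ (z x) = z x) (hq1 : ∀ k, 1 - q ^ (k + 1) ≠ 0) {B : ℕ}
    {s : Multiset ℕ} (hs : ∀ b ∈ s, b + 1 < B) :
    ∑ w ∈ perms s, majWeight q t w.reverse * rlWeight z w =
        ∑ w ∈ perms s, denWeight q t z B (s.sort (· ≤ ·)) w ∧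
      ∑ w ∈ perms s, denWeight q t z B (s.sort (· ≤ ·)) w =
        ∑ w ∈ perms s, makWeight q t z B w := by
  rcases B with _ | x
  · obtain rfl : s = 0 := Multiset.eq_zero_of_forall_notMem fun b hb => by
      have := hs b hb; omega
    have : perms 0 = {[]} := by ext w; simp [mem_perms]
    simp [this, majWeight, rlWeight, makWeight, denWeight, excWeight, nexWeight, nexPart]
  have hs' : ∀ b ∈ s, b < x := fun b hb => by have := hs b hb; omega
  obtain ⟨h1, -, h3⟩ := gf_eq_and_shiftRec hq ht hz hq1 (Nat.lt_succ_self x) hs'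
  have e1 : makGF q t z x (x + 1) s 0 = ∑ w ∈ perms s, makWeight q t z (x + 1) w := by
    refine Finset.sum_congr ?_ fun _ _ => rfl
    ext w
    rw [mem_goodPerms, mem_perms, Multiset.replicate_zero, add_zero, and_iff_left_iff_imp]
    rintro rfl
    exact good_of_forall_le fun b hb => (hs' b hb).le
  have e2 : denGF q t z (x + 1) (s.sort (· ≤ ·)) s 0 =
      ∑ w ∈ perms s, denWeight q t z (x + 1) (s.sort (· ≤ ·)) w := by
    refine Finset.sum_congr ?_ fun _ _ => rfl
    ext w
    rw [mem_denPerms, mem_perms, Multiset.replicate_zero, add_zero, and_iff_left_iff_imp]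
    rintro rfl h
    have := hs' _ (List.mem_of_mem_drop h)
    omega
  have e3 : majGF q t z s = ∑ w ∈ perms s, majWeight q t w.reverse * rlWeight z w := by
    rw [majGF, ← sum_perms_reverse s fun w => majWeight q t w * rlWeight z w.reverse]
    simp
  rw [← e1, ← e2, ← e3, h3, ← h1]
  exact ⟨rfl, rfl⟩

end Levels

/-! ### The recursive weights compute right-to-left minima, `maj` and `mak` -/

section Translation

@[simp] theorem letter_cons_one (b : ℕ) (l : List ℕ) : letter (b :: l) 1 = b := by simp [letter]

@[simp] theorem letter_cons_add_two (b : ℕ) (l : List ℕ) (i : ℕ) :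
    letter (b :: l) (i + 2) = letter l (i + 1) := by simp [letter]

theorem letter_cons_succ (b : ℕ) (l : List ℕ) {i : ℕ} (hi : 1 ≤ i) :
    letter (b :: l) (i + 1) = letter l i := by
  obtain ⟨i, rfl⟩ : ∃ k, i = k + 1 := ⟨i - 1, by omega⟩
  simp

theorem mem_positions {w : List ℕ} {i : ℕ} : i ∈ positions w ↔ 1 ≤ i ∧ i ≤ w.length := by
  simp [positions]

theorem sum_positions_cons {M : Type*} [AddCommMonoid M] (b : ℕ) (l : List ℕ) (f : ℕ → M) :
    ∑ i ∈ positions (b :: l), f i = f 1 + ∑ i ∈ positions l, f (i + 1) := by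
  have h : ∀ n, Finset.Icc 1 n = Finset.Ico 1 (n + 1) := fun n => by ext; simp
  unfold positions
  rw [h, h, Finset.sum_Ico_eq_sum_range, Finset.sum_Ico_eq_sum_range, List.length_cons]
  simp only [Nat.add_sub_cancel]
  rw [Finset.sum_range_succ', add_comm]
  refine congrArg₂ _ rfl (Finset.sum_congr rfl fun i _ => ?_)
  rw [add_comm 1 (i + 1), add_comm 1 i]

theorem forall_positions_cons (b : ℕ) (l : List ℕ) (Q : ℕ → Prop) :
    (∀ i ∈ positions (b :: l), Q i) ↔ Q 1 ∧ ∀ i ∈ positions l, Q (i + 1) := by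
  simp only [mem_positions, List.length_cons]
  constructor
  · intro h
    exact ⟨h 1 (by omega), fun i hi => h (i + 1) (by omega)⟩
  · rintro ⟨h1, h2⟩ i hi
    rcases Nat.lt_or_ge 1 i with h | h
    · have := h2 (i - 1) (by omega)
      rwa [Nat.sub_add_cancel (by omega)] at this
    · rwa [show i = 1 by omega]

theorem forall_positions_letter (l : List ℕ) (P : ℕ → Prop) :
    (∀ i ∈ positions l, P (letter l i)) ↔ ∀ y ∈ l, P y := by
  induction l with
  | nil => simp [positions]
  | cons b l ih =>
    rw [forall_positions_cons, List.forall_mem_cons, letter_cons_one, ← ih]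
    refine and_congr_right fun _ => forall₂_congr fun i hi => ?_
    rw [letter_cons_succ _ _ (mem_positions.1 hi).1]

theorem map_val_filter {M : Type*} (s : Finset ℕ) (p : ℕ → Prop) [DecidablePred p] (f : ℕ → M) :
    (s.filter p).val.map f = ∑ i ∈ s, if p i then {f i} else 0 := by
  rw [← Finset.sum_filter]
  induction s.filter p using Finset.induction_on with
  | empty => simp
  | insert a u ha ih => rw [Finset.sum_insert ha, ← ih, Finset.insert_val_of_notMem ha]; simp

theorem Rlwmin_cons (b : ℕ) (l : List ℕ) :
    Rlwmin (b :: l) = (if ∀ y ∈ l, b ≤ y then {b} else 0) + Rlwmin l := by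
  rw [Rlwmin, Rlwmin, map_val_filter, map_val_filter, sum_positions_cons]
  congr 1
  · refine if_congr ?_ (by rw [letter_cons_one]) rfl
    rw [forall_positions_cons, letter_cons_one, ← forall_positions_letter l (b ≤ ·)]
    simp only [lt_irrefl, false_imp_iff, true_and]
    refine forall₂_congr fun i hi => ?_
    have := (mem_positions.1 hi).1
    rw [letter_cons_succ _ _ this]
    exact ⟨fun h => h (by omega), fun h _ => h⟩
  · refine Finset.sum_congr rfl fun i hi => ?_
    have h1 := (mem_positions.1 hi).1
    refine if_congr ?_ (by rw [letter_cons_succ _ _ h1]) rfl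
    rw [forall_positions_cons, letter_cons_succ _ _ h1]
    simp only [Nat.add_lt_add_iff_right]
    constructor
    · intro h j hj hij
      have := h.2 j hj hij
      rwa [letter_cons_succ _ _ (mem_positions.1 hj).1] at this
    · intro h
      refine ⟨by omega, fun j hj hij => ?_⟩
      rw [letter_cons_succ _ _ (mem_positions.1 hj).1]
      exact h j hj hij

theorem rlWeight_eq {A : Type*} [CommRing A] (z : ℕ → A) (w : List ℕ) :
    rlWeight z w = ((Rlwmin w).map z).prod := by
  induction w with
  | nil => simp [rlWeight, Rlwmin, positions]
  | cons b l ih =>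
    rw [Rlwmin_cons, rlWeight, ih, Multiset.map_add, Multiset.prod_add]
    congr 1
    split_ifs <;> simp

theorem mem_Des {w : List ℕ} {i : ℕ} :
    i ∈ Des w ↔ (1 ≤ i ∧ i < w.length) ∧ letter w (i + 1) < letter w i := by
  simp [Des]

theorem one_mem_Des_cons {b : ℕ} {l : List ℕ} : 1 ∈ Des (b :: l) ↔ l.headD b < b := by
  cases l <;> simp [mem_Des]

theorem succ_mem_Des_cons {b : ℕ} {l : List ℕ} {i : ℕ} (hi : 1 ≤ i) :
    i + 1 ∈ Des (b :: l) ↔ i ∈ Des l := by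
  rw [mem_Des, mem_Des, letter_cons_succ _ _ hi, letter_cons_succ _ _ (by omega)]
  simp; omega

theorem sum_Des_cons {M : Type*} [AddCommMonoid M] (b : ℕ) (l : List ℕ) (f : ℕ → M) :
    ∑ i ∈ Des (b :: l), f i = (if l.headD b < b then f 1 else 0) + ∑ i ∈ Des l, f (i + 1) := by
  have h : ∀ w : List ℕ, Des w = (positions w).filter (· ∈ Des w) := by
    intro w
    ext i
    simp only [Finset.mem_filter, mem_Des, mem_positions]; omega
  rw [h, h l, Finset.sum_filter, Finset.sum_filter, sum_positions_cons]
  congr 1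
  · exact if_congr one_mem_Des_cons rfl rfl
  · refine Finset.sum_congr rfl fun i hi => ?_
    exact if_congr (succ_mem_Des_cons (mem_positions.1 hi).1) rfl rfl

theorem des_cons (b : ℕ) (l : List ℕ) : des (b :: l) = des l + if l.headD b < b then 1 else 0 := by
  rw [des, des, Finset.card_eq_sum_ones, sum_Des_cons, Finset.card_eq_sum_ones, add_comm]

theorem letter_append_left (u : List ℕ) (b : ℕ) {i : ℕ} (h1 : 1 ≤ i) (h2 : i ≤ u.length) :
    letter (u ++ [b]) i = letter u i := by
  unfold letter
  rw [List.getD_append _ _ _ _ (by omega)]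

theorem letter_append_right (u : List ℕ) (b : ℕ) : letter (u ++ [b]) (u.length + 1) = b := by
  unfold letter
  rw [Nat.add_sub_cancel, List.getD_append_right _ _ _ _ le_rfl]
  simp

/-- Prepending to the stored list appends to the actual word, so the only possible new descent is at
position `l.length`. -/
theorem majWeight_eq {A : Type*} [CommRing A] (q t : A) (l : List ℕ) :
    majWeight q t l = t ^ des l.reverse * q ^ maj l.reverse := by
  induction l with
  | nil => simp [majWeight, des, maj, Des]
  | cons b l ih =>
    have h0 : l.reverse.length ∉ Des l.reverse := by simp [mem_Des]
    have key : Des (b :: l).reverse =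
        if b < l.headD b then insert l.length (Des l.reverse) else Des l.reverse := by
      ext i
      rw [List.reverse_cons, mem_Des]
      have hl : (l.reverse ++ [b]).length = l.length + 1 := by simp
      have hlast : 1 ≤ l.length → letter (l.reverse ++ [b]) l.length = l.headD b := by
        intro h
        rw [letter_append_left _ _ h (by simp)]
        cases l with
        | nil => simp at h
        | cons c l =>
          rw [List.reverse_cons, List.headD_cons]
          have := letter_append_right l.reverse c
          simpa using this
      have hend : letter (l.reverse ++ [b]) (l.length + 1) = b := by
        have := letter_append_right l.reverse b
        simpa using this
      have hsub : i < l.length → 1 ≤ i → (letter (l.reverse ++ [b]) (i + 1) <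
          letter (l.reverse ++ [b]) i ↔ letter l.reverse (i + 1) < letter l.reverse i) := by
        intro h h1
        rw [letter_append_left _ _ h1 (by simp; omega),
          letter_append_left _ _ (by omega) (by simp; omega)]
      have hmem : i ∈ (if b < l.headD b then insert l.length (Des l.reverse) else Des l.reverse) ↔
          (b < l.headD b ∧ i = l.length) ∨ i ∈ Des l.reverse := by
        split_ifs with h <;> simp only [Finset.mem_insert, h, true_and, false_and, false_or]
      rw [hmem, hl, mem_Des, List.length_reverse]
      constructor
      · rintro ⟨⟨h1, h2⟩, h3⟩
        rcases Nat.lt_or_ge i l.length with h | h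
        · right; exact ⟨⟨h1, h⟩, (hsub h h1).1 h3⟩
        · left
          obtain rfl : i = l.length := by omega
          rw [hend, hlast h1] at h3
          exact ⟨h3, rfl⟩
      · rintro (⟨h1, rfl⟩ | ⟨⟨h1, h2⟩, h3⟩)
        · have : 1 ≤ l.length := by
            cases l with
            | nil => simp at h1
            | cons c l => simp
          rw [hend, hlast this]
          exact ⟨⟨this, by omega⟩, h1⟩
        · exact ⟨⟨h1, by omega⟩, (hsub h2 h1).2 h3⟩
    rw [List.length_reverse] at h0
    rw [majWeight, ih, des, des, maj, maj, key]
    split_ifs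
    · rw [Finset.card_insert_of_notMem h0, Finset.sum_insert h0]; ring
    · ring

theorem descTop_eq_card (b : ℕ) (l : List ℕ) :
    descTop b l = ∑ j ∈ Des l, if b ≤ letter l j then 1 else 0 := by
  induction l with
  | nil => simp [descTop, Des]
  | cons c l ih =>
    rw [descTop, sum_Des_cons, ih, add_comm, letter_cons_one]
    congr 1
    · rw [ite_and]
    · refine Finset.sum_congr rfl fun j hj => ?_
      rw [letter_cons_succ _ _ (mem_Des.1 hj).1.1]

theorem strictAnti_of_Des {w : List ℕ} {p q : ℕ} (h : ∀ i ∈ Finset.Ico p q, i ∈ Des w) {i j : ℕ}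
    (hi : p ≤ i) (hij : i < j) (hj : j ≤ q) : letter w j < letter w i := by
  induction j with
  | zero => omega
  | succ j ih =>
    have h1 := (mem_Des.1 (h j (by simp; omega))).2
    rcases Nat.lt_or_ge i j with h2 | h2
    · exact h1.trans (ih h2 (by omega))
    · rwa [show i = j by omega]

theorem mem_properBlocks {w : List ℕ} {p q : ℕ} : (p, q) ∈ properBlocks w ↔
    (p ∈ positions w ∧ q ∈ positions w) ∧ p < q ∧ (∀ i ∈ Finset.Ico p q, i ∈ Des w) ∧
      p - 1 ∉ Des w ∧ q ∉ Des w := by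
  simp [properBlocks]

theorem exists_block_start {w : List ℕ} {j : ℕ} (hj : j ∈ Des w) :
    ∃ p, 1 ≤ p ∧ p ≤ j ∧ (∀ i ∈ Finset.Ico p (j + 1), i ∈ Des w) ∧ p - 1 ∉ Des w := by
  induction j with
  | zero => simp [mem_Des] at hj
  | succ j ih =>
    by_cases h : j ∈ Des w
    · obtain ⟨p, h1, h2, h3, h4⟩ := ih h
      refine ⟨p, h1, by omega, fun i hi => ?_, h4⟩
      rw [Finset.mem_Ico] at hi
      rcases Nat.lt_or_ge i (j + 1) with h5 | h5
      · exact h3 i (by simp; omega)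
      · rwa [show i = j + 1 by omega]
    · refine ⟨j + 1, by omega, le_rfl, fun i hi => ?_, by simpa⟩
      rw [Finset.mem_Ico] at hi
      rwa [show i = j + 1 by omega]

theorem exists_block_end {w : List ℕ} {j : ℕ} (hj : j ∈ Des w) :
    ∃ r, j < r ∧ r ≤ w.length ∧ (∀ i ∈ Finset.Ico j r, i ∈ Des w) ∧ r ∉ Des w := by
  obtain ⟨k, hk⟩ : ∃ k, k + j = w.length := ⟨w.length - j, by have := (mem_Des.1 hj).1; omega⟩
  induction k generalizing j with
  | zero => have := (mem_Des.1 hj).1; omega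
  | succ k ih =>
    by_cases h : j + 1 ∈ Des w
    · obtain ⟨r, h1, h2, h3, h4⟩ := ih h (by omega)
      refine ⟨r, by omega, h2, fun i hi => ?_, h4⟩
      rw [Finset.mem_Ico] at hi
      rcases Nat.lt_or_ge j i with h5 | h5
      · exact h3 i (by simp; omega)
      · rwa [show i = j by omega]
    · refine ⟨j + 1, by omega, by omega, fun i hi => ?_, h⟩
      rw [Finset.mem_Ico] at hi
      rwa [show i = j by omega]

theorem exists_crossing {w : List ℕ} {p q y : ℕ} (hpq : p < q) (h1 : y ≤ letter w p)
    (h2 : letter w q < y) : ∃ j, p ≤ j ∧ j < q ∧ y ≤ letter w j ∧ letter w (j + 1) < y := by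
  induction q with
  | zero => omega
  | succ q ih =>
    by_cases h : letter w q < y
    · rcases Nat.lt_or_ge p q with h3 | h3
      · obtain ⟨j, h4⟩ := ih h3 h
        exact ⟨j, h4.1, by omega, h4.2.2⟩
      · rw [show p = q by omega] at h1; omega
    · exact ⟨q, by omega, by omega, by omega, h2⟩

/-- The embracing number counts the descents crossing the level of the letter on its right. -/
theorem embracing_eq (w : List ℕ) {i : ℕ} (hi : 1 ≤ i) :
    embracing w i = ((Des w).filter
      (fun j => i < j ∧ letter w i ≤ letter w j ∧ letter w (j + 1) < letter w i)).card := by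
  have hex : ∀ B : ℕ × ℕ, B ∈ (properBlocks w).filter
      (fun B => i < B.1 ∧ letter w i ≤ letter w B.1 ∧ letter w B.2 < letter w i) →
      ∃ j, B.1 ≤ j ∧ j < B.2 ∧ letter w i ≤ letter w j ∧ letter w (j + 1) < letter w i := by
    rintro ⟨p, r⟩ hB
    rw [Finset.mem_filter, mem_properBlocks] at hB
    exact exists_crossing hB.1.2.1 hB.2.2.1 hB.2.2.2
  -- Along a decreasing block the level of `w_i` is crossed by exactly one descent, and `f` selects
  -- it.
  choose! f hf using hex
  refine Finset.card_bij (fun B _ => f B) ?_ ?_ ?_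
  · rintro ⟨p, r⟩ hB
    obtain ⟨h1, h2, h3, h4⟩ := hf _ hB
    rw [Finset.mem_filter, mem_properBlocks] at hB
    rw [Finset.mem_filter]
    exact ⟨hB.1.2.2.1 _ (Finset.mem_Ico.2 ⟨h1, h2⟩), lt_of_lt_of_le hB.2.1 h1, h3, h4⟩
  · rintro ⟨p, r⟩ hB ⟨p', r'⟩ hB' he
    obtain ⟨h1, h2, -, -⟩ := hf _ hB
    obtain ⟨h1', h2', -, -⟩ := hf _ hB'
    rw [← he] at h1' h2'
    generalize f (p, r) = j at *
    rw [Finset.mem_filter, mem_properBlocks] at hB hB'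
    simp only at h1 h2 h1' h2'
    obtain ⟨⟨-, -, h3, h4, h5⟩, -⟩ := hB
    obtain ⟨⟨-, -, h3', h4', h5'⟩, -⟩ := hB'
    have e1 : p = p' := by
      rcases lt_trichotomy p p' with h | h | h
      · exact absurd (h3 (p' - 1) (by simp; omega)) h4'
      · exact h
      · exact absurd (h3' (p - 1) (by simp; omega)) h4
    have e2 : r = r' := by
      rcases lt_trichotomy r r' with h | h | h
      · exact absurd (h3' r (by simp; omega)) h5
      · exact h
      · exact absurd (h3 r' (by simp; omega)) h5'
    rw [e1, e2]
  · intro j hj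
    rw [Finset.mem_filter] at hj
    obtain ⟨hj, h1, h2, h3⟩ := hj
    obtain ⟨p, p1, p2, p3, p4⟩ := exists_block_start hj
    obtain ⟨r, r1, r2, r3, r4⟩ := exists_block_end hj
    have hall : ∀ k ∈ Finset.Ico p r, k ∈ Des w := by
      intro k hk
      rw [Finset.mem_Ico] at hk
      rcases Nat.lt_or_ge k (j + 1) with h | h
      · exact p3 k (by simp; omega)
      · exact r3 k (by simp; omega)
    -- If `i < j` lay inside the block, then `w_i > w_j`, contrary to the crossing condition `w_i ≤
    -- w_j`.
    have hip : i < p := by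
      by_contra h
      have := strictAnti_of_Des hall (i := i) (j := j) (by omega) h1 (by omega)
      omega
    have hB : (p, r) ∈ (properBlocks w).filter
        (fun B => i < B.1 ∧ letter w i ≤ letter w B.1 ∧ letter w B.2 < letter w i) := by
      rw [Finset.mem_filter, mem_properBlocks, mem_positions, mem_positions]
      refine ⟨⟨⟨by omega, by omega⟩, by omega, hall, p4, r4⟩, hip, ?_, ?_⟩
      · rcases p2.lt_or_eq with h | h
        · exact h2.trans (strictAnti_of_Des hall le_rfl h (by omega)).le
        · simpa [h] using h2
      · rcases (Nat.succ_le_of_lt r1).lt_or_eq with h | h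
        · exact (strictAnti_of_Des hall (i := j + 1) (by omega) h le_rfl).trans h3
        · simpa [← h] using h3
    refine ⟨(p, r), hB, ?_⟩
    obtain ⟨f1, f2, f3, f4⟩ := hf _ hB
    simp only at f1 f2
    rcases lt_trichotomy (f (p, r)) j with h | h | h
    · have := strictAnti_of_Des hall (i := f (p, r)) (j := j) f1 h (by omega)
      rcases (Nat.succ_le_of_lt h).lt_or_eq with h' | h'
      · have := strictAnti_of_Des hall (i := f (p, r) + 1) (j := j) (by omega) h' (by omega)
        omega
      · rw [← Nat.succ_eq_add_one, h'] at f4; omega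
    · exact h
    · rcases (Nat.succ_le_of_lt h).lt_or_eq with h' | h'
      · have := strictAnti_of_Des hall (i := j + 1) (j := f (p, r)) (by omega) h' (by omega)
        omega
      · rw [← h'] at f3; simp only [Nat.succ_eq_add_one] at f3; omega

/-- The contribution of a descent to `mak`. -/
def makTerm (w : List ℕ) (j : ℕ) : ℕ :=
  value w (j + 1) + ∑ i ∈ positions w,
    if i < j ∧ letter w i ≤ letter w j ∧ letter w (j + 1) < letter w i then 1 else 0

theorem mak_eq_sum (w : List ℕ) : mak w = ∑ j ∈ Des w, makTerm w j := by
  have h : Res w = ∑ j ∈ Des w, ∑ i ∈ positions w,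
      if i < j ∧ letter w i ≤ letter w j ∧ letter w (j + 1) < letter w i then 1 else 0 := by
    rw [Res, Finset.sum_comm]
    refine Finset.sum_congr rfl fun i hi => ?_
    rw [embracing_eq w (mem_positions.1 hi).1, Finset.card_filter]
  rw [mak, Dbot, h, ← Finset.sum_add_distrib]
  rfl

theorem value_eq (w : List ℕ) (j : ℕ) : value w (j + 1) = w.countP (· < letter w (j + 1)) + 1 +
    ∑ k ∈ Finset.range j, if letter w (k + 1) = letter w (j + 1) then 1 else 0 := by
  rw [value, height, Finset.card_filter, Finset.sum_Ico_eq_sum_range]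
  simp only [Nat.add_sub_cancel, add_comm 1]

/-- For an old descent with top `c` and bottom `d`, the new first letter raises the value of `d` if
`b ≤ d` and is embraced if `d < b ≤ c`. Together this adds one exactly when `b ≤ c`, which is what
`descTop` counts. -/
theorem mak_cons (b : ℕ) (l : List ℕ) : mak (b :: l) = mak l + descTop b l +
    if l.headD b < b then 1 + l.countP (· < l.headD b) else 0 := by
  rw [mak_eq_sum, mak_eq_sum, sum_Des_cons, descTop_eq_card, ← Finset.sum_add_distrib, add_comm]
  congr 1
  · refine Finset.sum_congr rfl fun j hj => ?_
    obtain ⟨⟨h1, -⟩, hd⟩ := mem_Des.1 hj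
    rw [makTerm, makTerm, value_eq, value_eq, sum_positions_cons, Finset.sum_range_succ',
      letter_cons_succ b l h1, letter_cons_succ b l (by omega : 1 ≤ j + 1), letter_cons_one,
      List.countP_cons]
    have e1 : ∑ k ∈ Finset.range j, (if letter (b :: l) (k + 1 + 1) = letter l (j + 1) then 1 else 0)
        = ∑ k ∈ Finset.range j, if letter l (k + 1) = letter l (j + 1) then 1 else 0 :=
      Finset.sum_congr rfl fun k _ => by rw [letter_cons_add_two]
    have e2 : ∑ i ∈ positions l, (if i + 1 < j + 1 ∧ letter (b :: l) (i + 1) ≤ letter l j ∧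
          letter l (j + 1) < letter (b :: l) (i + 1) then 1 else 0) =
        ∑ i ∈ positions l, if i < j ∧ letter l i ≤ letter l j ∧
          letter l (j + 1) < letter l i then 1 else 0 :=
      Finset.sum_congr rfl fun i hi => by
        rw [letter_cons_succ b l (mem_positions.1 hi).1]; simp only [Nat.add_lt_add_iff_right]
    rw [e1, e2]
    have e3 : (if b < letter l (j + 1) then 1 else 0) + (if b = letter l (j + 1) then 1 else 0) +
        (if 1 < j + 1 ∧ b ≤ letter l j ∧ letter l (j + 1) < b then 1 else 0) =
        if b ≤ letter l j then 1 else 0 := by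
      split_ifs <;> omega
    simp only [decide_eq_true_eq] at e3 ⊢
    omega
  · cases l with
    | nil => simp
    | cons y l =>
      by_cases h : (y :: l).headD b < b
      · rw [if_pos h, if_pos h, List.headD_cons]
        rw [List.headD_cons] at h
        rw [makTerm, value_eq, sum_positions_cons]
        have : b ≠ y := by omega
        rw [Finset.sum_eq_zero (s := positions (y :: l))]
        · rw [Finset.sum_range_one, letter_cons_one, letter_cons_add_two, letter_cons_one,
            if_neg this, List.countP_cons_of_neg (by simpa using h.le),
            if_neg fun h => absurd h.1 (lt_irrefl _)]
          omega
        · intro i hi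
          rw [if_neg (by omega)]
      · rw [if_neg h, if_neg h]

theorem makWeight_eq {A : Type*} [CommRing A] (q t : A) (z : ℕ → A) {B : ℕ} {w : List ℕ}
    (hw : ∀ b ∈ w, b < B) :
    makWeight q t z B w = t ^ des w * q ^ mak w * rlWeight z w := by
  induction w with
  | nil => simp [makWeight, des, Des, rlWeight, mak_eq_sum]
  | cons b l ih =>
    rw [makWeight, makFactor, ih fun a ha => hw a (by simp [ha]), des_cons, mak_cons, rlWeight,
      if_pos (hw b (by simp))]
    split_ifs <;> ring

end Translation

/-! ### The recursive weight computes `den` -/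

section DenTranslation

theorem map_letter_filter {a w : List ℕ} (h : a.length = w.length) :
    ((List.range' 1 w.length).filter (fun i => letter a i < letter w i)).map (letter w) =
        excPart a w ∧
      ((List.range' 1 w.length).filter (fun i => ¬ letter a i < letter w i)).map (letter w) =
        nexPart a w := by
  induction a generalizing w with
  | nil =>
    obtain rfl := List.length_eq_zero_iff.1 h.symm
    simp [excPart, nexPart]
  | cons x as ih =>
    rcases w with _ | ⟨b, w⟩
    · simp at h
    · obtain ⟨h1, h2⟩ := ih (w := w) (by simpa using h)
      have hpos : ∀ i ∈ List.range' 1 w.length, 1 ≤ i := fun i hi => (List.mem_range'_1.1 hi).1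
      have key : ∀ (p p' : ℕ → Bool), (∀ i, 1 ≤ i → p (1 + i) = p' i) →
          ((List.range' (1 + 1) w.length).filter p).map (letter (b :: w)) =
            ((List.range' 1 w.length).filter p').map (letter w) := by
        intro p p' hp
        rw [← List.map_add_range' (a := 1) (s := 1), List.filter_map, List.map_map,
          List.filter_congr (p := p ∘ (1 + ·)) (q := p') fun i hi => hp i (hpos i hi)]
        refine List.map_congr_left fun i hi => ?_
        rw [Function.comp_apply, add_comm, letter_cons_succ _ _ (hpos i (List.mem_filter.1 hi).1)]
      rw [List.length_cons, List.range'_succ, List.filter_cons, List.filter_cons, excPart, nexPart,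
        ← h1, ← h2]
      simp only [letter_cons_one]
      have e : ∀ i, 1 ≤ i → (letter (x :: as) (1 + i) < letter (b :: w) (1 + i) ↔
          letter as i < letter w i) := fun i hi => by
        rw [add_comm, letter_cons_succ _ _ hi, letter_cons_succ _ _ hi]
      constructor
      · rw [← key (fun i => letter (x :: as) i < letter (b :: w) i)
          (fun i => letter as i < letter w i) fun i hi => decide_eq_decide.2 (e i hi)]
        split_ifs <;> simp_all
      · rw [← key (fun i => ¬ letter (x :: as) i < letter (b :: w) i)
          (fun i => ¬ letter as i < letter w i) fun i hi => decide_eq_decide.2 (not_congr (e i hi))]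
        split_ifs <;> simp_all

theorem sum_positions_letter (l : List ℕ) (P : ℕ → Prop) [DecidablePred P] :
    (∑ j ∈ positions l, if P (letter l j) then 1 else 0) = l.countP (fun y => P y) := by
  induction l with
  | nil => simp [positions]
  | cons b l ih =>
    rw [sum_positions_cons, List.countP_cons, ← ih, letter_cons_one, add_comm]
    refine congrArg₂ _ (Finset.sum_congr rfl fun j hj => ?_) (by simp)
    rw [letter_cons_succ _ _ (mem_positions.1 hj).1]

theorem card_pairs_cons (r : ℕ → ℕ → Prop) [DecidableRel r] (b : ℕ) (l : List ℕ) :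
    ((positions (b :: l) ×ˢ positions (b :: l)).filter
        (fun p => p.1 < p.2 ∧ r (letter (b :: l) p.2) (letter (b :: l) p.1))).card =
      l.countP (fun y => r y b) + ((positions l ×ˢ positions l).filter
        (fun p => p.1 < p.2 ∧ r (letter l p.2) (letter l p.1))).card := by
  rw [Finset.card_filter, Finset.card_filter, Finset.sum_product, Finset.sum_product,
    sum_positions_cons, sum_positions_cons, ← sum_positions_letter l (fun y => r y b)]
  simp only [lt_irrefl, false_and, if_false, zero_add]
  refine congrArg₂ _ (Finset.sum_congr rfl fun j hj => ?_) (Finset.sum_congr rfl fun i hi => ?_)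
  · have h := (mem_positions.1 hj).1
    rw [letter_cons_succ _ _ h, letter_cons_one]
    exact if_congr (and_iff_right (by omega)) rfl rfl
  · rw [sum_positions_cons, if_neg (by omega), zero_add]
    refine Finset.sum_congr rfl fun j hj => ?_
    rw [letter_cons_succ _ _ (mem_positions.1 hi).1, letter_cons_succ _ _ (mem_positions.1 hj).1]
    simp only [Nat.add_lt_add_iff_right]

theorem inv_cons (b : ℕ) (l : List ℕ) : inv (b :: l) = l.countP (· < b) + inv l :=
  card_pairs_cons (· < ·) b l

theorem imv_cons (b : ℕ) (l : List ℕ) : imv (b :: l) = l.countP (· ≤ b) + imv l :=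
  card_pairs_cons (· ≤ ·) b l

variable {A : Type*} [CommRing A]

theorem nexWeight_eq (q : A) (z : ℕ → A) (u : List ℕ) :
    nexWeight q z u = q ^ inv u * rlWeight z u := by
  induction u with
  | nil => simp [nexWeight, rlWeight, inv, positions]
  | cons b l ih => rw [nexWeight, ih, inv_cons, rlWeight]; ring

theorem excWeight_eq (q t : A) {B : ℕ} (k : ℕ) {a w : List ℕ} (h : a.length = w.length)
    (hw : ∀ b ∈ w, b < B) : excWeight q t B (k + 1) a w =
      t ^ (∑ i ∈ positions w, if letter a i < letter w i then 1 else 0) *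
        q ^ ((∑ i ∈ positions w, if letter a i < letter w i then i + k else 0) +
          imv (excPart a w)) := by
  induction a generalizing w k with
  | nil =>
    obtain rfl := List.length_eq_zero_iff.1 h.symm
    simp [excWeight, excPart, positions, imv]
  | cons x as ih =>
    rcases w with _ | ⟨b, w⟩
    · simp at h
    · have e1 : ∑ i ∈ positions w, (if letter (x :: as) (i + 1) < letter (b :: w) (i + 1)
          then 1 else 0) = ∑ i ∈ positions w, if letter as i < letter w i then 1 else 0 :=
        Finset.sum_congr rfl fun i hi => by
          have := (mem_positions.1 hi).1
          rw [letter_cons_succ _ _ this, letter_cons_succ _ _ this]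
      have e2 : ∑ i ∈ positions w, (if letter (x :: as) (i + 1) < letter (b :: w) (i + 1)
          then i + 1 + k else 0) =
            ∑ i ∈ positions w, if letter as i < letter w i then i + (k + 1) else 0 :=
        Finset.sum_congr rfl fun i hi => by
          have := (mem_positions.1 hi).1
          rw [letter_cons_succ _ _ this, letter_cons_succ _ _ this, add_assoc, add_comm 1]
      rw [excWeight, ih (k + 1) (by simpa using h) fun y hy => hw y (by simp [hy]),
        sum_positions_cons, sum_positions_cons, e1, e2, letter_cons_one, letter_cons_one, excPart,
        countLe, if_pos (hw b (by simp))]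
      split_ifs
      · rw [imv_cons]; ring
      · ring

/-- Omitting the excedances does not change the right-to-left minima. -/
theorem rlWeight_nexPart_aux (z : ℕ → A) {a w : List ℕ} (h : a.length = w.length)
    (ha : a.Pairwise (· ≤ ·))
    (hc : ∀ y, a.headD 0 < y → w.countP (y ≤ ·) ≤ a.countP (y ≤ ·)) :
    rlWeight z (nexPart a w) = rlWeight z w ∧
      ∀ c, (∀ y ∈ nexPart a w, c ≤ y) ↔ ∀ y ∈ w, c ≤ y := by
  induction a generalizing w with
  | nil => simp [nexPart]
  | cons x as ih =>
    rcases w with _ | ⟨b, w⟩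
    · simp at h
    · rw [List.pairwise_cons] at ha
      have hl : as.length = w.length := by simpa using h
      -- Only levels above the head of `a` are considered, so dropping that head costs nothing in
      -- the count on the right.
      have hcount : ∀ y, x < y → (b :: w).countP (y ≤ ·) ≤ as.countP (y ≤ ·) := by
        intro y hy
        have := hc y hy
        rwa [List.countP_cons (l := as), if_neg (by simpa using hy), add_zero] at this
      obtain ⟨h1, h2⟩ := ih hl ha.2 (by
        intro y hy
        rcases as with _ | ⟨x', as⟩
        · rw [List.length_eq_zero_iff.1 hl.symm]
        · have hx : x ≤ x' := ha.1 x' (by simp)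
          have h3 : x' < y := hy
          refine le_trans ?_ (hcount y (by omega))
          rw [List.countP_cons]
          exact Nat.le_add_right _ _)
      rw [nexPart]
      split_ifs with hb
      -- Otherwise `b :: w` would have `w.length + 1` letters that are at least `b`, more than `as`
      -- has letters. So an excedance has a smaller letter to its right and is never a right-to-left
      -- minimum.
      · have hex : ∃ y ∈ w, y < b := by
          by_contra hne
          push Not at hne
          have h3 := hcount b hb
          have h4 : w.countP (b ≤ ·) = w.length :=
            List.countP_eq_length.2 fun y hy => by simpa using hne y hy
          have h5 := List.countP_le_length (p := fun y => decide (b ≤ y)) (l := as)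
          rw [List.countP_cons, h4] at h3
          simp at h3
          omega
        obtain ⟨y, hy, hyb⟩ := hex
        refine ⟨?_, fun c => ?_⟩
        · rw [rlWeight, h1, if_neg fun h => absurd (h y hy) (by omega), one_mul]
        · rw [h2, List.forall_mem_cons]
          exact ⟨fun h => ⟨(h y hy).trans hyb.le, h⟩, fun h => h.2⟩
      · refine ⟨?_, fun c => ?_⟩
        · rw [rlWeight, rlWeight, h1]
          simp only [h2]
        · rw [List.forall_mem_cons, List.forall_mem_cons, h2]

theorem rearr_eq_sort (w : List ℕ) : rearr w = (w : Multiset ℕ).sort (· ≤ ·) := by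
  refine List.Perm.eq_of_pairwise' (r := (· ≤ ·)) (List.pairwise_insertionSort _ _)
    (Multiset.pairwise_sort _ _) ?_
  rw [← Multiset.coe_eq_coe, Multiset.sort_eq, Multiset.coe_eq_coe]
  exact List.perm_insertionSort _ _

theorem denWeight_eq (q t : A) (z : ℕ → A) {B : ℕ} {w : List ℕ} (hw : ∀ b ∈ w, b < B) :
    denWeight q t z B (rearr w) w = t ^ exc w * q ^ den w * rlWeight z w := by
  have hl : (rearr w).length = w.length := List.length_insertionSort _ _
  obtain ⟨h1, h2⟩ := map_letter_filter hl
  have hExc : ∀ i ∈ List.range' 1 w.length, (i ∈ Exc w ↔ letter (rearr w) i < letter w i) := by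
    intro i hi
    rw [List.mem_range'_1] at hi
    rw [Exc, Finset.mem_filter, mem_positions]
    exact and_iff_right (by omega)
  have e1 : excl w = excPart (rearr w) w := by
    rw [← h1, excl, List.filter_congr fun i hi => decide_eq_decide.2 (hExc i hi)]
  have e2 : nexcl w = nexPart (rearr w) w := by
    rw [← h2, nexcl, List.filter_congr fun i hi => decide_eq_decide.2 (not_congr (hExc i hi))]
  have h3 := (rlWeight_nexPart_aux z hl (List.pairwise_insertionSort _ _) fun y _ =>
    ((List.perm_insertionSort (· ≤ ·) w).countP_eq _).ge).1
  rw [denWeight, ← zero_add 1, excWeight_eq q t 0 hl hw, nexWeight_eq, h3, den, e1, e2, exc, Exc,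
    Finset.card_filter, Finset.sum_filter]
  simp only [add_zero]
  ring

end DenTranslation

/-! ### Extracting the coefficient that belongs to `R` -/

section Coefficients

open MvPolynomial

theorem prod_map_X_eq_monomial {K : Type*} [CommSemiring K] (s : Multiset ℕ) :
    (s.map (X : ℕ → MvPolynomial ℕ K)).prod = monomial (Multiset.toFinsupp s) 1 := by
  induction s using Multiset.induction_on with
  | empty => simp
  | cons a s ih =>
    rw [Multiset.map_cons, Multiset.prod_cons, ih, ← Multiset.singleton_add, map_add,
      Multiset.toFinsupp_singleton, X, monomial_mul, one_mul]

theorem coeff_sum_C_mul_Rlwmin {K : Type*} [CommSemiring K] (S : Finset (List ℕ))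
    (F : List ℕ → K) (R : Multiset ℕ) :
    coeff (Multiset.toFinsupp R)
        (∑ w ∈ S, C (F w) * ((Rlwmin w).map (X : ℕ → MvPolynomial ℕ K)).prod) =
      ∑ w ∈ S.filter (fun w => Rlwmin w = R), F w := by
  rw [coeff_sum, Finset.sum_filter]
  refine Finset.sum_congr rfl fun w _ => ?_
  rw [prod_map_X_eq_monomial, coeff_C_mul, coeff_monomial, mul_ite, mul_one, mul_zero]
  exact if_congr Multiset.toFinsupp.injective.eq_iff rfl rfl

theorem one_sub_X_pow_ne_zero (k : ℕ) : (1 - X 1 ^ (k + 1) : MvPolynomial (Fin 2) ℤ) ≠ 0 := by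
  intro h
  have := congrArg (eval (fun _ => (0 : ℤ))) h
  simp at this

theorem sum_C_mul_Rlwmin_eq (s : Multiset ℕ) :
    (∑ w ∈ perms s, C (X 0 ^ des w * X 1 ^ maj w) * ((Rlwmin w).map X).prod :
        MvPolynomial ℕ (MvPolynomial (Fin 2) ℤ)) =
        ∑ w ∈ perms s, C (X 0 ^ exc w * X 1 ^ den w) * ((Rlwmin w).map X).prod ∧
      (∑ w ∈ perms s, C (X 0 ^ exc w * X 1 ^ den w) * ((Rlwmin w).map X).prod :
        MvPolynomial ℕ (MvPolynomial (Fin 2) ℤ)) =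
        ∑ w ∈ perms s, C (X 0 ^ des w * X 1 ^ mak w) * ((Rlwmin w).map X).prod := by
  obtain ⟨B, hB⟩ : ∃ B, ∀ b ∈ s, b + 1 < B :=
    ⟨s.sum + 2, fun b hb => by have := Multiset.le_sum_of_mem hb; omega⟩
  let q : MvPolynomial ℕ (MvPolynomial (Fin 2) ℤ) := C (X 1)
  let t : MvPolynomial ℕ (MvPolynomial (Fin 2) ℤ) := C (X 0)
  -- The shift acts on coefficients only, sending `t` to `q * t` and fixing `q`; the variables
  -- marking the minima are left alone, as `hz` requires.
  let σ : MvPolynomial (Fin 2) ℤ →+* MvPolynomial (Fin 2) ℤ :=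
    eval₂Hom C ![X 1 * X 0, X 1]
  have hq : MvPolynomial.map σ q = q := by simp [q, σ]
  have ht : MvPolynomial.map σ t = q * t := by simp [q, t, σ]
  have hq1 : ∀ k, 1 - q ^ (k + 1) ≠ 0 := by
    intro k
    have h : (1 - q ^ (k + 1)) = C (1 - X 1 ^ (k + 1)) := by simp [q]
    rw [h]
    exact (map_ne_zero_iff _ (C_injective _ _)).2 (one_sub_X_pow_ne_zero k)
  have key := sum_weights_eq (τ := MvPolynomial.map σ) (z := X) hq ht (fun x => map_X _ x) hq1 hB
  have hletter : ∀ w ∈ perms s, ∀ b ∈ w, b < B := by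
    intro w hw b hb
    rw [mem_perms] at hw
    have := hB b (by rw [← hw]; simpa using hb)
    omega
  have e1 : ∀ w ∈ perms s, C (X 0 ^ des w * X 1 ^ maj w) * ((Rlwmin w).map X).prod =
      majWeight q t w.reverse * rlWeight X w := by
    intro w _
    rw [majWeight_eq, List.reverse_reverse, rlWeight_eq]
    simp [q, t]
  have e2 : ∀ w ∈ perms s, C (X 0 ^ exc w * X 1 ^ den w) * ((Rlwmin w).map X).prod =
      denWeight q t X B (s.sort (· ≤ ·)) w := by
    intro w hw
    have h := mem_perms.1 hw
    rw [← h, ← rearr_eq_sort, denWeight_eq q t X (hletter w hw), rlWeight_eq]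
    simp [q, t]
  have e3 : ∀ w ∈ perms s, C (X 0 ^ des w * X 1 ^ mak w) * ((Rlwmin w).map X).prod =
      makWeight q t X B w := by
    intro w hw
    rw [makWeight_eq q t X (hletter w hw), rlWeight_eq]
    simp [q, t]
  rw [Finset.sum_congr rfl e1, Finset.sum_congr rfl e2, Finset.sum_congr rfl e3]
  exact key

end Coefficients

end WordStat

theorem theorem2p2 {n : ℕ} (α : Composition n) (R : Multiset ℕ) :
    (∑ w ∈ WordStat.wordsR α R,
        (MvPolynomial.X 0 ^ WordStat.des w * MvPolynomial.X 1 ^ WordStat.maj w :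
          MvPolynomial (Fin 2) ℤ)) =
      ∑ w ∈ WordStat.wordsR α R,
        MvPolynomial.X 0 ^ WordStat.exc w * MvPolynomial.X 1 ^ WordStat.den w ∧
    (∑ w ∈ WordStat.wordsR α R,
        (MvPolynomial.X 0 ^ WordStat.exc w * MvPolynomial.X 1 ^ WordStat.den w :
          MvPolynomial (Fin 2) ℤ)) =
      ∑ w ∈ WordStat.wordsR α R,
        MvPolynomial.X 0 ^ WordStat.des w * MvPolynomial.X 1 ^ WordStat.mak w := by
  obtain ⟨h1, h2⟩ := WordStat.sum_C_mul_Rlwmin_eq (WordStat.contentMultiset α)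
  have hcoeff := fun F => WordStat.coeff_sum_C_mul_Rlwmin (K := MvPolynomial (Fin 2) ℤ)
    (WordStat.perms (WordStat.contentMultiset α)) F R
  exact ⟨((hcoeff _).symm.trans (congrArg (MvPolynomial.coeff _) h1)).trans (hcoeff _),
    ((hcoeff _).symm.trans (congrArg (MvPolynomial.coeff _) h2)).trans (hcoeff _)⟩
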